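/- **Conventions.** Let $k$ be a commutative ring. $\mathbf{Mod}(k)$ is the category of $k$-modules, and $\mathbf{Pro}(k)=\mathrm{Ind}(\mathbf{Mod}(k)^{op})^{op}$ is the category of pro-modules. For a pro-module $A$ and a module $T$ put $\langle A,T\rangle=\mathrm{Hom}_{\mathbf{Pro}(k)}(A,T)$, a $k$-module. A pro-module $P$ is *quasi-projective* if $\langle P,-\rangle:\mathbf{Mod}(k)\to\mathbf{Mod}(k)$ is exact, and $k$ is *quasi-noetherian* if $\langle P,T\rangle$ is an injective $k$-module for every quasi-projective $P$ and every injective $T$. We assume that $k$ is quasi-noetherian. For a small category $\mathbf I$, a functor $F:\mathbf I\to\mathbf{Pro}(k)$ is quasi-projective if $\langle F,T\rangle$ is injective in $\mathbf{Mod}(k)^{\mathbf I^{op}}$ for every injective $T$. A *cosheaf* (of pro-modules) on a space $X$ is a functor $\mathcal A$ from the open sets of $X$ to $\mathbf{Pro}(k)$ such that $\varinjlim_{(V\to U)\in R}\mathcal A(V)\to\mathcal A(U)$ is an isomorphism for every covering sieve $R$ of every open $U$; they form the category $\mathbf{CS}(X,\mathbf{Pro}(k))$. A cosheaf $\mathcal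 A$ is quasi-projective if the sheaf $\langle\mathcal A,T\rangle$ is injective in the category of sheaves of $k$-modules for every injective $T$. For a continuous map $f:X\to Y$ let $(f_*\mathcal A)(U)=\mathcal A(f^{-1}U)$. The functors $\varinjlim_n$ on $\mathbf{Pro}(k)^{\mathbf I}$ and $H_n(X,-)$ on $\mathbf{CS}(X,\mathbf{Pro}(k))$ are the left satellites of $\varinjlim$ and of $\Gamma(X,\mathcal A)=\mathcal A(X)$: $\varinjlim_nF=H_n(\varinjlim P_\bullet)$ and $H_n(X,\mathcal A)=H_n(\Gamma(X,\mathcal P_\bullet))$, where $P_\bullet\to F$ and $\mathcal P_\bullet\to\mathcal A$ are quasi-projective resolutions. They are functorial in pairs $(\mathbf I,F)$, a morphism $(\mathbf I,F)\to(\mathbf J,G)$ being a functor $\varphi:\mathbf I\to\mathbf J$ with a natural transformation $F\to G\circ\varphi$, and in pairs $(X,\mathcal A)$ (with $X$ as below), a morphism $(X,\mathcal A)\to(Y,\mathcal B)$ being a continuous map $f$ with a morphism $f_*\mathcal A\to\mathcal B$. A preordered set $(X,\le)$ is also regarded as a category $\mathbf X$ (one arrow $x\to y$ when $x\le y$) and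 as an Alexandroff space, whose open sets are the lower sets. **Theorem.** Every functor $\mathbf I\to\mathbf{Pro}(k)$ on a small category, and every cosheaf of pro-modules on the Alexandroff space of a preordered set, has a quasi-projective resolution; the functors $\varinjlim_n$ and $H_n$ above exist and are unique up to natural isomorphism. Moreover: 1. For every preordered set $X$ the rule $F\mapsto\mathcal F$, $\mathcal F(U)=\varinjlim(F|_U)$, is an equivalence of categories $\mathbf{Pro}(k)^{\mathbf X}\to\mathbf{CS}(X,\mathbf{Pro}(k))$. 2. For every $n\ge0$ there is an isomorphism $\varinjlim_nF\cong H_n(X,\mathcal F)$, natural in $X$ and $F$. 3. For every small category $\mathbf I$ and $n\ge0$ there is an isomorphism $\varinjlim_nF\cong H_n(C_\bullet(\mathbf I,F))$, natural in $F\in\mathbf{Pro}(k)^{\mathbf I}$, where $$C_n(\mathbf I,F)=\bigoplus_{i_0\to i_1\to\dots\to i_n}F(i_0),$$ with inclusions $\rho_{i_0\to\dots\to i_n}$ of the summands, and $d_n:C_{n+1}(\mathbf I,F)\to C_n(\mathbf I,F)$ is given by $$d_n\circ\rho_{i_0\to\dots\to i_{n+1}}=\rho_{i_1\to\dots\to i_{n+1}}\circ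 F(i_0\to i_1)+\sum_{j=1}^{n+1}(-1)^j\rho_{i_0\to\dots\to\widehat{i_j}\to\dots\to i_{n+1}}.$$ 4. Let $X$ be a preordered set, let $\widehat X=X/R$ where $xRy\iff(x\le y\text{ and }y\le x)$, with the induced partial order, and let $\nu_X:X\to\widehat X$ be the projection. (a) $\mathcal A\mapsto\widehat{\mathcal A}$, $\widehat{\mathcal A}(U)=\mathcal A(\nu_X^{-1}U)$, is an equivalence of categories $\mathbf{CS}(X,\mathbf{Pro}(k))\to\mathbf{CS}(\widehat X,\mathbf{Pro}(k))$. (b) For every $n\ge0$ the morphisms $(\nu_X,\mathrm{id}):(X,\mathcal A)\to(\widehat X,\widehat{\mathcal A})$ induce an isomorphism $H_n(X,\mathcal A)\cong H_n(\widehat X,\widehat{\mathcal A})$, natural in $X$ and $\mathcal A$. (c) For every functor $\widehat F:\widehat{\mathbf X}\to\mathbf{Pro}(k)$ (in particular for every $\widehat F:\widehat{\mathbf X}\to\mathbf{Mod}(k)$) and every $n\ge0$, the map $\varinjlim_n(\widehat F\circ\nu_X)\to\varinjlim_n\widehat F$ induced by $\nu_X$ is an isomorphism. -/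

import Mathlib

open CategoryTheory Limits

universe v u

section
variable {C : Type u} [Category.{v} C]

theorem preservesFiniteLimits_of_isIndObject {A : Cᵒᵖ ⥤ Type v} (hA : IsIndObject A) :
    PreservesFiniteLimits A := by
  obtain ⟨⟨P⟩⟩ := hA
  have : PreservesFiniteLimits (P.F ⋙ yoneda).flip := by
    refine ⟨fun J _ _ => ⟨fun {K} => ?_⟩⟩
    apply preservesLimit_of_evaluation
    intro i
    exact inferInstanceAs (PreservesLimit K (yoneda.obj (P.F.obj i)))
  have e : (P.F ⋙ yoneda).flip ⋙ colim ≅ A :=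
    (colimitIsoFlipCompColim _).symm ≪≫
      IsColimit.coconePointUniqueUpToIso (colimit.isColimit _) P.isColimit
  have : PreservesFiniteLimits ((P.F ⋙ yoneda).flip ⋙ colim) := comp_preservesFiniteLimits _ _
  exact preservesFiniteLimits_of_natIso e

/-- Ind-objects as left exact functors. -/
noncomputable def indToLeftExact : Ind C ⥤ (Cᵒᵖ ⥤ₗ Type v) :=
  ObjectProperty.lift _ (Ind.inclusion C)
    (fun X => preservesFiniteLimits_of_isIndObject (Ind.isIndObject_inclusion_obj X))

noncomputable def indToLeftExactFullyFaithful : (indToLeftExact (C := C)).FullyFaithful :=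
  .ofCompFaithful (G := ObjectProperty.ι _) Ind.inclusion.fullyFaithful
variable [Abelian C]

attribute [local instance] HasFiniteBiproducts.of_hasFiniteProducts in
@[reducible]
noncomputable def indPreadditive : Preadditive (Ind C) :=
  .ofFullyFaithful ((indToLeftExactFullyFaithful.comp
    (AddCommGrpCat.leftExactFunctorForgetEquivalence Cᵒᵖ).symm.fullyFaithfulFunctor).comp
      (ObjectProperty.fullyFaithfulι _))

attribute [local instance] indPreadditive

open CategoryTheory.Abelian in
@[reducible]
noncomputable def indAbelian : Abelian (Ind C) :=
  have : HasFiniteBiproducts (Ind C) := HasFiniteBiproducts.of_hasFiniteCoproducts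
  have : ∀ {X Y : Ind C} (f : X ⟶ Y), IsIso (coimageImageComparison f) := by
    intro X Y f
    obtain ⟨I, _, _, F, G, ϕ, ⟨i⟩⟩ := Ind.exists_nonempty_arrow_mk_iso_ind_lim (f := f)
    let i' : Arrow.mk (coimageImageComparison f) ≅
        Arrow.mk (coimageImageComparison ((Ind.lim I).map ϕ)) :=
      coimageImageComparisonFunctor.mapIso i
    have := Iso.isIso_hom i'
    rw [Arrow.isIso_iff_isIso_of_isIso i'.hom,
      Arrow.isIso_iff_isIso_of_isIso (PreservesCoimageImageComparison.iso (Ind.lim I) ϕ).inv]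
    infer_instance
  .ofCoimageImageComparisonIsIso
end

/-- The category of pro-modules: `Pro(k) = Ind(Mod(k)ᵒᵖ)ᵒᵖ`. -/
def ProMod (k : Type u) [CommRing k] : Type (u + 1) := (Ind (ModuleCat.{u} k)ᵒᵖ)ᵒᵖ
namespace ProMod
variable (k : Type u) [CommRing k]

noncomputable instance : Category.{u} (ProMod k) :=
  inferInstanceAs <| Category.{u} (Ind (ModuleCat.{u} k)ᵒᵖ)ᵒᵖ

noncomputable instance : Abelian (ProMod k) :=
  letI : Abelian (Ind (ModuleCat.{u} k)ᵒᵖ) := indAbelian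
  inferInstanceAs <| Abelian (Ind (ModuleCat.{u} k)ᵒᵖ)ᵒᵖ

instance : HasColimits (ProMod k) :=
  inferInstanceAs <| HasColimits (Ind (ModuleCat.{u} k)ᵒᵖ)ᵒᵖ

instance : HasLimits (ProMod k) :=
  inferInstanceAs <| HasLimits (Ind (ModuleCat.{u} k)ᵒᵖ)ᵒᵖ

/-- The embedding of modules into pro-modules. -/
noncomputable def ι : ModuleCat.{u} k ⥤ ProMod k :=
  (Ind.yoneda (C := (ModuleCat.{u} k)ᵒᵖ)).rightOp

instance : (ι k).Full := inferInstanceAs <| (Ind.yoneda (C := (ModuleCat.{u} k)ᵒᵖ)).rightOp.Full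
instance : (ι k).Faithful := inferInstanceAs <| (Ind.yoneda (C := (ModuleCat.{u} k)ᵒᵖ)).rightOp.Faithful

instance : (ι k).Additive := by
  have : PreservesLimitsOfShape (Discrete WalkingPair) (ι k) :=
    preservesLimitsOfShape_rightOp _ (Ind.yoneda (C := (ModuleCat.{u} k)ᵒᵖ))
  exact Functor.additive_of_preserves_binary_products _
end ProMod
namespace ProMod
variable {k : Type u} [CommRing k]

/-- `Hom(A, T)` as a `k`-module, for a pro-module `A` and a module `T`. -/
noncomputable instance homModule (A : ProMod k) (T : ModuleCat.{u} k) :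
    Module k (A ⟶ (ι k).obj T) where
  smul r f := f ≫ (ι k).map (r • 𝟙 T)
  one_smul f := by
    change f ≫ (ι k).map ((1 : k) • 𝟙 T) = f
    simp
  mul_smul r s f := by
    change f ≫ (ι k).map ((r * s) • 𝟙 T) = (f ≫ (ι k).map (s • 𝟙 T)) ≫ (ι k).map (r • 𝟙 T)
    rw [Category.assoc, ← Functor.map_comp]
    simp [mul_smul]
  smul_zero r := by
    change (0 : A ⟶ (ι k).obj T) ≫ (ι k).map (r • 𝟙 T) = 0
    simp
  smul_add r f g := by
    change (f + g) ≫ (ι k).map (r • 𝟙 T) = f ≫ (ι k).map (r • 𝟙 T) + g ≫ (ι k).map (r • 𝟙 T)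
    simp
  add_smul r s f := by
    change f ≫ (ι k).map ((r + s) • 𝟙 T) = f ≫ (ι k).map (r • 𝟙 T) + f ≫ (ι k).map (s • 𝟙 T)
    rw [add_smul, Functor.map_add, Preadditive.comp_add]
  zero_smul f := by
    change f ≫ (ι k).map ((0 : k) • 𝟙 T) = 0
    simp

theorem smul_def {A : ProMod k} {T : ModuleCat.{u} k} (r : k) (f : A ⟶ (ι k).obj T) :
    r • f = f ≫ (ι k).map (r • 𝟙 T) := rfl

/-- The functor `⟨-, T⟩ = Hom(-, T)` from pro-modules to modules. -/
noncomputable def pairing (T : ModuleCat.{u} k) : (ProMod k)ᵒᵖ ⥤ ModuleCat.{u} k where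
  obj A := ModuleCat.of k (A.unop ⟶ (ι k).obj T)
  map g := ModuleCat.ofHom
    { toFun := fun f => g.unop ≫ f
      map_add' := fun f f' => by simp
      map_smul' := fun r f => by simp [smul_def] }

/-- The functor `Hom(P, -)` from modules to modules. -/
noncomputable def homFrom (P : ProMod k) : ModuleCat.{u} k ⥤ ModuleCat.{u} k where
  obj T := ModuleCat.of k (P ⟶ (ι k).obj T)
  map t := ModuleCat.ofHom
    { toFun := fun f => f ≫ (ι k).map t
      map_add' := fun f f' => by simp
      map_smul' := fun r f => by
        simp only [smul_def, RingHom.id_apply, Category.assoc, ← Functor.map_comp]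
        simp }

/-- A pro-module `P` is quasi-projective when `Hom(P, -) : Mod(k) ⥤ Mod(k)` is exact. -/
def IsQuasiProjective (P : ProMod k) : Prop :=
  PreservesFiniteLimits (homFrom P) ∧ PreservesFiniteColimits (homFrom P)

end ProMod

/-- A ring is quasi-noetherian when `Hom(P, T)` is an injective module for each quasi-projective
pro-module `P` and each injective module `T`. -/
def IsQuasiNoetherian (k : Type u) [CommRing k] : Prop :=
  ∀ (P : ProMod k) (T : ModuleCat.{u} k), P.IsQuasiProjective → Injective T →
    Injective ((ProMod.pairing T).obj (Opposite.op P))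

section
variable {C : Type*} [Category* C] {K : Type*} [Category* K] (J : GrothendieckTopology C)

/-- A functor `A` is a cosheaf when `colim_{(V ⟶ U) ∈ R} A(V) ⟶ A(U)` is an isomorphism for each
covering sieve `R` of each object `U`. -/
def IsCosheaf : ObjectProperty (C ⥤ K) := fun A =>
  ∀ (U : C) (R : Sieve U), R ∈ J U → Nonempty (IsColimit (A.mapCocone R.arrows.cocone))

end

section
variable {C : Type*} [Category* C] {K : Type*} [Category* K] (J : GrothendieckTopology C)
theorem isCosheaf_iff_isSheaf_op (A : C ⥤ K) : IsCosheaf J A ↔ Presheaf.IsSheaf J A.op := by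
  rw [Presheaf.isSheaf_iff_isLimit]
  refine forall_congr' fun U => forall_congr' fun R => forall_congr' fun _ => ?_
  exact ⟨fun ⟨h⟩ => ⟨(show IsLimit (A.mapCocone R.arrows.cocone).op from h.op)⟩,
    fun ⟨h⟩ => ⟨isColimitOfOp (show IsLimit (A.mapCocone R.arrows.cocone).op from h)⟩⟩
end
section
variable {C : Type u} [SmallCategory C] (J : GrothendieckTopology C) {k : Type u} [CommRing k]

theorem isSheaf_pairing {A : C ⥤ ProMod k} (hA : IsCosheaf J A) (T : ModuleCat.{u} k) :
    Presheaf.IsSheaf J (A.op ⋙ ProMod.pairing T) := by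
  rw [Presheaf.isSheaf_iff_isSheaf_forget J _ (forget (ModuleCat.{u} k))]
  exact Presheaf.isSheaf_comp_of_isSheaf J A.op (yoneda.obj ((ProMod.ι k).obj T)) ((isCosheaf_iff_isSheaf_op J A).1 hA)
end

open TopologicalSpace Topology Opposite

/-- The category of cosheaves of pro-modules on a topological space. -/
abbrev Cosheaf (X : TopCat.{u}) (k : Type u) [CommRing k] :=
  (IsCosheaf (Opens.grothendieckTopology X) (K := ProMod k)).FullSubcategory

namespace Cosheaf
variable {k : Type u} [CommRing k]

/-- A cosheaf `A` is quasi-projective when `⟨A, T⟩` is an injective sheaf of modules for each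
injective module `T`. -/
def IsQuasiProjective {X : TopCat.{u}} (A : Cosheaf X k) : Prop :=
  ∀ T : ModuleCat.{u} k, Injective T →
    Injective (⟨A.obj.op ⋙ ProMod.pairing T, isSheaf_pairing _ A.property T⟩ :
      Sheaf (Opens.grothendieckTopology X) (ModuleCat.{u} k))

/-- The functor `f_*`, with `(f_* A)(U) = A(f⁻¹ U)`. -/
noncomputable def pushforward (k : Type u) [CommRing k] {X Y : TopCat.{u}} (f : X ⟶ Y) : Cosheaf X k ⥤ Cosheaf Y k :=
  ObjectProperty.lift _
    (ObjectProperty.ι _ ⋙ (Functor.whiskeringLeft _ _ _).obj (Opens.map f))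
    (fun A => by
      rw [isCosheaf_iff_isSheaf_op]
      exact (Opens.map f).op_comp_isSheaf_of_isSheaf _ _ _
        ((isCosheaf_iff_isSheaf_op _ _).1 A.property))

/-- The functor of global cosections. -/
noncomputable def Γ (k : Type u) [CommRing k] (X : TopCat.{u}) : Cosheaf X k ⥤ ProMod k :=
  ObjectProperty.ι _ ⋙ (evaluation _ _).obj ⊤

instance additive_Γ (X : TopCat.{u}) : (Γ k X).Additive where
instance additive_pushforward {X Y : TopCat.{u}} (f : X ⟶ Y) : (pushforward k f).Additive where

end Cosheaf

section
variable {k : Type u} [CommRing k] {X : Type u} [Preorder X]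

/-- The Alexandroff space of a preordered set: the open sets are the lower sets. -/
abbrev aSpace (X : Type u) [Preorder X] : TopCat.{u} := TopCat.of (WithLowerSet X)

/-- The points of an open set, with the preorder of `X`. -/
abbrev pts (U : Opens (aSpace X)) : Type u := {x : X // WithLowerSet.toLowerSet x ∈ U}

abbrev ptsIncl (U : Opens (aSpace X)) : pts U ⥤ X := (Subtype.mono_coe _).functor

/-- The pro-module `colim F|_U`. -/
noncomputable abbrev colimOn (F : X ⥤ ProMod k) (U : Opens (aSpace X)) : ProMod k :=
  colimit (ptsIncl U ⋙ F)

/-- The canonical map `F x ⟶ colim F|_U` for a point `x` of `U`. -/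
noncomputable def inOn (F : X ⥤ ProMod k) (U : Opens (aSpace X)) (x : X)
    (hx : WithLowerSet.toLowerSet x ∈ U) : F.obj x ⟶ colimOn F U :=
  colimit.ι (ptsIncl U ⋙ F) ⟨x, hx⟩

theorem map_inOn (F : X ⥤ ProMod k) (U : Opens (aSpace X)) {x y : X} (f : x ⟶ y)
    (hx : WithLowerSet.toLowerSet x ∈ U) (hy : WithLowerSet.toLowerSet y ∈ U) :
    F.map f ≫ inOn F U y hy = inOn F U x hx :=
  colimit.w (ptsIncl U ⋙ F) (homOfLE f.le : (⟨x, hx⟩ : pts U) ⟶ ⟨y, hy⟩)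

theorem colimOn_hom_ext {F : X ⥤ ProMod k} {U : Opens (aSpace X)} {Z : ProMod k}
    {f g : colimOn F U ⟶ Z} (h : ∀ x hx, inOn F U x hx ≫ f = inOn F U x hx ≫ g) : f = g :=
  colimit.hom_ext fun x => h x.1 x.2

noncomputable def descOn (F : X ⥤ ProMod k) (U : Opens (aSpace X)) {Z : ProMod k}
    (a : ∀ x : X, WithLowerSet.toLowerSet x ∈ U → (F.obj x ⟶ Z))
    (w : ∀ (x y : X) (f : x ⟶ y) hx hy, F.map f ≫ a y hy = a x hx) : colimOn F U ⟶ Z :=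
  colimit.desc (ptsIncl U ⋙ F) ⟨Z,
    { app := fun x => a x.1 x.2
      naturality := fun x y f =>
        (w x.1 y.1 (homOfLE f.le) x.2 y.2).trans (Category.comp_id _).symm }⟩

@[simp]
theorem inOn_descOn (F : X ⥤ ProMod k) (U : Opens (aSpace X)) {Z : ProMod k}
    (a : ∀ x : X, WithLowerSet.toLowerSet x ∈ U → (F.obj x ⟶ Z)) (w) (x : X)
    (hx : WithLowerSet.toLowerSet x ∈ U) : inOn F U x hx ≫ descOn F U a w = a x hx :=
  colimit.ι_desc _ _

@[simp]
theorem inOn_descOn_assoc (F : X ⥤ ProMod k) (U : Opens (aSpace X)) {Z W : ProMod k}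
    (a : ∀ x : X, WithLowerSet.toLowerSet x ∈ U → (F.obj x ⟶ Z)) (w) (x : X)
    (hx : WithLowerSet.toLowerSet x ∈ U) (g : Z ⟶ W) :
    inOn F U x hx ≫ descOn F U a w ≫ g = a x hx ≫ g :=
  (Category.assoc _ _ _).symm.trans (eq_whisker (inOn_descOn F U a w x hx) g)

/-- The functor `F ↦ (U ↦ colim F|_U)`. -/
noncomputable def colimPrecosheaf : (X ⥤ ProMod k) ⥤ Opens (aSpace X) ⥤ ProMod k where
  obj F :=
    { obj := fun U => colimOn F U
      map := fun {U V} h => descOn F U (fun x hx => inOn F V x (h.le hx))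
        (fun x y f _ _ => map_inOn F V f _ _)
      map_id := fun U => colimOn_hom_ext fun x hx => by simp
      map_comp := fun f g => colimOn_hom_ext fun x hx => by simp }
  map {F G} α :=
    { app := fun U => descOn F U (fun x hx => α.app x ≫ inOn G U x hx)
        (fun x y f hx hy => by rw [α.naturality_assoc, map_inOn G U f hx hy])
      naturality := fun U V h => colimOn_hom_ext fun x hx => by simp }
  map_id F := by ext U : 2; exact colimOn_hom_ext fun x hx => by simp
  map_comp α β := by ext U : 2; exact colimOn_hom_ext fun x hx => by simp

theorem isCosheaf_colimPrecosheaf (F : X ⥤ ProMod k) :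
    IsCosheaf (Opens.grothendieckTopology (aSpace X)) (colimPrecosheaf.obj F) := by
  intro U R hR
  choose V h hV hx using fun (x : X) (hx : WithLowerSet.toLowerSet x ∈ U) => hR _ hx
  let leg (s : Cocone (R.arrows.diagram ⋙ colimPrecosheaf.obj F)) {W : Opens (aSpace X)}
      (g : W ⟶ U) (hg : R g) (x : X) (hx : WithLowerSet.toLowerSet x ∈ W) : F.obj x ⟶ s.pt :=
    inOn F W x hx ≫ s.ι.app (R.arrows.categoryMk g hg)
  have map_in {W W' : Opens (aSpace X)} (i : W ⟶ W') (x : X) (hx : WithLowerSet.toLowerSet x ∈ W) :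
      inOn F W x hx ≫ (colimPrecosheaf.obj F).map i = inOn F W' x (i.le hx) :=
    inOn_descOn _ _ _ _ _ _
  have legmono (s : Cocone (R.arrows.diagram ⋙ colimPrecosheaf.obj F)) {W W' : Opens (aSpace X)}
      (i : W ⟶ W') (g : W ⟶ U) (g' : W' ⟶ U) (hg : R g) (hg' : R g') (x : X)
      (hx : WithLowerSet.toLowerSet x ∈ W) : leg s g hg x hx = leg s g' hg' x (i.le hx) := by
    have w : (colimPrecosheaf.obj F).map i ≫ s.ι.app (R.arrows.categoryMk g' hg') =
        s.ι.app (R.arrows.categoryMk g hg) :=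
      s.w (ObjectProperty.homMk (Over.homMk i) :
        R.arrows.categoryMk g hg ⟶ R.arrows.categoryMk g' hg')
    exact (congrArg (inOn F W x hx ≫ ·) w.symm).trans
      ((Category.assoc _ _ _).symm.trans (congrArg (· ≫ _) (map_in i x hx)))
  have legeq (s : Cocone (R.arrows.diagram ⋙ colimPrecosheaf.obj F)) {W W' : Opens (aSpace X)}
      (g : W ⟶ U) (g' : W' ⟶ U) (hg : R g) (hg' : R g') (x : X)
      (hx : WithLowerSet.toLowerSet x ∈ W) (hx' : WithLowerSet.toLowerSet x ∈ W') :
      leg s g hg x hx = leg s g' hg' x hx' := by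
    rw [← legmono s (homOfLE inf_le_left : W ⊓ W' ⟶ W) (homOfLE inf_le_left ≫ g) g
        (R.downward_closed hg _) hg x ⟨hx, hx'⟩,
      ← legmono s (homOfLE inf_le_right : W ⊓ W' ⟶ W') (homOfLE inf_le_left ≫ g) g'
        (R.downward_closed hg _) hg' x ⟨hx, hx'⟩]
  refine ⟨{ desc := fun s => descOn F U (fun x hU => leg s (h x hU) (hV x hU) x (hx x hU))
              (fun x y f hxU hyU => ?_)
            fac := fun s j => ?_
            uniq := fun s m hm => ?_ }⟩
  · have hxy : WithLowerSet.toLowerSet x ∈ V y hyU :=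
      (IsLowerSet.isOpen_iff_isLowerSet.1 (V y hyU).isOpen) (show x ≤ y from f.le) (hx y hyU)
    rw [legeq s (h x hxU) (h y hyU) (hV x hxU) (hV y hyU) x (hx x hxU) hxy]
    exact (Category.assoc _ _ _).symm.trans (congrArg (· ≫ _) (map_inOn F _ f hxy _))
  · refine colimOn_hom_ext fun x hxj => ?_
    exact (Category.assoc _ _ _).symm.trans ((congrArg (· ≫ _) (map_in j.obj.hom x hxj)).trans
      ((inOn_descOn F U _ _ x _).trans (legeq s _ j.obj.hom _ j.property x _ hxj)))
  · refine colimOn_hom_ext fun x hxU => ?_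
    refine Eq.trans ?_ (inOn_descOn F U _ _ x hxU).symm
    have e : (colimPrecosheaf.obj F).map (h x hxU) ≫ m =
        s.ι.app (R.arrows.categoryMk (h x hxU) (hV x hxU)) :=
      hm (R.arrows.categoryMk (h x hxU) (hV x hxU))
    change inOn F U x hxU ≫ m = inOn F (V x hxU) x (hx x hxU) ≫ _
    rw [← e, ← map_in (h x hxU) x (hx x hxU)]
    exact Category.assoc (inOn F (V x hxU) x (hx x hxU))
      ((colimPrecosheaf.obj F).map (h x hxU)) m

/-- The functor `F ↦ 𝓕`, where `𝓕(U) = colim F|_U`. -/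
noncomputable def functorToCosheaf (X : Type u) [Preorder X] (k : Type u) [CommRing k] :
    (X ⥤ ProMod k) ⥤ Cosheaf (aSpace X) k :=
  ObjectProperty.lift _ colimPrecosheaf isCosheaf_colimPrecosheaf
end

/-- A resolution of `A` by objects satisfying `Q`: an exact sequence
`⋯ ⟶ P₂ ⟶ P₁ ⟶ P₀ ⟶ A ⟶ 0` with all `Pₙ` in `Q`. -/
structure ResolutionBy {C : Type*} [Category* C] [Preadditive C] (Q : ObjectProperty C)
    (A : C) where
  complex : ChainComplex C ℕ
  mem : ∀ n, Q (complex.X n)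
  π : complex.X 0 ⟶ A
  w : complex.d 1 0 ≫ π = 0
  epi : Epi π
  exact_zero : (ShortComplex.mk _ _ w).Exact
  exact_succ : ∀ n, complex.ExactAt (n + 1)

/-- A functor `F : I ⥤ Pro(k)` is quasi-projective when the functor `⟨F, T⟩ : Iᵒᵖ ⥤ Mod(k)` is
injective for each injective module `T`. -/
def IsQuasiProjectiveFunctor {k : Type u} [CommRing k] {I : Type u} [SmallCategory I] :
    ObjectProperty (I ⥤ ProMod k) := fun F =>
  ∀ T : ModuleCat.{u} k, Injective T → Injective (F.op ⋙ ProMod.pairing T)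

/-- A small category together with a `Pro(k)`-valued functor on it. -/
structure Diagram (k : Type u) [CommRing k] : Type (u + 1) where
  I : Type u
  [cat : SmallCategory I]
  functor : I ⥤ ProMod k

namespace Diagram
variable {k : Type u} [CommRing k]
attribute [instance] Diagram.cat

/-- A morphism `(I, F) ⟶ (J, G)` is a functor `φ : I ⥤ J` with a natural transformation
`F ⟶ φ ⋙ G`. -/
structure Hom (D E : Diagram k) where
  base : D.I ⥤ E.I
  fiber : D.functor ⟶ base ⋙ E.functor

noncomputable instance : Category (Diagram k) where
  Hom := Hom
  id D := ⟨𝟭 D.I, (Functor.leftUnitor D.functor).inv⟩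
  comp u v := ⟨u.base ⋙ v.base,
    u.fiber ≫ Functor.whiskerLeft u.base v.fiber ≫ (Functor.associator _ _ _).inv⟩
  id_comp u := by
    obtain ⟨b, f⟩ := u
    refine congrArg (Hom.mk b) ?_
    ext x
    simp
  comp_id u := by
    obtain ⟨b, f⟩ := u
    refine congrArg (Hom.mk b) ?_
    ext x
    simp
  assoc u v w := by
    refine congrArg (Hom.mk _) ?_
    ext x
    simp

/-- The diagrams on a fixed small category `I`. -/
noncomputable def incl (I : Type u) [SmallCategory I] : (I ⥤ ProMod k) ⥤ Diagram k where
  obj F := ⟨I, F⟩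
  map α := ⟨𝟭 I, α ≫ (Functor.leftUnitor _).inv⟩
  map_id F := by
    refine congrArg (Hom.mk _) ?_
    ext x
    simp
  map_comp α β := by
    refine congrArg (Hom.mk _) ?_
    ext x
    simp

abbrev Resolution (D : Diagram k) := ResolutionBy IsQuasiProjectiveFunctor D.functor

/-- The complex `colim Pₙ` of pro-modules. -/
noncomputable abbrev Resolution.colimComplex {D : Diagram k} (P : D.Resolution) :
    ChainComplex (ProMod k) ℕ :=
  ((colim : (D.I ⥤ ProMod k) ⥤ ProMod k).mapHomologicalComplex _).obj P.complex

/-- A lift of `u : (I, F) ⟶ (J, G)` to resolutions of `F` and `G`. -/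
structure Lift {D E : Diagram k} (u : D ⟶ E) (P : D.Resolution) (Q : E.Resolution) where
  hom : P.complex ⟶
    (((Functor.whiskeringLeft _ _ (ProMod k)).obj u.base).mapHomologicalComplex _).obj Q.complex
  w : hom.f 0 ≫ Functor.whiskerLeft u.base Q.π = P.π ≫ u.fiber

/-- The canonical maps `colim (φ ⋙ G) ⟶ colim G`. -/
noncomputable def preTrans {I J : Type u} [SmallCategory I] [SmallCategory J] (φ : I ⥤ J) :
    (Functor.whiskeringLeft I J (ProMod k)).obj φ ⋙ colim ⟶ colim where
  app G := colimit.pre G φ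
  naturality G G' α := colimit.hom_ext fun x => by simp

/-- The chain map with components `colim Pₙ ⟶ colim (φ ⋙ Qₙ) ⟶ colim Qₙ`. -/
noncomputable def Lift.colimMap {D E : Diagram k} {u : D ⟶ E} {P : D.Resolution}
    {Q : E.Resolution} (l : Lift u P Q) : P.colimComplex ⟶ Q.colimComplex :=
  (colim.mapHomologicalComplex _).map l.hom ≫
    (NatTrans.mapHomologicalComplex (preTrans u.base) _).app Q.complex

end Diagram

/-- `L` is the `n`-th higher colimit (the `n`-th left satellite of `colim`), as a functor of the
index category and of the diagram on it: `L (I, F)` is the `n`-th homology of `colim P` for each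
quasi-projective resolution `P` of `F`, and the action of `L` on morphisms is the one induced by
lifts to resolutions. -/
def IsHigherColimit {k : Type u} [CommRing k] (n : ℕ) (L : Diagram k ⥤ ProMod k) : Prop :=
  ∃ e : ∀ (D : Diagram k) (P : D.Resolution), L.obj D ≅ P.colimComplex.homology n,
    ∀ (D E : Diagram k) (u : D ⟶ E) (P : D.Resolution) (Q : E.Resolution)
      (l : Diagram.Lift u P Q),
      L.map u ≫ (e E Q).hom = (e D P).hom ≫ HomologicalComplex.homologyMap l.colimMap n

open Classical ZeroObject in
/-- The `n`-th higher colimit. -/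
noncomputable def higherColim (k : Type u) [CommRing k] (n : ℕ) : Diagram k ⥤ ProMod k :=
  if h : ∃ L : Diagram k ⥤ ProMod k, IsHigherColimit n L then h.choose
  else (Functor.const _).obj 0

/-- A preordered set with a `Pro(k)`-valued functor on it. -/
structure PreDiagramData (k : Type u) [CommRing k] : Type (u + 1) where
  X : Type u
  [pre : Preorder X]
  functor : X ⥤ ProMod k

attribute [instance] PreDiagramData.pre

abbrev PreDiagramData.toDiagram {k : Type u} [CommRing k] (D : PreDiagramData k) : Diagram k :=
  ⟨D.X, D.functor⟩

/-- Morphisms `(X, F) ⟶ (Y, G)`: a monotone map `f : X ⟶ Y` with a natural transformation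
`F ⟶ G ∘ f`. -/
abbrev PreDiagram (k : Type u) [CommRing k] :=
  InducedCategory (Diagram k) (PreDiagramData.toDiagram (k := k))

/-- A preordered set with a cosheaf of pro-modules on the corresponding Alexandroff space. -/
structure ACosheaf (k : Type u) [CommRing k] : Type (u + 1) where
  X : Type u
  [pre : Preorder X]
  cosheaf : Cosheaf (aSpace X) k

namespace ACosheaf
variable {k : Type u} [CommRing k]
attribute [instance] ACosheaf.pre

/-- A morphism `(X, A) ⟶ (Y, B)` is a continuous map `f : X ⟶ Y` with a morphism of cosheaves
`f_* A ⟶ B`. -/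
structure Hom (A B : ACosheaf k) where
  base : aSpace A.X ⟶ aSpace B.X
  fiber : (Cosheaf.pushforward k base).obj A.cosheaf ⟶ B.cosheaf

noncomputable instance : Category (ACosheaf k) where
  Hom := Hom
  id A := ⟨𝟙 (aSpace A.X), 𝟙 A.cosheaf⟩
  comp {_ _ C} u v := ⟨u.base ≫ v.base, show (Cosheaf.pushforward k v.base).obj
    ((Cosheaf.pushforward k u.base).obj _) ⟶ C.cosheaf from
      (Cosheaf.pushforward k v.base).map u.fiber ≫ v.fiber⟩
  id_comp u := by
    obtain ⟨b, f⟩ := u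
    refine congrArg (Hom.mk b) ?_
    exact (congrArg (· ≫ f) (CategoryTheory.Functor.map_id _ _)).trans (Category.id_comp f)
  comp_id u := by
    obtain ⟨b, f⟩ := u
    refine congrArg (Hom.mk b) ?_
    exact Category.comp_id f
  assoc u v w := by
    refine congrArg (Hom.mk _) ?_
    exact ((congrArg (· ≫ w.fiber) (Functor.map_comp (Cosheaf.pushforward k w.base)
      ((Cosheaf.pushforward k v.base).map u.fiber) v.fiber)).trans
        (Category.assoc _ _ _))

instance (X : Type u) [Preorder X] : (Cosheaf.Γ k (aSpace X)).Additive := Cosheaf.additive_Γ _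

instance {X Y : Type u} [Preorder X] [Preorder Y] (f : aSpace X ⟶ aSpace Y) :
    (Cosheaf.pushforward k f).Additive := Cosheaf.additive_pushforward f

abbrev Resolution (A : ACosheaf k) := ResolutionBy Cosheaf.IsQuasiProjective A.cosheaf

/-- The complex of global cosections. -/
noncomputable abbrev Resolution.ΓComplex {A : ACosheaf k} (P : A.Resolution) :
    ChainComplex (ProMod k) ℕ :=
  ((Cosheaf.Γ k (aSpace A.X)).mapHomologicalComplex _).obj P.complex

/-- A lift of `u : (X, A) ⟶ (Y, B)` to resolutions of `A` and `B`. -/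
structure Lift {A B : ACosheaf k} (u : A ⟶ B) (P : A.Resolution) (Q : B.Resolution) where
  hom : ((Cosheaf.pushforward k u.base).mapHomologicalComplex _).obj P.complex ⟶ Q.complex
  w : hom.f 0 ≫ Q.π = (Cosheaf.pushforward k u.base).map P.π ≫ u.fiber

/-- The chain map of global cosections; note that `Γ(f_* P) = Γ(P)`. -/
noncomputable def Lift.ΓMap {A B : ACosheaf k} {u : A ⟶ B} {P : A.Resolution}
    {Q : B.Resolution} (l : Lift u P Q) : P.ΓComplex ⟶ Q.ΓComplex :=
  ((Cosheaf.Γ k (aSpace B.X)).mapHomologicalComplex _).map l.hom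

end ACosheaf

/-- `H` is the `n`-th cosheaf homology (the `n`-th left satellite of the functor of global
cosections), as a functor of the space and of the cosheaf on it. -/
def IsCosheafHomology {k : Type u} [CommRing k] (n : ℕ) (H : ACosheaf k ⥤ ProMod k) : Prop :=
  ∃ e : ∀ (A : ACosheaf k) (P : A.Resolution), H.obj A ≅ P.ΓComplex.homology n,
    ∀ (A B : ACosheaf k) (u : A ⟶ B) (P : A.Resolution) (Q : B.Resolution)
      (l : ACosheaf.Lift u P Q),
      H.map u ≫ (e B Q).hom = (e A P).hom ≫ HomologicalComplex.homologyMap l.ΓMap n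

open Classical ZeroObject in
/-- The `n`-th cosheaf homology `(X, A) ↦ Hₙ(X, A)`. -/
noncomputable def cosheafHomology (k : Type u) [CommRing k] (n : ℕ) : ACosheaf k ⥤ ProMod k :=
  if h : ∃ H : ACosheaf k ⥤ ProMod k, IsCosheafHomology n H then h.choose
  else (Functor.const _).obj 0

section Comparison
variable {k : Type u} [CommRing k]

/-- The continuous map of Alexandroff spaces given by a functor between preordered sets. -/
def aMap {X Y : Type u} [Preorder X] [Preorder Y] (φ : X ⥤ Y) : aSpace X ⟶ aSpace Y :=
  TopCat.ofHom (WithLowerSet.map ⟨φ.obj, φ.monotone⟩)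

theorem map_inOn_colimPrecosheaf {X : Type u} [Preorder X] (F : X ⥤ ProMod k)
    {U V : Opens (aSpace X)} (i : U ⟶ V) (x : X) (hx : WithLowerSet.toLowerSet x ∈ U) :
    inOn F U x hx ≫ (colimPrecosheaf.obj F).map i = inOn F V x (i.le hx) :=
  inOn_descOn _ _ _ _ _ _

/-- The morphism of cosheaves `f_* 𝓕 ⟶ 𝓖` given by `F ⟶ f ⋙ G`: over an open set `U` it is the
map `colim F|_{f⁻¹ U} ⟶ colim G|_U`. -/
noncomputable def pushforwardMap {X Y : Type u} [Preorder X] [Preorder Y] (φ : X ⥤ Y)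
    {F : X ⥤ ProMod k} {G : Y ⥤ ProMod k} (α : F ⟶ φ ⋙ G) :
    (Cosheaf.pushforward k (aMap φ)).obj ((functorToCosheaf X k).obj F) ⟶
      (functorToCosheaf Y k).obj G :=
  ObjectProperty.homMk
    { app := fun U => descOn F ((Opens.map (aMap φ)).obj U)
        (fun x hx => α.app x ≫ inOn G U (φ.obj x) hx)
        (fun x y f hx hy => by
          exact (α.naturality_assoc f (inOn G U (φ.obj y) hy)).trans
            (congrArg (α.app x ≫ ·) (map_inOn G U (φ.map f) hx hy)))
      naturality := fun U V h => colimOn_hom_ext fun x hx => by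
        have hx' : WithLowerSet.toLowerSet (φ.obj x) ∈ U := hx
        have e₁ := map_inOn_colimPrecosheaf F ((Opens.map (aMap φ)).map h) x hx
        have e₂ := map_inOn_colimPrecosheaf G h (φ.obj x) hx
        refine Eq.trans (b := α.app x ≫ inOn G V (φ.obj x) (h.le hx)) ?_ ?_
        · refine (Category.assoc _ _ _).symm.trans ((congrArg (· ≫ _) e₁).trans ?_)
          exact inOn_descOn _ _ _ _ _ _
        · refine (Eq.trans (Category.assoc _ _ _).symm ((congrArg (· ≫ _)
            (inOn_descOn _ _ _ _ _ _)).trans ?_)).symm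
          exact (Category.assoc _ _ _).trans (congrArg (α.app x ≫ ·) e₂) }

theorem inOn_pushforwardMap {X Y : Type u} [Preorder X] [Preorder Y] (φ : X ⥤ Y)
    {F : X ⥤ ProMod k} {G : Y ⥤ ProMod k} (α : F ⟶ φ ⋙ G) (U : Opens (aSpace Y)) (x : X)
    (hx : WithLowerSet.toLowerSet x ∈ (Opens.map (aMap φ)).obj U) :
    inOn F ((Opens.map (aMap φ)).obj U) x hx ≫ (pushforwardMap φ α).hom.app U =
      α.app x ≫ inOn G U (φ.obj x) hx :=
  inOn_descOn _ _ _ _ _ _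

/-- The functor `(X, F) ↦ (X, 𝓕)`. -/
noncomputable def preDiagramToACosheaf (k : Type u) [CommRing k] :
    PreDiagram k ⥤ ACosheaf k where
  obj D := ⟨D.X, (functorToCosheaf D.X k).obj D.functor⟩
  map u := ⟨aMap u.hom.base, pushforwardMap u.hom.base u.hom.fiber⟩
  map_id D := by
    refine congrArg (ACosheaf.Hom.mk _) (ObjectProperty.hom_ext _ (NatTrans.ext (funext fun U =>
      colimOn_hom_ext fun x hx => ?_)))
    exact (inOn_descOn _ _ _ _ _ _).trans ((Category.id_comp _).trans (Category.comp_id _).symm)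
  map_comp u v := by
    refine congrArg (ACosheaf.Hom.mk _) (ObjectProperty.hom_ext _ (NatTrans.ext (funext fun U =>
      colimOn_hom_ext fun x hx => ?_)))
    have h₁ := inOn_pushforwardMap u.hom.base u.hom.fiber
      ((Opens.map (aMap v.hom.base)).obj U) x hx
    have h₂ := inOn_pushforwardMap v.hom.base v.hom.fiber U (u.hom.base.obj x) hx
    have h₃ := inOn_pushforwardMap (u ≫ v).hom.base (u ≫ v).hom.fiber U x hx
    have h₄ : (u ≫ v).hom.fiber.app x =
        u.hom.fiber.app x ≫ v.hom.fiber.app (u.hom.base.obj x) :=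
      whisker_eq (u.hom.fiber.app x) (Category.comp_id (v.hom.fiber.app (u.hom.base.obj x)))
    refine h₃.trans ((eq_whisker h₄ _).trans ?_)
    refine (Category.assoc _ _ _).trans ((whisker_eq _ h₂.symm).trans ?_)
    refine (Category.assoc _ _ _).symm.trans ((eq_whisker h₁.symm _).trans ?_)
    exact Category.assoc _ _ _

end Comparison


section Bar
variable {k : Type u} [CommRing k] {I : Type u} [SmallCategory I]

/-- The direct sum `Cₙ(I, F) = ⨁ F(i₀)` over all `i₀ → ⋯ → iₙ`. -/
noncomputable abbrev barObj (F : I ⥤ ProMod k) (n : ℕ) : ProMod k :=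
  ∐ fun s : ComposableArrows I n => F.obj (s.obj 0)

/-- The inclusion `ρ` of the summand with index `i₀ → ⋯ → iₙ`. -/
noncomputable abbrev barρ (F : I ⥤ ProMod k) {n : ℕ} (s : ComposableArrows I n) :
    F.obj (s.obj 0) ⟶ barObj F n :=
  Sigma.ι (fun s : ComposableArrows I n => F.obj (s.obj 0)) s

/-- The action on bar objects of a monotone map `θ`; it sends the summand at `i₀ → ⋯ → iₙ` to the
summand at `i_{θ 0} → ⋯ → i_{θ m}` by means of `F (i₀ → i_{θ 0})`. -/
noncomputable def barMap (F : I ⥤ ProMod k) {m n : ℕ} (θ : Fin (m + 1) →o Fin (n + 1)) :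
    barObj F n ⟶ barObj F m :=
  Limits.Sigma.desc fun s => F.map (s.map (homOfLE (Fin.zero_le (θ 0)))) ≫
    barρ F (s.whiskerLeft θ.monotone.functor)

theorem barρ_barMap (F : I ⥤ ProMod k) {m n : ℕ} (θ : Fin (m + 1) →o Fin (n + 1))
    (s : ComposableArrows I n) : barρ F s ≫ barMap F θ =
      F.map (s.map (homOfLE (Fin.zero_le (θ 0)))) ≫ barρ F (s.whiskerLeft θ.monotone.functor) :=
  Limits.Sigma.ι_desc _ _

theorem bar_hom_ext {F : I ⥤ ProMod k} {n : ℕ} {Z : ProMod k} {f g : barObj F n ⟶ Z}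
    (h : ∀ s, barρ F s ≫ f = barρ F s ≫ g) : f = g :=
  Limits.Sigma.hom_ext _ _ h

noncomputable def barNat {F G : I ⥤ ProMod k} (α : F ⟶ G) (n : ℕ) : barObj F n ⟶ barObj G n :=
  Limits.Sigma.map fun s : ComposableArrows I n => α.app (s.obj 0)

theorem barρ_barNat {F G : I ⥤ ProMod k} (α : F ⟶ G) {n : ℕ} (s : ComposableArrows I n) :
    barρ F s ≫ barNat α n = α.app (s.obj 0) ≫ barρ G s :=
  Limits.Sigma.ι_map _ _

/-- The simplicial object with terms `Cₙ(I, F)`. -/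
noncomputable def barSimplicial : (I ⥤ ProMod k) ⥤ SimplicialObject (ProMod k) where
  obj F :=
    { obj := fun Δ => barObj F Δ.unop.len
      map := fun θ => barMap F θ.unop.toOrderHom
      map_id := fun Δ => bar_hom_ext fun s => by
        rw [barρ_barMap]
        refine (congrArg (· ≫ _) ?_).trans ((Category.id_comp _).trans (Category.comp_id _).symm)
        exact (congrArg F.map (s.map_id 0)).trans (F.map_id _)
      map_comp := fun {Δ Δ' Δ''} θ θ' => bar_hom_ext fun s => by
        refine (barρ_barMap F _ s).trans (Eq.symm ?_)
        refine (Category.assoc _ _ _).symm.trans ((eq_whisker (barρ_barMap F _ s) _).trans ?_)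
        refine (Category.assoc _ _ _).trans ((whisker_eq _ (barρ_barMap F _ _)).trans ?_)
        refine (Category.assoc _ _ _).symm.trans (congrArg (· ≫ _) ?_)
        exact (F.map_comp _ _).symm.trans (congrArg F.map (s.map_comp _ _).symm) }
  map {F G} α :=
    { app := fun Δ => barNat α Δ.unop.len
      naturality := fun Δ Δ' θ => bar_hom_ext fun s => by
        refine (Category.assoc _ _ _).symm.trans ((eq_whisker (barρ_barMap F _ s) _).trans ?_)
        refine (Category.assoc _ _ _).trans ((whisker_eq _ (barρ_barNat _ _)).trans ?_)
        refine Eq.symm ?_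
        refine (Category.assoc _ _ _).symm.trans
          ((eq_whisker (barρ_barNat _ _) _).trans ?_)
        refine (Category.assoc _ _ _).trans ((whisker_eq _ (barρ_barMap G _ s)).trans ?_)
        exact (α.naturality_assoc _ _).symm }
  map_id F := NatTrans.ext (funext fun Δ => bar_hom_ext fun s =>
    (barρ_barNat (𝟙 F) s).trans ((Category.id_comp _).trans (Category.comp_id _).symm))
  map_comp α β := by
    refine NatTrans.ext (funext fun Δ => bar_hom_ext fun s =>
      (barρ_barNat (α ≫ β) s).trans (Eq.symm ?_))
    refine (Category.assoc _ _ _).symm.trans ((eq_whisker (barρ_barNat α s) _).trans ?_)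
    exact (Category.assoc _ _ _).trans ((whisker_eq _ (barρ_barNat β s)).trans
      (Category.assoc _ _ _).symm)

/-- The bar construction `F ↦ C_•(I, F)`; see `barρ_d` for the differential. -/
noncomputable def barComplex (k : Type u) [CommRing k] (I : Type u) [SmallCategory I] :
    (I ⥤ ProMod k) ⥤ ChainComplex (ProMod k) ℕ :=
  barSimplicial ⋙ AlgebraicTopology.alternatingFaceMapComplex (ProMod k)

/-- The `j`-th face of `i₀ → ⋯ → iₙ₊₁`, obtained by omitting `i_j`. -/
abbrev face {n : ℕ} (s : ComposableArrows I (n + 1)) (j : Fin (n + 2)) : ComposableArrows I n :=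
  s.whiskerLeft (Fin.succAboveOrderEmb j).monotone.functor

/-- The differential of the bar construction on the summand at `i₀ → ⋯ → iₙ₊₁`. -/
theorem barρ_d (F : I ⥤ ProMod k) (n : ℕ) (s : ComposableArrows I (n + 1)) :
    barρ F s ≫ ((barComplex k I).obj F).d (n + 1) n =
      (F.map (s.map (homOfLE (Fin.zero_le 1))) ≫ barρ F (face s 0) +
        ∑ j : Fin (n + 1), (-1 : ℤ) ^ (j.1 + 1) • barρ F (face s j.succ) :
          F.obj (s.obj 0) ⟶ barObj F n) := by
  have h : ∀ j : Fin (n + 2), barρ F s ≫ (barSimplicial.obj F).δ j =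
      F.map (s.map (homOfLE (Fin.zero_le (j.succAbove 0)))) ≫ barρ F (face s j) :=
    fun j => barρ_barMap F (Fin.succAboveOrderEmb j).toOrderHom s
  have hd : ((barComplex k I).obj F).d (n + 1) n =
      ∑ j : Fin (n + 2), (-1 : ℤ) ^ j.1 • (barSimplicial.obj F).δ j :=
    AlgebraicTopology.alternatingFaceMapComplex_obj_d _ _
  rw [hd]
  refine (Preadditive.comp_sum _ _ _).trans ((Fin.sum_univ_succ _).trans ?_)
  refine congrArg₂ (· + ·) ?_ (Finset.sum_congr rfl fun j _ => ?_)
  · refine (Preadditive.comp_zsmul _ _ _).trans ((congrArg (_ • ·) (h 0)).trans ?_)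
    exact one_smul ℤ _
  · refine (Preadditive.comp_zsmul _ _ _).trans ((congrArg (_ • ·) (h j.succ)).trans ?_)
    refine congrArg (fun t => (-1 : ℤ) ^ (j.1 + 1) • t) ?_
    refine (eq_whisker ?_ _).trans (Category.id_comp (barρ F (face s j.succ)))
    exact (congrArg F.map (s.map_id 0)).trans (F.map_id _)
end Bar

section Quotient
variable {k : Type u} [CommRing k]

/-- The partially ordered set `X / R`, where `x R y` means `x ≤ y` and `y ≤ x`. -/
abbrev Hat (X : Type u) [Preorder X] : Type u := Antisymmetrization X (· ≤ ·)

/-- The projection `X ⟶ X / R`. -/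
def hatν (X : Type u) [Preorder X] : X ⥤ Hat X :=
  (toAntisymmetrization_mono (α := X)).functor

/-- The projection as a continuous map of Alexandroff spaces. -/
abbrev hatνTop (X : Type u) [Preorder X] : aSpace X ⟶ aSpace (Hat X) := aMap (hatν X)

/-- The map of quotients induced by a continuous map. -/
def hatMap {X Y : Type u} [Preorder X] [Preorder Y] (f : aSpace X ⟶ aSpace Y) :
    aSpace (Hat X) ⟶ aSpace (Hat Y) :=
  TopCat.ofHom (WithLowerSet.map (OrderHom.antisymmetrization
    ⟨fun x => WithLowerSet.ofLowerSet (f (WithLowerSet.toLowerSet x)), fun x y h =>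
      (IsLowerSet.monotone_iff_continuous (α := WithLowerSet X) (β := WithLowerSet Y)).2
        f.hom.continuous (show WithLowerSet.toLowerSet x ≤ WithLowerSet.toLowerSet y from h)⟩))

theorem ACosheaf.hom_ext {A B : ACosheaf k} {u v : A ⟶ B} (h : u.base = v.base)
    (hf : ∀ U : Opens (aSpace B.X), u.fiber.hom.app U =
      A.cosheaf.obj.map (eqToHom (congrArg (fun f => (Opens.map f).obj U) h)) ≫
        v.fiber.hom.app U) : u = v := by
  obtain ⟨b, f⟩ := u
  obtain ⟨b', f'⟩ := v
  obtain rfl : b = b' := h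
  refine congrArg (ACosheaf.Hom.mk b) (ObjectProperty.hom_ext _ (NatTrans.ext (funext fun U =>
    (hf U).trans ?_)))
  exact (eq_whisker (A.cosheaf.obj.map_id _) _).trans (Category.id_comp _)

/-- The functor `(X, A) ↦ (X / R, Â)` with `Â(U) = A(ν⁻¹ U)`. -/
noncomputable def hat (k : Type u) [CommRing k] : ACosheaf k ⥤ ACosheaf k where
  obj A := ⟨Hat A.X, (Cosheaf.pushforward k (hatνTop A.X)).obj A.cosheaf⟩
  map {A B} u := ⟨hatMap u.base, (Cosheaf.pushforward k (hatνTop B.X)).map u.fiber⟩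
  map_id A := by
    refine ACosheaf.hom_ext (TopCat.hom_ext (ContinuousMap.ext fun x => ?_)) fun U => ?_
    · exact Quotient.inductionOn x fun _ => rfl
    · exact (Category.comp_id (𝟙 _)).symm.trans
        (eq_whisker (A.cosheaf.obj.map_id ((Opens.map (hatνTop A.X)).obj U)).symm (𝟙 _))
  map_comp {A B C} u v := by
    refine ACosheaf.hom_ext (TopCat.hom_ext (ContinuousMap.ext fun x => ?_)) fun U => ?_
    · exact Quotient.inductionOn x fun _ => rfl
    · exact (Category.id_comp _).symm.trans
        (eq_whisker (A.cosheaf.obj.map_id ((Opens.map u.base).obj ((Opens.map v.base).obj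
          ((Opens.map (hatνTop C.X)).obj U)))).symm _)

/-- The morphisms `(X, A) ⟶ (X / R, Â)` given by the projection and the identity of `Â`. -/
noncomputable def toHat (k : Type u) [CommRing k] : 𝟭 (ACosheaf k) ⟶ hat k where
  app A := ⟨hatνTop A.X, 𝟙 _⟩
  naturality A B u := by
    refine ACosheaf.hom_ext rfl fun U => ?_
    refine (Category.comp_id (u.fiber.hom.app ((Opens.map (hatνTop B.X)).obj U))).trans ?_
    refine (Category.id_comp _).symm.trans ((Category.id_comp _).symm.trans (eq_whisker ?_ _))
    exact (A.cosheaf.obj.map_id _).symm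

end Quotient

/-! Everything is computed by the bar construction. Exactness in Pro(k) can be tested by maps into
`ι T` with T an injective module: these objects are injective in Pro(k), since a representable
ind-object on a projective is projective (`projective_yoneda`), and they detect zero objects
(`exact_iff`). Maps out of a coproduct form a product, so coproducts of pro-modules are exact; hence
F ↦ C(I, F) is exact. Its H_0 is colim F, because a map out of C_0(I, F) that kills the differential
is a cocone. If P is quasi-projective, then ⟨P, T⟩ is a retract of the coinduced functor j ↦ ∏_{i →
j} ⟨P i, T⟩. Prefixing an arrow i → i_0 to strings, followed by the retraction, splits cocycles, so
C(I, P) is acyclic in positive degrees (`barComplex_exactAt`).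

Thus the functors H_m(C(I, -)) have long exact sequences, start with colim and vanish on
quasi-projectives for m > 0. Dimension shifting along the opcycles of a resolution P of F identifies
H_n(C(I, F)) with H_n(colim P) (`exists_connect_iso`). The identification is compatible with every
lift of a morphism of diagrams to resolutions (`connect_naturality`), so independence of the
resolution and of the lift needs no homotopies.

The quasi-noetherian condition enters through the existence of resolutions. A pro-module is covered
by the pro-system of free modules on the terms of a presentation, and F by j ↦ ⨁_{i → j} of the
covers of the F(i); pairing this with T gives a functor coinduced from injective modules. Morphisms
of diagrams lift to these covers, hence to the syzygy resolutions.

For an Alexandroff space, the least open neighbourhoods of points form a dense subsite with trivial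
topology. A cosheaf therefore amounts to the functor of its values there; this equivalence matches
the quasi-projective objects, and matches Γ with colim, so cosheaf homology is the higher colimit of
the stalks. Finally X → X/R is an equivalence of categories, along which resolutions pull back and
colimits do not change. -/

namespace CategoryTheory.Ind
-- Ind-objects: maps from representables, extension of endofunctors
section
variable {C : Type u} [Category.{v} C]

/-- Maps from a representable ind-object are the values of the corresponding presheaf. -/
noncomputable def coyonedaYonedaIso (c : C) :
    coyoneda.obj (op (Ind.yoneda.obj c)) ≅ Ind.inclusion C ⋙ (evaluation _ _).obj (op c) :=
  NatIso.ofComponents (fun X => (Ind.inclusion.fullyFaithful.homEquiv.trans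
    (((Ind.yonedaCompInclusion.app c).homFromEquiv).trans yonedaEquiv)).toIso) (by
      intro X Y f
      ext g
      simp [Functor.FullyFaithful.homEquiv, yonedaEquiv, Iso.homFromEquiv])

/-- Representables are compact: maps out of them are evaluations of presheaves, and the inclusion of
ind-objects into presheaves preserves filtered colimits. Consequently maps from a representable to
an ind-limit, and equalities between such maps, live at a finite stage. -/
instance (c : C) {J : Type v} [SmallCategory J] [IsFiltered J] :
    PreservesColimitsOfShape J (coyoneda.obj (op (Ind.yoneda.obj c))) :=
  preservesColimitsOfShape_of_natIso (coyonedaYonedaIso c).symm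

variable {I : Type v} [SmallCategory I] [IsFiltered I]

/-- The structure maps of an ind-limit. -/
noncomputable def limι (F : I ⥤ C) (i : I) : Ind.yoneda.obj (F.obj i) ⟶ (Ind.lim I).obj F :=
  colimit.ι (F ⋙ Ind.yoneda) i

theorem limι_w (F : I ⥤ C) {i j : I} (p : i ⟶ j) :
    Ind.yoneda.map (F.map p) ≫ limι F j = limι F i :=
  colimit.w (F ⋙ Ind.yoneda) p

theorem limι_map {F G : I ⥤ C} (φ : F ⟶ G) (i : I) :
    limι F i ≫ (Ind.lim I).map φ = Ind.yoneda.map (φ.app i) ≫ limι G i :=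
  ι_colimMap (Functor.whiskerRight φ Ind.yoneda) i

theorem lim_hom_ext {F : I ⥤ C} {Z : Ind C} {f g : (Ind.lim I).obj F ⟶ Z}
    (h : ∀ i, limι F i ≫ f = limι F i ≫ g) : f = g :=
  colimit.hom_ext h

theorem exists_lim_desc (F : I ⥤ C) {Z : Ind C} (a : ∀ i, Ind.yoneda.obj (F.obj i) ⟶ Z)
    (w : ∀ {i j : I} (p : i ⟶ j), Ind.yoneda.map (F.map p) ≫ a j = a i) :
    ∃ f : (Ind.lim I).obj F ⟶ Z, ∀ i, limι F i ≫ f = a i :=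
  ⟨colimit.desc (F ⋙ Ind.yoneda) ⟨Z, { app := a
                                       naturality := fun i j p => by simpa using w p }⟩,
    fun i => colimit.ι_desc _ i⟩

theorem exists_factor {F : I ⥤ C} {c : C} (g : Ind.yoneda.obj c ⟶ (Ind.lim I).obj F) :
    ∃ (i : I) (a : c ⟶ F.obj i), Ind.yoneda.map a ≫ limι F i = g := by
  obtain ⟨i, a, ha⟩ := Types.jointly_surjective_of_isColimit
    (isColimitOfPreserves (coyoneda.obj (op (Ind.yoneda.obj c)))
      (colimit.isColimit (F ⋙ Ind.yoneda))) g
  obtain ⟨b, rfl⟩ := Ind.yoneda.map_surjective a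
  exact ⟨i, b, ha⟩

theorem exists_eq {F : I ⥤ C} {c : C} {i j : I} (a : c ⟶ F.obj i) (b : c ⟶ F.obj j)
    (h : Ind.yoneda.map a ≫ limι F i = Ind.yoneda.map b ≫ limι F j) :
    ∃ (l : I) (p : i ⟶ l) (q : j ⟶ l), a ≫ F.map p = b ≫ F.map q := by
  obtain ⟨l, p, q, e⟩ := (Types.FilteredColimit.isColimit_eq_iff _
    (isColimitOfPreserves (coyoneda.obj (op (Ind.yoneda.obj c)))
      (colimit.isColimit (F ⋙ Ind.yoneda)))
      (xi := Ind.yoneda.map a) (xj := Ind.yoneda.map b)).1 h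
  refine ⟨l, p, q, Ind.yoneda.map_injective ?_⟩
  rw [Functor.map_comp, Functor.map_comp]
  exact e

/-- The map `F ⟶ F ⋙ G` given by `η : 𝟭 ⟶ G`. -/
def whiskerUnit {G : C ⥤ C} (η : 𝟭 C ⟶ G) {I : Type v} [SmallCategory I] (F : I ⥤ C) :
    F ⟶ F ⋙ G where
  app i := η.app (F.obj i)
  naturality _ _ p := η.naturality (F.map p)

/-- By compactness `f` is represented by maps F(i) → K(j(i)); `G` is applied to these. The choices
are compatible because two representatives become equal at a later stage, and this equality persists
under `G`. Naturality of `η` gives the square. -/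
theorem exists_lim_map (G : C ⥤ C) (η : 𝟭 C ⟶ G) {I J : Type v} [SmallCategory I] [IsFiltered I]
    [SmallCategory J] [IsFiltered J] {F : I ⥤ C} {K : J ⥤ C}
    (f : (Ind.lim I).obj F ⟶ (Ind.lim J).obj K) :
    ∃ g : (Ind.lim I).obj (F ⋙ G) ⟶ (Ind.lim J).obj (K ⋙ G),
      (Ind.lim I).map (whiskerUnit η F) ≫ g =
        f ≫ (Ind.lim J).map (whiskerUnit η K) := by
  choose j a ha using fun i => exists_factor (limι F i ≫ f)
  have hw : ∀ {i i' : J} (p : i ⟶ i'),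
      Ind.yoneda.map (G.map (K.map p)) ≫ limι (K ⋙ G) i' = limι (K ⋙ G) i :=
    fun p => limι_w (K ⋙ G) p
  obtain ⟨g, hg⟩ := exists_lim_desc (F ⋙ G)
    (fun i => Ind.yoneda.map (G.map (a i)) ≫ limι (K ⋙ G) (j i)) (fun {i i'} s => by
      obtain ⟨l, p, q, e⟩ := exists_eq (F.map s ≫ a i') (a i) (by
        rw [ha, Functor.map_comp, Category.assoc, ha, ← Category.assoc, limι_w])
      have e' := congrArg (fun z => Ind.yoneda.map (G.map z) ≫ limι (K ⋙ G) l) e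
      simp only [Functor.map_comp, Category.assoc, hw] at e'
      exact e')
  refine ⟨g, lim_hom_ext fun i => ?_⟩
  rw [← Category.assoc, limι_map, Category.assoc, hg, ← Category.assoc, ← Category.assoc (limι F i),
    ← ha, Category.assoc _ (limι K (j i)), limι_map, ← Category.assoc]
  refine congrArg (· ≫ limι (K ⋙ G) (j i)) ?_
  exact (Ind.yoneda.map_comp _ _).symm.trans
    ((congrArg Ind.yoneda.map (η.naturality (a i)).symm).trans (Ind.yoneda.map_comp _ _))

/-- An ind-object is the ind-limit of the diagram presenting it. -/
noncomputable def presIso (X : Ind C) : (Ind.lim _).obj X.presentation.F ≅ X :=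
  X.colimitPresentationCompYoneda

/-- The extension of an endofunctor to an ind-object, by means of a chosen presentation. -/
noncomputable def ext (G : C ⥤ C) (X : Ind C) : Ind C := (Ind.lim _).obj (X.presentation.F ⋙ G)

noncomputable def toExt {G : C ⥤ C} (η : 𝟭 C ⟶ G) (X : Ind C) : X ⟶ X.ext G :=
  X.presIso.inv ≫ (Ind.lim _).map (whiskerUnit η X.presentation.F)

theorem exists_ext_map {G : C ⥤ C} (η : 𝟭 C ⟶ G) {X Y : Ind C} (f : X ⟶ Y) :
    ∃ g : X.ext G ⟶ Y.ext G, X.toExt η ≫ g = f ≫ Y.toExt η := by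
  obtain ⟨g, hg⟩ := exists_lim_map G η (X.presIso.hom ≫ f ≫ Y.presIso.inv)
  refine ⟨g, ?_⟩
  refine (Category.assoc _ _ _).trans ((whisker_eq _ hg).trans ?_)
  refine (whisker_eq _ (Category.assoc _ _ _)).trans ((Iso.inv_hom_id_assoc _ _).trans ?_)
  exact Category.assoc _ _ _
end

/-! ### Projective objects among ind-objects of an abelian category -/

section
variable {C : Type u} [Category.{v} C] [Abelian C]
attribute [local instance] indAbelian

theorem mono_lim_map {I : Type v} [SmallCategory I] [IsFiltered I] {F G : I ⥤ C} (φ : F ⟶ G)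
    [Mono φ] : Mono ((Ind.lim I).map φ) := by
  have := preservesMonomorphisms_of_preservesLimitsOfShape (Ind.lim I : (I ⥤ C) ⥤ Ind C)
  infer_instance

theorem mono_toExt {G : C ⥤ C} (η : 𝟭 C ⟶ G) [∀ c, Mono (η.app c)] (X : Ind C) :
    Mono (X.toExt η) := by
  have : ∀ i, Mono ((whiskerUnit η X.presentation.F).app i) := fun i =>
    inferInstanceAs (Mono (η.app _))
  have : Mono (whiskerUnit η X.presentation.F) := NatTrans.mono_of_mono_app _
  exact @mono_comp _ _ _ _ _ _ _ _ (mono_lim_map (whiskerUnit η X.presentation.F))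

/-- The transformation `φ` need not be epi at each stage, but its image inclusion becomes both mono
and epi in the limit, hence invertible. So `g` factors through a stage of the image, and there F
maps onto the image and `T` is projective. -/
theorem exists_lift_of_epi {I : Type v} [SmallCategory I] [IsFiltered I] {F K : I ⥤ C} (φ : F ⟶ K)
    (h : Epi ((Ind.lim I).map φ)) {T : C} [Projective T]
    (g : Ind.yoneda.obj T ⟶ (Ind.lim I).obj K) :
    ∃ g' : Ind.yoneda.obj T ⟶ (Ind.lim I).obj F, g' ≫ (Ind.lim I).map φ = g := by
  have hφ := congrArg (Ind.lim I).map (Abelian.image.fac φ)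
  rw [Functor.map_comp] at hφ
  have : Epi ((Ind.lim I).map (Abelian.image.ι φ)) := by
    rw [← hφ] at h; exact epi_of_epi ((Ind.lim I).map (Abelian.factorThruImage φ)) _
  have := mono_lim_map (Abelian.image.ι φ)
  have : IsIso ((Ind.lim I).map (Abelian.image.ι φ)) := isIso_of_mono_of_epi _
  obtain ⟨l, a, ha⟩ := exists_factor (g ≫ inv ((Ind.lim I).map (Abelian.image.ι φ)))
  refine ⟨Ind.yoneda.map (Projective.factorThru a ((Abelian.factorThruImage φ).app l)) ≫
    limι F l, ?_⟩
  rw [← hφ, Category.assoc, ← Category.assoc (limι F l), limι_map, Category.assoc,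
    ← Category.assoc, ← Functor.map_comp, Projective.factorThru_comp, ← Category.assoc, ha]
  simp

/-- Every morphism of ind-objects is isomorphic to the limit of a transformation over a common
filtered index, which reduces the claim to `exists_lift_of_epi`. -/
theorem projective_yoneda (T : C) [Projective T] : Projective (Ind.yoneda.obj T) where
  factors {E X} g f hf := by
    obtain ⟨I, _, _, F, K, φ, ⟨i⟩⟩ := Ind.exists_nonempty_arrow_mk_iso_ind_lim (f := f)
    let l : E ≅ (Ind.lim I).obj F := Arrow.leftFunc.mapIso i
    let r : X ≅ (Ind.lim I).obj K := Arrow.rightFunc.mapIso i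
    have hi : l.hom ≫ (Ind.lim I).map φ = f ≫ r.hom := Arrow.w i.hom
    have : Epi ((Ind.lim I).map φ) := by
      have : Epi (l.hom ≫ (Ind.lim I).map φ) := by rw [hi]; exact epi_comp _ _
      exact epi_of_epi l.hom _
    obtain ⟨g', hg'⟩ := exists_lift_of_epi φ this (g ≫ r.hom)
    refine ⟨g' ≫ l.inv, ?_⟩
    rw [← cancel_mono r.hom, Category.assoc, Category.assoc, ← hi, l.inv_hom_id_assoc, hg']

/-- The terms of a presentation of `X` are covered by projectives, and `Ind.yoneda` preserves
epimorphisms; so all structure maps of the colimit vanish, and with them the identity. -/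
theorem isZero_of_projectives [EnoughProjectives C] (X : Ind C)
    (h : ∀ (T : C) (_ : Projective T) (g : Ind.yoneda.obj T ⟶ X), g = 0) : IsZero X := by
  refine IsZero.of_iso ?_ X.presIso.symm
  rw [IsZero.iff_id_eq_zero]
  refine lim_hom_ext fun i => ?_
  rw [Category.comp_id, comp_zero]
  rw [← cancel_epi (Ind.yoneda.map (Projective.π (X.presentation.F.obj i))), comp_zero,
    ← cancel_mono X.presIso.hom, zero_comp]
  exact h _ inferInstance _
end
end CategoryTheory.Ind

/-! ### Quasi-projective covers of pro-modules; exactness tested on injective modules -/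

namespace ProMod
variable {k : Type u} [CommRing k]

instance injective_ι (T : ModuleCat.{u} k) [Injective T] : Injective ((ι k).obj T) := by
  have : Projective (Ind.yoneda.obj (op T)) := Ind.projective_yoneda (op T)
  exact inferInstanceAs (Injective (op (Ind.yoneda.obj (op T))))

/-- The dual of `isZero_of_projectives`: projectives of the opposite category are injective modules,
and there are enough of them. -/
theorem isZero_of_hom_ι (A : ProMod k)
    (h : ∀ (T : ModuleCat.{u} k), Injective T → ∀ g : A ⟶ (ι k).obj T, g = 0) : IsZero A := by
  let _ : Abelian (Ind (ModuleCat.{u} k)ᵒᵖ) := indAbelian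
  have : IsZero (Opposite.unop A) := Ind.isZero_of_projectives _ fun T _ g => by
    have : Injective T.unop := inferInstance
    exact congrArg Quiver.Hom.unop (h T.unop this g.op)
  exact this.op

/-- The free modules on the underlying sets, as an endofunctor. -/
noncomputable abbrev freeOp (k : Type u) [CommRing k] :
    (ModuleCat.{u} k)ᵒᵖ ⥤ (ModuleCat.{u} k)ᵒᵖ :=
  (forget (ModuleCat.{u} k) ⋙ ModuleCat.free k).op

noncomputable def freeUnit (k : Type u) [CommRing k] : 𝟭 (ModuleCat.{u} k)ᵒᵖ ⟶ freeOp k where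
  app M := ((ModuleCat.adj k).counit.app M.unop).op
  naturality _ _ f := congrArg Quiver.Hom.op ((ModuleCat.adj k).counit.naturality f.unop).symm

instance (M) : Mono ((freeUnit k).app M) :=
  inferInstanceAs (Mono ((ModuleCat.adj k).counit.app M.unop).op)

/-- A quasi-projective cover of a pro-module. -/
noncomputable def cover (A : ProMod k) : ProMod k := op ((Opposite.unop A).ext (freeOp k))

noncomputable def coverπ (A : ProMod k) : cover A ⟶ A :=
  ((Opposite.unop A).toExt (freeUnit k)).op

instance (A : ProMod k) : Epi (coverπ A) := by
  have := Ind.mono_toExt (freeUnit k) (Opposite.unop A)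
  exact inferInstanceAs (Epi ((Opposite.unop A).toExt (freeUnit k)).op)

theorem exists_cover_map {A B : ProMod k} (f : A ⟶ B) :
    ∃ g : cover A ⟶ cover B, g ≫ coverπ B = coverπ A ≫ f := by
  obtain ⟨g, hg⟩ := Ind.exists_ext_map (freeUnit k) (Quiver.Hom.unop f)
  exact ⟨g.op, congrArg Quiver.Hom.op hg⟩

noncomputable def coverMap {A B : ProMod k} (f : A ⟶ B) : cover A ⟶ cover B :=
  (exists_cover_map f).choose

@[simp]
theorem coverMap_π {A B : ProMod k} (f : A ⟶ B) : coverMap f ≫ coverπ B = coverπ A ≫ f :=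
  (exists_cover_map f).choose_spec

instance (P : ProMod k) : (homFrom P).Additive where
  map_add {T T' f g} := by
    ext h
    exact (congrArg (h ≫ ·) ((ι k).map_add (f := f) (g := g))).trans
      (Preadditive.comp_add _ _ _ _ _ _)

instance : PreservesFiniteLimits (ι k) := by
  have : PreservesFiniteColimits (Ind.yoneda (C := (ModuleCat.{u} k)ᵒᵖ)) := inferInstance
  exact preservesFiniteLimits_rightOp (Ind.yoneda (C := (ModuleCat.{u} k)ᵒᵖ))

instance (P : ProMod k) : PreservesFiniteLimits (homFrom P) := by
  have : PreservesFiniteLimits (homFrom P ⋙ forget (ModuleCat.{u} k)) :=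
    inferInstanceAs (PreservesFiniteLimits (ι k ⋙ coyoneda.obj (op P)))
  exact preservesFiniteLimits_of_reflects_of_preserves (homFrom P) (forget (ModuleCat.{u} k))

/-- Hom(P, -) is always left exact, because `ι` is; only preservation of surjections is at stake. -/
theorem isQuasiProjective_of_lift (P : ProMod k)
    (h : ∀ (T T' : ModuleCat.{u} k) (f : T ⟶ T') (_ : Epi f) (a : P ⟶ (ι k).obj T'),
      ∃ b : P ⟶ (ι k).obj T, b ≫ (ι k).map f = a) : P.IsQuasiProjective := by
  refine ⟨inferInstance, ?_⟩
  have : (homFrom P).PreservesEpimorphisms := ⟨fun {T T'} f hf => by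
    rw [ModuleCat.epi_iff_surjective]
    exact fun a => h T T' f hf a⟩
  rw [Functor.preservesFiniteColimits_iff_forall_exact_map_and_epi]
  intro S hS
  have := hS.epi_g
  have e := ((Functor.preservesFiniteLimits_iff_forall_exact_map_and_mono (homFrom P)).1
    inferInstance S hS).1
  exact ⟨e, inferInstance⟩

/-- A map from the cover to a module factors through one term of the pro-system, which is a free
module and therefore lifts along epimorphisms. -/
theorem isQuasiProjective_cover (A : ProMod k) : (cover A).IsQuasiProjective := by
  refine isQuasiProjective_of_lift _ fun T T' f _ a => ?_
  obtain ⟨i, b, hb⟩ := Ind.exists_factor (Quiver.Hom.unop a)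
  have : Projective ((ModuleCat.free k).obj ((forget (ModuleCat.{u} k)).obj
    ((Opposite.unop A).presentation.F.obj i).unop)) :=
    (ModuleCat.adj k).map_projective _ inferInstance
  let b' : (ModuleCat.free k).obj ((forget (ModuleCat.{u} k)).obj
    ((Opposite.unop A).presentation.F.obj i).unop) ⟶ T' := b.unop
  refine ⟨Quiver.Hom.op (Ind.yoneda.map (Projective.factorThru b' f).op ≫
    Ind.limι ((Opposite.unop A).presentation.F ⋙ freeOp k) i), ?_⟩
  refine congrArg Quiver.Hom.op (a₂ := Quiver.Hom.unop a) (Eq.trans ?_ hb)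
  refine (Category.assoc _ _ _).symm.trans (congrArg (· ≫ _) ?_)
  refine (Ind.yoneda.map_comp _ _).symm.trans (congrArg Ind.yoneda.map ?_)
  exact congrArg Quiver.Hom.op (Projective.factorThru_comp b' f)

/-- Exactness can be tested by mapping into injective modules. -/
theorem exact_iff (S : ShortComplex (ProMod k)) : S.Exact ↔
    ∀ (T : ModuleCat.{u} k), Injective T → ∀ h : S.X₂ ⟶ (ι k).obj T, S.f ≫ h = 0 →
      ∃ h' : S.X₃ ⟶ (ι k).obj T, S.g ≫ h' = h := by
  constructor
  · intro hS T _ h w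
    exact ⟨hS.descToInjective h w, hS.comp_descToInjective h w⟩
  · intro H
    rw [S.exact_iff_isZero_homology]
    refine isZero_of_hom_ι _ fun T hT g => ?_
    -- A map from the homology to an injective extends to the opcycles. If the extension factors
    -- through the map from the opcycles to X₃, its restriction to the homology vanishes.
    obtain ⟨h', hh⟩ := H T hT (S.pOpcycles ≫ Injective.factorThru g S.homologyι) (by simp)
    have : S.fromOpcycles ≫ h' = Injective.factorThru g S.homologyι := by
      rw [← cancel_epi S.pOpcycles, ← hh]; simp
    rw [← Injective.comp_factorThru g S.homologyι, ← this]
    simp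

theorem mono_iff {A B : ProMod k} (f : A ⟶ B) : Mono f ↔
    ∀ (T : ModuleCat.{u} k), Injective T → ∀ h : A ⟶ (ι k).obj T,
      ∃ h' : B ⟶ (ι k).obj T, f ≫ h' = h := by
  have := (ShortComplex.mk (0 : A ⟶ A) f zero_comp).exact_iff_mono rfl
  rw [← this, exact_iff]
  simp

/-- Maps from a coproduct to `ι T` are families, so the extensions required by `mono_iff` may be
chosen componentwise. -/
instance mono_sigmaMap {J : Type u} {A B : J → ProMod k} (f : ∀ j, A j ⟶ B j) [∀ j, Mono (f j)] :
    Mono (Limits.Sigma.map f) := by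
  rw [mono_iff]
  intro T hT h
  choose h' hh using fun j => (mono_iff (f j)).1 inferInstance T hT (Sigma.ι A j ≫ h)
  exact ⟨Sigma.desc h', Sigma.hom_ext _ _ fun j => by simp [hh]⟩

end ProMod

/-! ### Quasi-projective covers of functors -/

section
variable {k : Type u} [CommRing k] {I J : Type u} [SmallCategory I] [SmallCategory J]

/-- The inclusions of the summands of `⨁_{i ⟶ j} P(F i)`, where `P` is the quasi-projective
cover. -/
noncomputable def summandIncl (F : I ⥤ ProMod k) {i j : I} (f : i ⟶ j) :
    ProMod.cover (F.obj i) ⟶ ∐ fun p : (Σ i : I, i ⟶ j) => ProMod.cover (F.obj p.1) :=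
  Sigma.ι (fun p : (Σ i : I, i ⟶ j) => ProMod.cover (F.obj p.1)) ⟨i, f⟩

/-- The functor `j ↦ ⨁_{i ⟶ j} P(F i)`. -/
noncomputable def coverFunctor (F : I ⥤ ProMod k) : I ⥤ ProMod k where
  obj j := ∐ fun p : (Σ i : I, i ⟶ j) => ProMod.cover (F.obj p.1)
  map f := Sigma.desc fun p => summandIncl F (p.2 ≫ f)
  map_id j := Sigma.hom_ext _ _ fun p => by
    rw [colimit.ι_desc, Category.comp_id]
    exact congrArg (summandIncl F) (Category.comp_id p.2)
  map_comp {_ _ j} f g := Sigma.hom_ext _ _ fun p => by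
    refine (colimit.ι_desc _ _).trans (Eq.symm ?_)
    refine (Category.assoc _ _ _).symm.trans ((eq_whisker (colimit.ι_desc _ _) _).trans ?_)
    refine (colimit.ι_desc _ _).trans ?_
    exact congrArg (summandIncl F) (Category.assoc p.2 f g)

namespace coverFunctor

noncomputable def incl (F : I ⥤ ProMod k) {i j : I} (f : i ⟶ j) :
    ProMod.cover (F.obj i) ⟶ (coverFunctor F).obj j :=
  summandIncl F f

theorem incl_map (F : I ⥤ ProMod k) {i j j' : I} (f : i ⟶ j) (g : j ⟶ j') :
    incl F f ≫ (coverFunctor F).map g = incl F (f ≫ g) :=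
  Sigma.ι_desc _ _

theorem incl_map_assoc (F : I ⥤ ProMod k) {i j j' : I} (f : i ⟶ j) (g : j ⟶ j') {Z : ProMod k}
    (h : (coverFunctor F).obj j' ⟶ Z) :
    incl F f ≫ (coverFunctor F).map g ≫ h = incl F (f ≫ g) ≫ h := by
  rw [← Category.assoc, incl_map]

theorem hom_ext {F : I ⥤ ProMod k} {j : I} {Z : ProMod k} {a b : (coverFunctor F).obj j ⟶ Z}
    (h : ∀ (i : I) (f : i ⟶ j), incl F f ≫ a = incl F f ≫ b) : a = b :=
  Sigma.hom_ext _ _ fun p => h p.1 p.2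

noncomputable def desc (F : I ⥤ ProMod k) {j : I} {Z : ProMod k}
    (a : ∀ (i : I) (_ : i ⟶ j), ProMod.cover (F.obj i) ⟶ Z) : (coverFunctor F).obj j ⟶ Z :=
  Sigma.desc fun p => a p.1 p.2

theorem incl_desc (F : I ⥤ ProMod k) {i j : I} {Z : ProMod k}
    (a : ∀ (i : I) (_ : i ⟶ j), ProMod.cover (F.obj i) ⟶ Z) (f : i ⟶ j) :
    incl F f ≫ desc F a = a i f :=
  Sigma.ι_desc _ _

theorem incl_desc_assoc (F : I ⥤ ProMod k) {i j : I} {Z W : ProMod k}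
    (a : ∀ (i : I) (_ : i ⟶ j), ProMod.cover (F.obj i) ⟶ Z) (f : i ⟶ j) (h : Z ⟶ W) :
    incl F f ≫ desc F a ≫ h = a i f ≫ h := by
  rw [← Category.assoc, incl_desc]

noncomputable def π (F : I ⥤ ProMod k) : coverFunctor F ⟶ F where
  app j := desc F fun i f => ProMod.coverπ (F.obj i) ≫ F.map f
  naturality j j' g := hom_ext fun i f => by
    rw [incl_map_assoc, incl_desc, incl_desc_assoc]; simp

theorem incl_π (F : I ⥤ ProMod k) {i j : I} (f : i ⟶ j) :
    incl F f ≫ (π F).app j = ProMod.coverπ (F.obj i) ≫ F.map f :=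
  incl_desc _ _ _

/-- On the summand of the identity of j the map is the cover of F(j), which is already epi. -/
instance (F : I ⥤ ProMod k) : Epi (π F) := by
  have : ∀ j, Epi ((π F).app j) := fun j => by
    have h := incl_π F (𝟙 j)
    rw [F.map_id, Category.comp_id] at h
    exact epi_of_epi_fac h
  exact NatTrans.epi_of_epi_app _

/-- The transition maps of `coverFunctor F` only relabel summands. Naturality therefore needs no
functoriality of the chosen maps `ProMod.coverMap`. -/
noncomputable def map (φ : I ⥤ J) {F : I ⥤ ProMod k} {G : J ⥤ ProMod k} (α : F ⟶ φ ⋙ G) :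
    coverFunctor F ⟶ φ ⋙ coverFunctor G where
  app j := desc F fun i f => ProMod.coverMap (α.app i) ≫ incl G (φ.map f)
  naturality j j' g := hom_ext fun i f => by
    rw [incl_map_assoc, incl_desc, incl_desc_assoc, Category.assoc]
    refine Eq.trans ?_ (whisker_eq _ (incl_map G (φ.map f) (φ.map g)).symm)
    rw [φ.map_comp]

theorem map_π (φ : I ⥤ J) {F : I ⥤ ProMod k} {G : J ⥤ ProMod k} (α : F ⟶ φ ⋙ G) :
    map φ α ≫ Functor.whiskerLeft φ (π G) = π F ≫ α := by
  ext j
  refine hom_ext fun i f => ?_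
  have h₁ : incl F f ≫ (map φ α).app j = ProMod.coverMap (α.app i) ≫ incl G (φ.map f) :=
    incl_desc _ _ _
  have h₂ := α.naturality f
  have h₃ := incl_π G (φ.map f)
  have h₄ := ProMod.coverMap_π (α.app i)
  refine (Category.assoc _ _ _).symm.trans ((eq_whisker h₁ _).trans ?_)
  refine (Category.assoc _ _ _).trans ((whisker_eq _ h₃).trans ?_)
  refine (Category.assoc _ _ _).symm.trans ((eq_whisker h₄ _).trans ?_)
  refine (Category.assoc _ _ _).trans ((whisker_eq _ h₂.symm).trans ?_)
  refine (Category.assoc _ _ _).symm.trans ((eq_whisker (incl_π F f).symm _).trans ?_)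
  exact Category.assoc _ _ _

/-- A family of linear maps into `⟨P(F i), T⟩` assembles to a natural transformation into
`⟨coverFunctor F, T⟩`. -/
noncomputable def toPairing (F : I ⥤ ProMod k) (T : ModuleCat.{u} k) {N : Iᵒᵖ ⥤ ModuleCat.{u} k}
    (c : ∀ i, N.obj (op i) ⟶ (ProMod.pairing T).obj (op (ProMod.cover (F.obj i)))) :
    N ⟶ (coverFunctor F).op ⋙ ProMod.pairing T where
  app j := ModuleCat.ofHom
    { toFun := fun n => desc F (j := j.unop) fun i f => (c i).hom ((N.map f.op).hom n)
      map_add' := fun n n' => hom_ext fun i f => (incl_desc _ _ _).trans <|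
        ((congrArg (c i).hom (map_add _ _ _)).trans (map_add _ _ _)).trans <| Eq.symm <|
          (Preadditive.comp_add _ _ _ _ _ _).trans
            (congrArg₂ (· + ·) (incl_desc _ _ _) (incl_desc _ _ _))
      map_smul' := fun r n => hom_ext fun i f => (incl_desc _ _ _).trans <|
        ((congrArg (c i).hom (map_smul _ _ _)).trans (map_smul _ _ _)).trans <| Eq.symm <|
          (Category.assoc _ _ _).symm.trans (congrArg (· ≫ _) (incl_desc _ _ _)) }
  naturality j j' g := by
    ext n
    refine hom_ext fun i f => ?_
    refine (incl_desc _ _ _).trans (Eq.symm ?_)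
    refine (incl_map_assoc F f g.unop _).trans ((incl_desc _ _ _).trans ?_)
    exact congrArg (fun z => (c i).hom (z.hom n)) (N.map_comp g f.op)

theorem incl_toPairing (F : I ⥤ ProMod k) (T : ModuleCat.{u} k) {N : Iᵒᵖ ⥤ ModuleCat.{u} k}
    (c : ∀ i, N.obj (op i) ⟶ (ProMod.pairing T).obj (op (ProMod.cover (F.obj i))))
    {i j : I} (f : i ⟶ j) (n : N.obj (op j)) :
    incl F f ≫ ((toPairing F T c).app (op j)).hom n = (c i).hom ((N.map f.op).hom n) :=
  incl_desc _ _ _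

/-- The pairing with T is coinduced: it is j ↦ ∏_{i → j} ⟨cover of F(i), T⟩, and a transformation N
→ ⟨`coverFunctor F`, T⟩ is the same as a family of linear maps on the modules N(i). Since `k` is
quasi-noetherian, each factor is an injective module, so such families extend along monomorphisms.
-/
theorem isQuasiProjective (hk : IsQuasiNoetherian k) (F : I ⥤ ProMod k) :
    IsQuasiProjectiveFunctor (coverFunctor F) := fun T hT => ⟨fun {M N} g m _ => by
  have hi := fun i => hk (ProMod.cover (F.obj i)) T (ProMod.isQuasiProjective_cover _) hT
  let c := fun i => Injective.factorThru
    (g.app (op i) ≫ (ProMod.pairing T).map (incl F (𝟙 i)).op) (m.app (op i))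
  have hc : ∀ i, m.app (op i) ≫ c i = g.app (op i) ≫ (ProMod.pairing T).map (incl F (𝟙 i)).op :=
    fun i => Injective.comp_factorThru _ _
  refine ⟨toPairing F T c, ?_⟩
  ext j n
  refine hom_ext fun i f => ?_
  refine (incl_toPairing F T c f _).trans ?_
  have e₁ : (N.map f.op).hom ((m.app j).hom n) = (m.app (op i)).hom ((M.map f.op).hom n) :=
    (congrArg (fun z => z.hom n) (m.naturality f.op)).symm
  have e₂ : (c i).hom ((m.app (op i)).hom ((M.map f.op).hom n)) =
      incl F (𝟙 i) ≫ (g.app (op i)).hom ((M.map f.op).hom n) :=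
    congrArg (fun z => z.hom ((M.map f.op).hom n)) (hc i)
  have e₃ : (g.app (op i)).hom ((M.map f.op).hom n) =
      (coverFunctor F).map f ≫ (g.app j).hom n :=
    congrArg (fun z => z.hom n) (g.naturality f.op)
  refine (congrArg (c i).hom e₁).trans (e₂.trans ((whisker_eq _ e₃).trans ?_))
  exact (incl_map_assoc F (𝟙 i) f _).trans (congrArg (fun z => incl F z ≫ _) (Category.id_comp f))⟩

end coverFunctor

/-! ### Resolutions by syzygies and lifts to them -/

theorem _root_.CategoryTheory.ShortComplex.exact_of_eq {C : Type*} [Category* C]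
    [HasZeroMorphisms C] {X Y Z : C} {f f' : X ⟶ Y} {g g' : Y ⟶ Z} {w : f ≫ g = 0}
    {w' : f' ≫ g' = 0} (hf : f = f') (hg : g = g') (h : (ShortComplex.mk f' g' w').Exact) :
    (ShortComplex.mk f g w).Exact := by
  subst hf hg; exact h

/-- The syzygies of a functor with respect to `coverFunctor`. -/
noncomputable def syz (F : I ⥤ ProMod k) : ℕ → (I ⥤ ProMod k)
  | 0 => F
  | n + 1 => kernel (coverFunctor.π (syz F n))

noncomputable def syzIncl (F : I ⥤ ProMod k) (n : ℕ) : syz F (n + 1) ⟶ coverFunctor (syz F n) :=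
  kernel.ι (coverFunctor.π (syz F n))

instance (F : I ⥤ ProMod k) (n : ℕ) : Mono (syzIncl F n) :=
  inferInstanceAs (Mono (kernel.ι _))

@[simp]
theorem syzIncl_π (F : I ⥤ ProMod k) (n : ℕ) : syzIncl F n ≫ coverFunctor.π (syz F n) = 0 :=
  kernel.condition _

theorem syz_exact (F : I ⥤ ProMod k) (n : ℕ) : (ShortComplex.mk _ _ (syzIncl_π F n)).Exact :=
  ShortComplex.exact_kernel _

theorem syz_comp_zero (F : I ⥤ ProMod k) (n : ℕ) :
    (coverFunctor.π (syz F (n + 1)) ≫ syzIncl F n) ≫ coverFunctor.π (syz F n) = 0 := by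
  rw [Category.assoc, syzIncl_π, comp_zero]

theorem syz_exact_zero (F : I ⥤ ProMod k) (n : ℕ) :
    (ShortComplex.mk _ _ (syz_comp_zero F n)).Exact := by
  let f : ShortComplex.mk _ _ (syz_comp_zero F n) ⟶ ShortComplex.mk _ _ (syzIncl_π F n) :=
    { τ₁ := coverFunctor.π (syz F (n + 1)), τ₂ := 𝟙 _, τ₃ := 𝟙 _ }
  have : Epi f.τ₁ := inferInstanceAs (Epi (coverFunctor.π (syz F (n + 1))))
  exact (ShortComplex.exact_iff_of_epi_of_isIso_of_mono f).2 (syz_exact F n)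

theorem syz_comp_comp_zero (F : I ⥤ ProMod k) (n : ℕ) :
    (coverFunctor.π (syz F (n + 2)) ≫ syzIncl F (n + 1)) ≫
      (coverFunctor.π (syz F (n + 1)) ≫ syzIncl F n) = 0 := by
  rw [← Category.assoc, syz_comp_zero, zero_comp]

theorem syz_exact_succ (F : I ⥤ ProMod k) (n : ℕ) :
    (ShortComplex.mk _ _ (syz_comp_comp_zero F n)).Exact := by
  let f : ShortComplex.mk _ _ (syz_comp_zero F (n + 1)) ⟶
      ShortComplex.mk _ _ (syz_comp_comp_zero F n) :=
    { τ₁ := 𝟙 _, τ₂ := 𝟙 _, τ₃ := syzIncl F n }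
  have : Mono f.τ₃ := inferInstanceAs (Mono (syzIncl F n))
  exact (ShortComplex.exact_iff_of_epi_of_isIso_of_mono f).1 (syz_exact_zero F (n + 1))

/-- Restriction along `φ` is exact, so the restricted syzygy of G is still the kernel of the
restricted cover, and the induced map of covers passes to kernels. -/
theorem exists_syz_map (φ : I ⥤ J) {F : I ⥤ ProMod k} {G : J ⥤ ProMod k} (n : ℕ)
    (α : syz F n ⟶ φ ⋙ syz G n) : ∃ β : syz F (n + 1) ⟶ φ ⋙ syz G (n + 1),
      β ≫ Functor.whiskerLeft φ (syzIncl G n) = syzIncl F n ≫ coverFunctor.map φ α := by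
  have hex := (syz_exact G n).map ((Functor.whiskeringLeft I J (ProMod k)).obj φ)
  have : Mono (((ShortComplex.mk _ _ (syzIncl_π G n)).map
    ((Functor.whiskeringLeft I J (ProMod k)).obj φ)).f) :=
    inferInstanceAs (Mono (((Functor.whiskeringLeft I J (ProMod k)).obj φ).map (syzIncl G n)))
  have hz : (syzIncl F n ≫ coverFunctor.map φ α) ≫
      Functor.whiskerLeft φ (coverFunctor.π (syz G n)) = 0 := by
    rw [Category.assoc, coverFunctor.map_π, ← Category.assoc, syzIncl_π, zero_comp]
  exact ⟨hex.lift (syzIncl F n ≫ coverFunctor.map φ α) hz,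
    hex.lift_f (syzIncl F n ≫ coverFunctor.map φ α) hz⟩

noncomputable def syzMap (φ : I ⥤ J) {F : I ⥤ ProMod k} {G : J ⥤ ProMod k} (α : F ⟶ φ ⋙ G) :
    ∀ n, syz F n ⟶ φ ⋙ syz G n
  | 0 => α
  | n + 1 => (exists_syz_map φ n (syzMap φ α n)).choose

theorem syzMap_incl (φ : I ⥤ J) {F : I ⥤ ProMod k} {G : J ⥤ ProMod k} (α : F ⟶ φ ⋙ G) (n : ℕ) :
    syzMap φ α (n + 1) ≫ Functor.whiskerLeft φ (syzIncl G n) =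
      syzIncl F n ≫ coverFunctor.map φ (syzMap φ α n) :=
  (exists_syz_map φ n (syzMap φ α n)).choose_spec

noncomputable def syzComplex (F : I ⥤ ProMod k) : ChainComplex (I ⥤ ProMod k) ℕ :=
  ChainComplex.of (fun n => coverFunctor (syz F n)) (fun n => coverFunctor.π _ ≫ syzIncl F n)
    (fun n => by rw [Category.assoc, ← Category.assoc (syzIncl F (n + 1)), syzIncl_π,
      zero_comp, comp_zero])

theorem syzComplex_d (F : I ⥤ ProMod k) (n : ℕ) :
    (syzComplex F).d (n + 1) n = coverFunctor.π _ ≫ syzIncl F n :=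
  ChainComplex.of_d (fun n => coverFunctor (syz F n)) (fun n => coverFunctor.π _ ≫ syzIncl F n) n

noncomputable def syzResolution (hk : IsQuasiNoetherian k) (F : I ⥤ ProMod k) :
    ResolutionBy IsQuasiProjectiveFunctor F where
  complex := syzComplex F
  mem n := coverFunctor.isQuasiProjective hk (syz F n)
  π := coverFunctor.π F
  w := by
    rw [syzComplex_d]
    exact (Category.assoc _ _ _).trans ((whisker_eq _ (syzIncl_π F 0)).trans comp_zero)
  epi := inferInstanceAs (Epi (coverFunctor.π F))
  exact_zero := by
    exact ShortComplex.exact_of_eq (syzComplex_d F 0) rfl (syz_exact_zero F 0)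
  exact_succ n := by
    rw [HomologicalComplex.exactAt_iff' _ (n + 2) (n + 1) n (by simp) (by simp)]
    exact ShortComplex.exact_of_eq (syzComplex_d F (n + 1)) (syzComplex_d F n) (syz_exact_succ F n)

theorem map_comp_whiskerLeft_d (φ : I ⥤ J) {F : I ⥤ ProMod k} {G : J ⥤ ProMod k}
    (α : F ⟶ φ ⋙ G) (n : ℕ) :
    coverFunctor.map φ (syzMap φ α (n + 1)) ≫ Functor.whiskerLeft φ ((syzComplex G).d (n + 1) n) =
      (syzComplex F).d (n + 1) n ≫ coverFunctor.map φ (syzMap φ α n) := by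
  refine (whisker_eq _ (congrArg (Functor.whiskerLeft φ) (syzComplex_d G n))).trans
    (Eq.trans ?_ (eq_whisker (syzComplex_d F n) _).symm)
  refine (whisker_eq _ (Functor.whiskerLeft_comp φ _ _)).trans ?_
  refine (Category.assoc _ _ _).symm.trans ((eq_whisker (coverFunctor.map_π φ _) _).trans ?_)
  refine (Category.assoc _ _ _).trans ((whisker_eq _ (syzMap_incl φ α n)).trans ?_)
  exact (Category.assoc _ _ _).symm

/-- Morphisms of diagrams lift to the resolutions by syzygies. -/
noncomputable def syzLift (hk : IsQuasiNoetherian k) {D E : Diagram k} (u : D ⟶ E) :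
    Diagram.Lift u (syzResolution hk D.functor) (syzResolution hk E.functor) where
  hom :=
    { f := fun n => coverFunctor.map u.base (syzMap u.base u.fiber n)
      comm' := fun i n h => by
        obtain rfl : n + 1 = i := h
        exact map_comp_whiskerLeft_d u.base u.fiber n }
  w := coverFunctor.map_π u.base u.fiber
end

/-! ### Faces of strings with a new first object -/

section
variable {I : Type u} [SmallCategory I]

/-- The extension of a map between finite ordinals by a new least element. -/
def finShift {m n : ℕ} (θ : Fin m → Fin n) : Fin (m + 1) → Fin (n + 1) :=
  Fin.cases 0 fun i => (θ i).succ

theorem finShift_mono {m n : ℕ} {θ : Fin m → Fin n} (hθ : Monotone θ) : Monotone (finShift θ) := by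
  intro i j h
  induction i using Fin.cases with
  | zero => exact Fin.zero_le _
  | succ i =>
    induction j using Fin.cases with
    | zero => simp at h
    | succ j => exact Fin.succ_le_succ_iff.2 (hθ (Fin.succ_le_succ_iff.1 h))

/-- Restriction along a shifted map keeps the new first object, but its outgoing arrow now ends at
the object of `s` with index `θ 0`. -/
theorem whiskerLeft_precomp {m n : ℕ} (s : ComposableArrows I n) {x : I} (f : x ⟶ s.obj 0)
    {θ : Fin (m + 1) → Fin (n + 1)} (hθ : Monotone θ) :
    (s.precomp f).whiskerLeft (finShift_mono hθ).functor =
      (s.whiskerLeft hθ.functor).precomp (f ≫ s.map (homOfLE (Fin.zero_le (θ 0)))) := by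
  refine ComposableArrows.ext_succ rfl rfl ?_
  refine Eq.trans ?_ ((Category.id_comp _).trans (Category.comp_id _)).symm
  change (s.precomp f).map (homOfLE (Fin.zero_le (θ 0).succ)) = f ≫ s.map (homOfLE (Fin.zero_le (θ 0)))
  generalize θ 0 = j
  induction j using Fin.cases with
  | zero => exact ((congrArg (f ≫ ·) (s.map_id 0)).trans (Category.comp_id f)).symm
  | succ j => rfl

theorem face_precomp_zero {n : ℕ} (s : ComposableArrows I n) {x : I} (f : x ⟶ s.obj 0) :
    face (s.precomp f) 0 = s := by
  have h : ∀ {θ θ' : Fin (n + 1) → Fin (n + 2)} (hθ : Monotone θ) (hθ' : Monotone θ'), θ = θ' →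
    (s.precomp f).whiskerLeft hθ.functor = (s.precomp f).whiskerLeft hθ'.functor := by
    rintro θ _ _ _ rfl
    rfl
  exact h _ (Fin.strictMono_succ).monotone (by ext; simp)

/-- The coface with index `j.succ` is the shift of the coface with index `j`. The first arrow really
changes only for j = 0, where it absorbs i_0 → i_1. -/
theorem face_precomp_succ {n : ℕ} (s : ComposableArrows I (n + 1)) {x : I} (f : x ⟶ s.obj 0)
    (j : Fin (n + 2)) : face (s.precomp f) j.succ =
      (face s j).precomp (f ≫ s.map (homOfLE (Fin.zero_le (j.succAbove 0)))) := by
  have h : ∀ {θ θ' : Fin (n + 2) → Fin (n + 3)} (hθ : Monotone θ) (hθ' : Monotone θ'), θ = θ' →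
    (s.precomp f).whiskerLeft hθ.functor = (s.precomp f).whiskerLeft hθ'.functor := by
    rintro θ _ _ _ rfl
    rfl
  refine (h _ (finShift_mono (Fin.succAboveOrderEmb j).monotone) ?_).trans
    (whiskerLeft_precomp s f _)
  funext i
  induction i using Fin.cases with
  | zero => simp [finShift]
  | succ i => simp [finShift]

theorem face_precomp_one {n : ℕ} (s : ComposableArrows I (n + 1)) {x : I} (f : x ⟶ s.obj 0) :
    face (s.precomp f) 1 = (face s 0).precomp (f ≫ s.map (homOfLE (Fin.zero_le 1))) :=
  face_precomp_succ s f 0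

theorem face_precomp_succ_succ {n : ℕ} (s : ComposableArrows I (n + 1)) {x : I}
    (f : x ⟶ s.obj 0) (j : Fin (n + 1)) :
    face (s.precomp f) j.succ.succ = (face s j.succ).precomp f :=
  (face_precomp_succ s f j.succ).trans (congrArg (face s j.succ).precomp
    ((congrArg (f ≫ ·) (s.map_id 0)).trans (Category.comp_id f)))
end

/-! ### The bar construction of a quasi-projective functor is acyclic -/

section
variable {k : Type u} [CommRing k] {I : Type u} [SmallCategory I]

/-- The chain map of bar constructions given by a morphism of diagrams. -/
noncomputable def barDiagramMap {D E : Diagram k} (u : D ⟶ E) (n : ℕ) :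
    barObj D.functor n ⟶ barObj E.functor n :=
  Sigma.desc fun s => u.fiber.app (s.obj 0) ≫ barρ E.functor (s ⋙ u.base : ComposableArrows E.I n)

theorem barρ_barDiagramMap {D E : Diagram k} (u : D ⟶ E) {n : ℕ} (s : ComposableArrows D.I n) :
    barρ D.functor s ≫ barDiagramMap u n =
      u.fiber.app (s.obj 0) ≫ barρ E.functor (s ⋙ u.base : ComposableArrows E.I n) :=
  Sigma.ι_desc _ _

/-- The bar construction as a functor of the index category and the diagram. -/
noncomputable def barDiagramSimplicial (k : Type u) [CommRing k] :
    Diagram k ⥤ SimplicialObject (ProMod k) where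
  obj D := barSimplicial.obj D.functor
  map {D E} u :=
    { app := fun Δ => barDiagramMap u Δ.unop.len
      naturality := fun Δ Δ' θ => bar_hom_ext fun s => by
        have h := u.fiber.naturality (s.map (homOfLE (Fin.zero_le (θ.unop.toOrderHom 0))))
        refine (Category.assoc _ _ _).symm.trans
          ((eq_whisker (barρ_barMap D.functor θ.unop.toOrderHom s) _).trans ?_)
        refine (Category.assoc _ _ _).trans ((whisker_eq _ (barρ_barDiagramMap u _)).trans ?_)
        refine Eq.symm ((Category.assoc _ _ _).symm.trans
          ((eq_whisker (barρ_barDiagramMap u s) _).trans ?_))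
        refine (Category.assoc _ _ _).trans
          ((whisker_eq _ (barρ_barMap E.functor θ.unop.toOrderHom _)).trans ?_)
        exact (Category.assoc _ _ _).symm.trans ((eq_whisker h.symm _).trans (Category.assoc _ _ _)) }
  map_id D := NatTrans.ext (funext fun Δ => bar_hom_ext fun s =>
    (barρ_barDiagramMap (𝟙 D) s).trans
      ((Category.id_comp (barρ D.functor s)).trans (Category.comp_id _).symm))
  map_comp {D E F} u v := NatTrans.ext (funext fun Δ => bar_hom_ext fun s => by
    have h₁ := barρ_barDiagramMap u s
    have h₂ := barρ_barDiagramMap v (s ⋙ u.base : ComposableArrows E.I _)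
    have h₃ : (u ≫ v).fiber.app (s.obj 0) =
        u.fiber.app (s.obj 0) ≫ v.fiber.app (u.base.obj (s.obj 0)) :=
      whisker_eq (u.fiber.app (s.obj 0)) (Category.comp_id _)
    refine (barρ_barDiagramMap (u ≫ v) s).trans ((eq_whisker h₃ _).trans ?_)
    refine Eq.symm ((Category.assoc _ _ _).symm.trans ((eq_whisker h₁ _).trans ?_))
    exact (Category.assoc _ _ _).trans ((whisker_eq _ h₂).trans (Category.assoc _ _ _).symm))

noncomputable def barDiagram (k : Type u) [CommRing k] : Diagram k ⥤ ChainComplex (ProMod k) ℕ :=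
  barDiagramSimplicial k ⋙ AlgebraicTopology.alternatingFaceMapComplex (ProMod k)

/-- On diagrams indexed by a fixed category this is the bar construction. -/
noncomputable def inclBarDiagramIso (k : Type u) [CommRing k] (I : Type u) [SmallCategory I] :
    Diagram.incl I ⋙ barDiagram k ≅ barComplex k I :=
  NatIso.ofComponents (fun _ => Iso.refl _) fun {F G} α => by
    refine (Category.comp_id _).trans (Eq.trans ?_ (Category.id_comp _).symm)
    refine HomologicalComplex.hom_ext _ _ fun n => bar_hom_ext fun s => ?_
    refine (barρ_barDiagramMap ((Diagram.incl I).map α) s).trans ?_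
    exact (eq_whisker (Category.comp_id (α.app (s.obj 0))) _).trans (barρ_barNat α s).symm

/-- A quasi-projective functor is a retract of a coinduced one after pairing with an injective
module. -/
theorem IsQuasiProjectiveFunctor.exists_retraction {P : I ⥤ ProMod k}
    (hP : IsQuasiProjectiveFunctor P) (T : ModuleCat.{u} k) (hT : Injective T) :
    ∃ r : ∀ j : I, (∀ i : I, (i ⟶ j) → (P.obj i ⟶ (ProMod.ι k).obj T)) →+
        (P.obj j ⟶ (ProMod.ι k).obj T),
      (∀ (j j' : I) (g : j ⟶ j') x, P.map g ≫ r j' x = r j fun i f => x i (f ≫ g)) ∧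
      ∀ (j : I) (m : P.obj j ⟶ (ProMod.ι k).obj T), r j (fun _ f => P.map f ≫ m) = m := by
  let M := P.op ⋙ ProMod.pairing T
  -- The coinduced functor j ↦ ∏_{i → j} ⟨P i, T⟩. The embedding `η` restricts a functional on P(j)
  -- along all arrows into j.
  let M' : Iᵒᵖ ⥤ ModuleCat.{u} k :=
    { obj := fun j => ModuleCat.of k
        (∀ i : I, (i ⟶ j.unop) → (P.obj i ⟶ (ProMod.ι k).obj T))
      map := fun {j j'} g => ModuleCat.ofHom
        { toFun := fun x i f => x i (f ≫ g.unop)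
          map_add' := fun _ _ => rfl
          map_smul' := fun _ _ => rfl }
      map_id := fun j => by
        ext x
        exact congrArg (x _) (Category.comp_id _)
      map_comp := fun g g' => by
        ext x
        exact congrArg (x _) (Category.assoc _ _ _).symm }
  let η : M ⟶ M' :=
    { app := fun j => ModuleCat.ofHom
        { toFun := fun m i f => P.map f ≫ m
          map_add' := fun m m' => funext fun i => funext fun f => Preadditive.comp_add _ _ _ _ _ _
          map_smul' := fun r m => funext fun i => funext fun f => (Category.assoc _ _ _).symm }
      naturality := fun j j' g => by
        ext m
        exact (Category.assoc _ _ _).symm.trans (eq_whisker (P.map_comp _ g.unop).symm _) }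
  -- The component at the identity of j recovers the functional.
  have : ∀ j, Mono (η.app j) := fun j => by
    rw [ModuleCat.mono_iff_injective]
    have e : ∀ m : P.obj j.unop ⟶ (ProMod.ι k).obj T, P.map (𝟙 j.unop) ≫ m = m := fun m => by
      rw [P.map_id, Category.id_comp]
    exact fun m m' h => (e m).symm.trans ((congrFun (congrFun h j.unop) (𝟙 _)).trans (e m'))
  have : Mono η := NatTrans.mono_of_mono_app _
  have : Injective M := hP T hT
  let r := Injective.factorThru (𝟙 M) η
  have hr : η ≫ r = 𝟙 M := Injective.comp_factorThru _ _
  refine ⟨fun j => (r.app (op j)).hom.toAddMonoidHom, fun j j' g x => ?_, fun j m => ?_⟩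
  · exact (congrArg (fun z => z.hom x) (r.naturality g.op)).symm
  · exact congrArg (fun z => (z.app (op j)).hom m) hr

/-- Serves to solve a cocycle identity for its leading term: moving the remaining terms to the other
side lowers each index by one and so absorbs the sign. -/
theorem add_alternatingSum_eq {M : Type*} [AddCommGroup M] {n : ℕ} {x a : M} {b : Fin n → M}
    (w : Fin (n + 1) → M) (h₀ : w 0 = a) (hs : ∀ j : Fin n, w j.succ = b j)
    (h : x + ∑ j, (-1 : ℤ) ^ (j.1 + 1) • w j = 0) : a + ∑ j, (-1 : ℤ) ^ (j.1 + 1) • b j = x := by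
  rw [Fin.sum_univ_succ, h₀] at h
  simp only [hs, Fin.val_zero, Fin.val_succ, zero_add, pow_succ _ (_ + 1), mul_neg_one, neg_smul,
    Finset.sum_neg_distrib, pow_one, one_smul] at h
  rw [← sub_eq_zero, ← neg_eq_zero, ← h]
  abel

theorem AddMonoidHom.map_add_alternatingSum {M N : Type*} [AddCommGroup M] [AddCommGroup N] {n : ℕ}
    (r : M →+ N) (a : M) (b : Fin n → M) :
    r (a + ∑ j, (-1 : ℤ) ^ (j.1 + 1) • b j) = r a + ∑ j, (-1 : ℤ) ^ (j.1 + 1) • r (b j) := by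
  simp

/-- The source of `barρ F s` depends on `s`, so equal strings yield maps of different types. The
heterogeneous hypotheses become reflexivity when both first objects reduce to the same object. -/
theorem barρ_comp_congr (F : I ⥤ ProMod k) {n : ℕ} {Z : ProMod k} (h : barObj F n ⟶ Z)
    {s s' : ComposableArrows I n} (e : s = s') {i : I} {a b : F.obj i ⟶ Z}
    (ha : a ≍ barρ F s ≫ h) (hb : b ≍ barρ F s' ≫ h) : a = b := by
  subst e
  exact eq_of_heq (ha.trans hb.symm)

theorem barρ_d_comp (F : I ⥤ ProMod k) (n : ℕ) {Z : ProMod k} (h : barObj F n ⟶ Z)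
    (s : ComposableArrows I (n + 1)) :
    barρ F s ≫ ((barComplex k I).obj F).d (n + 1) n ≫ h =
      (F.map (s.map (homOfLE (Fin.zero_le 1))) ≫ barρ F (face s 0) ≫ h +
        ∑ j : Fin (n + 1), (-1 : ℤ) ^ (j.1 + 1) • (barρ F (face s j.succ) ≫ h) :
          F.obj (s.obj 0) ⟶ Z) := by
  refine (Category.assoc _ _ _).symm.trans ((eq_whisker (barρ_d F n s) h).trans ?_)
  refine (Preadditive.add_comp _ _ _ _ _ _).trans (congrArg₂ (· + ·) (Category.assoc _ _ _) ?_)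
  refine (Preadditive.sum_comp _ _ _).trans (Finset.sum_congr rfl fun j _ => ?_)
  exact Preadditive.zsmul_comp _ _ _

/-- The bar construction of a quasi-projective functor is exact in positive degrees. -/
theorem barComplex_exactAt {P : I ⥤ ProMod k} (hP : IsQuasiProjectiveFunctor P) (n : ℕ) :
    ((barComplex k I).obj P).ExactAt (n + 1) := by
  rw [HomologicalComplex.exactAt_iff' _ (n + 2) (n + 1) n (by simp) (by simp), ProMod.exact_iff]
  intro T hT h w
  obtain ⟨r, hr, hr'⟩ := hP.exists_retraction T hT
  change barObj P (n + 1) ⟶ (ProMod.ι k).obj T at h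
  change ((barComplex k I).obj P).d (n + 2) (n + 1) ≫ h = 0 at w
  let v (m : ℕ) (g : barObj P m ⟶ (ProMod.ι k).obj T) (s : ComposableArrows I m) :
    P.obj (s.obj 0) ⟶ (ProMod.ι k).obj T := barρ P s ≫ g
  -- The contraction: on a string `s` evaluate `h` on all strings prefixed by an arrow into the
  -- first object of `s`, then return from the coinduced functor by the retraction.
  let h' : barObj P n ⟶ (ProMod.ι k).obj T :=
    Sigma.desc fun s => r (s.obj 0) fun i f => (v _ h (s.precomp f) : P.obj i ⟶ _)
  have hh' : ∀ s, barρ P s ≫ h' = r (s.obj 0) fun i f => (v _ h (s.precomp f) : P.obj i ⟶ _) :=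
    fun s => Sigma.ι_desc _ _
  refine ⟨h', bar_hom_ext fun (s : ComposableArrows I (n + 1)) => ?_⟩
  let A : ∀ i, (i ⟶ s.obj 0) → (P.obj i ⟶ (ProMod.ι k).obj T) := fun i f =>
    v _ h ((face s 0).precomp (f ≫ s.map (homOfLE (Fin.zero_le 1))))
  let B (j : Fin (n + 1)) : ∀ i, (i ⟶ s.obj 0) → (P.obj i ⟶ (ProMod.ι k).obj T) := fun i f =>
    v _ h ((face s j.succ).precomp f)
  -- The cocycle identity of `h` on the prefixed string `s.precomp f`, solved for the face that
  -- drops the prefix.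
  have key : ∀ i (f : i ⟶ s.obj 0),
      A i f + ∑ j : Fin (n + 1), (-1 : ℤ) ^ (j.1 + 1) • B j i f = P.map f ≫ barρ P s ≫ h := by
    intro i f
    have e := barρ_d_comp P (n + 1) h (s.precomp f)
    have e₀ : (v _ h (face (s.precomp f) 0) : P.obj (s.obj 0) ⟶ _) = v _ h s :=
      barρ_comp_congr P h (face_precomp_zero s f) HEq.rfl HEq.rfl
    have e₁ : (v _ h (face (s.precomp f) 1) : P.obj i ⟶ _) = A i f :=
      barρ_comp_congr P h (face_precomp_one s f) HEq.rfl HEq.rfl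
    have e₂ : ∀ j : Fin (n + 1), (v _ h (face (s.precomp f) j.succ.succ) : P.obj i ⟶ _) = B j i f :=
      fun j => barρ_comp_congr P h (face_precomp_succ_succ s f j) HEq.rfl HEq.rfl
    let w' : Fin (n + 2) → (P.obj i ⟶ (ProMod.ι k).obj T) :=
      fun j => v _ h (face (s.precomp f) j.succ)
    have e₃ : P.map f ≫ v _ h s + ∑ j : Fin (n + 2), (-1 : ℤ) ^ (j.1 + 1) • w' j = 0 :=
      (congrArg (P.map f ≫ · + _) e₀.symm).trans (e.symm.trans ((whisker_eq _ w).trans comp_zero))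
    exact add_alternatingSum_eq w' e₁ e₂ e₃
  refine (barρ_d_comp P n h' s).trans ?_
  -- Naturality of the retraction moves P(i_0 → i_1) inside, where arrows into i_0 become prefixes
  -- of the zeroth face after composition with i_0 → i_1.
  have e₁ : P.map (s.map (homOfLE (Fin.zero_le 1))) ≫ barρ P (face s 0) ≫ h' = r (s.obj 0) A :=
    (whisker_eq _ (hh' (face s 0))).trans (hr _ _ _ _)
  have e₂ : ∀ j : Fin (n + 1), barρ P (face s j.succ) ≫ h' = r (s.obj 0) (B j) :=
    fun j => hh' (face s j.succ)
  refine (congrArg₂ (· + ·) e₁ (Finset.sum_congr rfl fun j _ =>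
    congrArg (fun z => (-1 : ℤ) ^ (j.1 + 1) • z) (e₂ j))).trans ?_
  refine Eq.trans ?_ (hr' (s.obj 0) (barρ P s ≫ h))
  refine Eq.trans ?_ (congrArg (r (s.obj 0)) (funext fun i => funext fun f => key i f))
  refine (AddMonoidHom.map_add_alternatingSum (r (s.obj 0)) A B).symm.trans
    (congrArg (r (s.obj 0)) ?_)
  funext i f
  simp
end

/-! ### The bar construction as an exact functor with zeroth homology the colimit -/

namespace ProMod
variable {k : Type u} [CommRing k]

/-- As for monomorphisms, the test by injective modules splits into independent tests on the
summands. -/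
theorem exact_sigmaMap {J : Type u} {A B C : J → ProMod k} (f : ∀ j, A j ⟶ B j)
    (g : ∀ j, B j ⟶ C j) (w : ∀ j, f j ≫ g j = 0)
    (h : ∀ j, (ShortComplex.mk (f j) (g j) (w j)).Exact)
    (w' : Limits.Sigma.map f ≫ Limits.Sigma.map g = 0) :
    (ShortComplex.mk (Limits.Sigma.map f) (Limits.Sigma.map g) w').Exact := by
  rw [exact_iff]
  intro T hT (a : ∐ B ⟶ _) ha
  have ha' : ∀ j, f j ≫ Sigma.ι B j ≫ a = 0 := fun j => by
    have e : f j ≫ Sigma.ι B j = Sigma.ι A j ≫ Limits.Sigma.map f := (Sigma.ι_map _ _).symm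
    rw [← Category.assoc, e, Category.assoc]
    exact (whisker_eq _ ha).trans comp_zero
  choose b hb using fun j => (exact_iff _).1 (h j) T hT (Sigma.ι B j ≫ a) (ha' j)
  refine ⟨Sigma.desc b, Sigma.hom_ext _ _ fun j => ?_⟩
  refine Eq.trans ?_ (hb j)
  refine (Category.assoc _ _ _).symm.trans ((eq_whisker (Sigma.ι_map _ _) _).trans ?_)
  exact (Category.assoc _ _ _).trans (whisker_eq _ (Sigma.ι_desc _ _))

end ProMod

section
variable {k : Type u} [CommRing k]

/-- The colimit as a functor of the index category and the diagram. -/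
noncomputable def colimDiagram (k : Type u) [CommRing k] : Diagram k ⥤ ProMod k where
  obj D := colimit D.functor
  map u := colimMap u.fiber ≫ colimit.pre _ u.base
  map_id D := colimit.hom_ext fun i => by
    refine (Category.assoc _ _ _).symm.trans ((eq_whisker (ι_colimMap _ i) _).trans ?_)
    refine (Category.assoc _ _ _).trans ((whisker_eq _ (colimit.ι_pre _ _ i)).trans ?_)
    exact (Category.id_comp _).trans (Category.comp_id _).symm
  map_comp {D E F} u v := colimit.hom_ext fun i => by
    have h₁ : ∀ {D E : Diagram k} (u : D ⟶ E) (i : D.I), colimit.ι D.functor i ≫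
        colimMap u.fiber ≫ colimit.pre E.functor u.base =
          u.fiber.app i ≫ colimit.ι E.functor (u.base.obj i) := fun u i => by
      refine (Category.assoc _ _ _).symm.trans ((eq_whisker (ι_colimMap _ i) _).trans ?_)
      exact (Category.assoc _ _ _).trans (whisker_eq _ (colimit.ι_pre _ _ i))
    have h₂ : (u ≫ v).fiber.app i = u.fiber.app i ≫ v.fiber.app (u.base.obj i) :=
      whisker_eq (u.fiber.app i) (Category.comp_id _)
    refine (h₁ (u ≫ v) i).trans ((eq_whisker h₂ _).trans ?_)
    refine Eq.symm ((Category.assoc _ _ _).symm.trans ((eq_whisker (h₁ u i) _).trans ?_))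
    refine (Category.assoc _ _ _).trans ((whisker_eq _ (h₁ v _)).trans ?_)
    exact (Category.assoc _ _ _).symm

theorem ι_colimDiagram_map {D E : Diagram k} (u : D ⟶ E) (i : D.I) :
    colimit.ι D.functor i ≫ (colimDiagram k).map u =
      u.fiber.app i ≫ colimit.ι E.functor (u.base.obj i) := by
  refine (Category.assoc _ _ _).symm.trans ((eq_whisker (ι_colimMap _ i) _).trans ?_)
  exact (Category.assoc _ _ _).trans (whisker_eq _ (colimit.ι_pre _ _ i))

/-- The augmentation of the bar construction. -/
noncomputable def barAug (D : Diagram k) :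
    ((barDiagram k).obj D).X 0 ⟶ (colimDiagram k).obj D :=
  Sigma.desc fun s => colimit.ι D.functor (s.obj 0)

theorem barρ_barAug (D : Diagram k) (s : ComposableArrows D.I 0) :
    barρ D.functor s ≫ barAug D = colimit.ι D.functor (s.obj 0) :=
  Sigma.ι_desc _ _

theorem barAug_naturality {D E : Diagram k} (u : D ⟶ E) :
    barDiagramMap u 0 ≫ barAug E = barAug D ≫ (colimDiagram k).map u := bar_hom_ext fun s => by
  refine (Category.assoc _ _ _).symm.trans ((eq_whisker (barρ_barDiagramMap u s) _).trans ?_)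
  refine (Category.assoc _ _ _).trans ((whisker_eq _ (barρ_barAug E _)).trans ?_)
  refine Eq.symm ((Category.assoc _ _ _).symm.trans ((eq_whisker (barρ_barAug D s) _).trans ?_))
  exact ι_colimDiagram_map u (s.obj 0)

theorem eq_zero_iff_of_alternatingSum {M : Type*} [AddCommGroup M] {x a : M} (c : Fin 1 → M)
    (h : x = a + ∑ j, (-1 : ℤ) ^ (j.1 + 1) • c j) : x = 0 ↔ a = c 0 := by
  rw [h]
  simp [← sub_eq_add_neg, sub_eq_zero]

/-- A string of length one is an arrow, and its two faces are its end points; so the condition says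
that the components of `h` form a cocone. This makes the colimit the cokernel of the first
differential. -/
theorem bar_d_comp_eq_zero_iff (D : Diagram k) {Z : ProMod k} (h : barObj D.functor 0 ⟶ Z) :
    ((barDiagram k).obj D).d 1 0 ≫ h = 0 ↔ ∀ s : ComposableArrows D.I 1,
      D.functor.map (s.map (homOfLE (Fin.zero_le 1))) ≫ barρ D.functor (face s 0) ≫ h =
        barρ D.functor (face s 1) ≫ h := by
  have e := fun s : ComposableArrows D.I 1 => eq_zero_iff_of_alternatingSum
    (fun j => (barρ D.functor (face s j.succ) ≫ h : D.functor.obj (s.obj 0) ⟶ Z))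
      (barρ_d_comp D.functor 0 h s)
  constructor
  · exact fun w s => (e s).1 ((whisker_eq _ w).trans comp_zero)
  · exact fun w => bar_hom_ext fun s => ((e s).2 (w s)).trans comp_zero.symm

theorem d_barAug (D : Diagram k) : ((barDiagram k).obj D).d 1 0 ≫ barAug D = 0 :=
  (bar_d_comp_eq_zero_iff D (barAug D)).2 fun s =>
    (whisker_eq _ (barρ_barAug D (face s 0))).trans
      ((colimit.w D.functor (s.map (homOfLE (Fin.zero_le 1)))).trans
        (barρ_barAug D (face s 1)).symm)

theorem exists_barAug_desc (D : Diagram k) {Z : ProMod k} (h : barObj D.functor 0 ⟶ Z)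
    (w : ((barDiagram k).obj D).d 1 0 ≫ h = 0) : ∃ h' : (colimDiagram k).obj D ⟶ Z,
      barAug D ≫ h' = h := by
  let t : Cocone D.functor :=
    { pt := Z
      ι :=
        { app := fun i => barρ D.functor (ComposableArrows.mk₀ i) ≫ h
          naturality := fun i j f => by
            refine Eq.trans ?_ (Category.comp_id _).symm
            have e := (bar_d_comp_eq_zero_iff D h).1 w (ComposableArrows.mk₁ f)
            have e₀ : (barρ D.functor (face (ComposableArrows.mk₁ f) 0) ≫ h :
                D.functor.obj j ⟶ Z) = barρ D.functor (ComposableArrows.mk₀ j) ≫ h :=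
              barρ_comp_congr D.functor h (s := face (ComposableArrows.mk₁ f) 0)
                (s' := ComposableArrows.mk₀ j) (ComposableArrows.ext₀ rfl) HEq.rfl HEq.rfl
            have e₁ : (barρ D.functor (face (ComposableArrows.mk₁ f) 1) ≫ h :
                D.functor.obj i ⟶ Z) = barρ D.functor (ComposableArrows.mk₀ i) ≫ h :=
              barρ_comp_congr D.functor h (s := face (ComposableArrows.mk₁ f) 1)
                (s' := ComposableArrows.mk₀ i) (ComposableArrows.ext₀ rfl) HEq.rfl HEq.rfl
            exact (whisker_eq _ e₀.symm).trans (e.trans e₁) } }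
  refine ⟨colimit.desc D.functor t, bar_hom_ext fun s => ?_⟩
  refine (Category.assoc _ _ _).symm.trans ((eq_whisker (barρ_barAug D s) _).trans ?_)
  refine (colimit.ι_desc _ _).trans ?_
  exact barρ_comp_congr D.functor h (s := ComposableArrows.mk₀ (s.obj 0)) (s' := s)
    (ComposableArrows.ext₀ rfl) HEq.rfl HEq.rfl

instance (D : Diagram k) : Epi (barAug D) where
  left_cancellation {Z} f g h := colimit.hom_ext fun i => by
    have e : ∀ f : (colimDiagram k).obj D ⟶ Z, barρ D.functor (ComposableArrows.mk₀ i) ≫ barAug D ≫ f =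
        colimit.ι D.functor i ≫ f := fun f =>
      (Category.assoc _ _ _).symm.trans
        (eq_whisker (barρ_barAug D (ComposableArrows.mk₀ i)) _)
    exact (e f).symm.trans ((whisker_eq _ h).trans (e g))

theorem barAug_exact (D : Diagram k) : (ShortComplex.mk _ _ (d_barAug D)).Exact := by
  rw [ProMod.exact_iff]
  exact fun T _ h w => exists_barAug_desc D h w

/-- The map `H₀(C(I, F)) ⟶ colim F`. -/
noncomputable def barZero (D : Diagram k) :
    ((barDiagram k).obj D).homology 0 ⟶ (colimDiagram k).obj D :=
  ((barDiagram k).obj D).homologyι 0 ≫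
    ((barDiagram k).obj D).descOpcycles (barAug D) 1 (by simp) (d_barAug D)

end
section
-- Both objects are cokernels of the incoming differential.
theorem HomologicalComplex.isIso_descOpcycles {C : Type*} [Category* C] [Abelian C] {ι : Type*}
    {c : ComplexShape ι} (K : HomologicalComplex C c) {i j : ι} {A : C} (f : K.X i ⟶ A)
    (hj : c.prev i = j) (w : K.d j i ≫ f = 0) (h : (ShortComplex.mk _ _ w).Exact) [Epi f] :
    IsIso (K.descOpcycles f j hj w) := by
  have : Epi (ShortComplex.mk _ _ w).g := inferInstanceAs (Epi f)
  refine ⟨h.desc (K.pOpcycles i) (K.d_pOpcycles j i), ?_, ?_⟩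
  · rw [← cancel_epi (K.pOpcycles i), ← Category.assoc, K.p_descOpcycles, Category.comp_id]
    exact h.g_desc _ _
  · rw [← cancel_epi f]
    refine (Category.assoc _ _ _).symm.trans ((eq_whisker (h.g_desc (K.pOpcycles i) (K.d_pOpcycles j i)) _).trans ?_)
    rw [K.p_descOpcycles, Category.comp_id]

variable {k : Type u} [CommRing k]

instance (D : Diagram k) : IsIso (barZero D) := by
  have := HomologicalComplex.isIso_descOpcycles ((barDiagram k).obj D) (barAug D) (by simp)
    (d_barAug D) (barAug_exact D)
  have : IsIso (((barDiagram k).obj D).homologyι 0) :=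
    ((barDiagram k).obj D).isIso_homologyι 0 0 (by simp) (by simp)
  exact IsIso.comp_isIso

theorem barZero_naturality {D E : Diagram k} (u : D ⟶ E) :
    HomologicalComplex.homologyMap ((barDiagram k).map u) 0 ≫ barZero E =
      barZero D ≫ (colimDiagram k).map u := by
  unfold barZero
  rw [HomologicalComplex.homologyι_naturality_assoc, Category.assoc]
  congr 1
  rw [← cancel_epi (HomologicalComplex.pOpcycles _ _), HomologicalComplex.p_opcyclesMap_assoc,
    HomologicalComplex.p_descOpcycles, HomologicalComplex.p_descOpcycles_assoc]
  exact barAug_naturality u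

theorem barDiagramMap_incl {I : Type u} [SmallCategory I] {F G : I ⥤ ProMod k} (α : F ⟶ G)
    (n : ℕ) : barDiagramMap ((Diagram.incl I).map α) n = barNat α n := bar_hom_ext fun s => by
  refine (barρ_barDiagramMap ((Diagram.incl I).map α) s).trans ?_
  exact (eq_whisker (Category.comp_id (α.app (s.obj 0))) _).trans (barρ_barNat α s).symm

/-- The bar construction of a short complex of functors. -/
noncomputable def barShort {I : Type u} [SmallCategory I] (S : ShortComplex (I ⥤ ProMod k)) :
    ShortComplex (ChainComplex (ProMod k) ℕ) where
  X₁ := (barDiagram k).obj ((Diagram.incl I).obj S.X₁)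
  X₂ := (barDiagram k).obj ((Diagram.incl I).obj S.X₂)
  X₃ := (barDiagram k).obj ((Diagram.incl I).obj S.X₃)
  f := (barDiagram k).map ((Diagram.incl I).map S.f)
  g := (barDiagram k).map ((Diagram.incl I).map S.g)
  zero := by
    rw [← Functor.map_comp, ← Functor.map_comp, S.zero]
    refine HomologicalComplex.hom_ext _ _ fun n => (barDiagramMap_incl _ n).trans ?_
    refine bar_hom_ext fun s => (barρ_barNat _ s).trans (zero_comp.trans comp_zero.symm)

/-- In each degree the sequence is a coproduct of values of `S` at objects of I, and coproducts of
pro-modules are exact. This yields the long exact sequences for the bar homology. -/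
theorem barShort_shortExact {I : Type u} [SmallCategory I] {S : ShortComplex (I ⥤ ProMod k)}
    (hS : S.ShortExact) : (barShort S).ShortExact := by
  refine HomologicalComplex.shortExact_of_degreewise_shortExact _ fun n => ?_
  have := hS.mono_f
  have := hS.epi_g
  have hf : ∀ i, Mono (S.f.app i) := fun i => inferInstance
  have hg : ∀ i, Epi (S.g.app i) := fun i => inferInstance
  have hw : barNat S.f n ≫ barNat S.g n = 0 := by
    rw [← barDiagramMap_incl, ← barDiagramMap_incl]
    exact congrArg (fun z => z.f n) (barShort S).zero
  have he : (ShortComplex.mk (barNat S.f n) (barNat S.g n) hw).Exact :=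
    ProMod.exact_sigmaMap (fun s : ComposableArrows I n => S.f.app (s.obj 0))
      (fun s => S.g.app (s.obj 0)) (fun s => congrArg (fun z => z.app (s.obj 0)) S.zero)
      (fun s => hS.exact.map ((evaluation I (ProMod k)).obj (s.obj 0))) hw
  exact
    { exact := ShortComplex.exact_of_eq (barDiagramMap_incl S.f n) (barDiagramMap_incl S.g n) he
      mono_f := (congrArg Mono (barDiagramMap_incl S.f n)).mpr
        (inferInstanceAs (Mono (Limits.Sigma.map _)))
      epi_g := (congrArg Epi (barDiagramMap_incl S.g n)).mpr
        (inferInstanceAs (Epi (Limits.Sigma.map _))) }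

theorem barDiagram_exactAt (D : Diagram k) (hD : IsQuasiProjectiveFunctor D.functor) (n : ℕ) :
    ((barDiagram k).obj D).ExactAt (n + 1) :=
  barComplex_exactAt hD n
end

/-! ### Dimension shifting along the opcycles of a resolution -/

section
open HomologicalComplex
variable {k : Type u} [CommRing k]

theorem Diagram.incl_map_comp_mk {I J : Type u} [SmallCategory I] [SmallCategory J] {φ : I ⥤ J}
    {F F' : I ⥤ ProMod k} {G G' : J ⥤ ProMod k} (α : F ⟶ F') (β : G ⟶ G') (τ : F ⟶ φ ⋙ G)
    (τ' : F' ⟶ φ ⋙ G') (h : α ≫ τ' = τ ≫ Functor.whiskerLeft φ β) :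
    (Diagram.incl I).map α ≫ (Diagram.Hom.mk φ τ' : Diagram.mk I F' ⟶ Diagram.mk J G') =
      (Diagram.Hom.mk φ τ : Diagram.mk I F ⟶ Diagram.mk J G) ≫ (Diagram.incl J).map β := by
  refine congrArg (Diagram.Hom.mk (D := Diagram.mk I F) (E := Diagram.mk J G') φ)
    (NatTrans.ext (funext fun i => ?_))
  have e : α.app i ≫ τ'.app i = τ.app i ≫ β.app (φ.obj i) := congrArg (fun z => z.app i) h
  refine (congrArg₂ (· ≫ ·) (Category.comp_id (α.app i)) (Category.comp_id (τ'.app i))).trans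
    (e.trans (whisker_eq _ ?_))
  exact ((Category.comp_id _).trans (Category.comp_id (β.app (φ.obj i)))).symm

/-- A morphism of short complexes over a functor induces one of bar constructions. -/
noncomputable def barShortMap {I J : Type u} [SmallCategory I] [SmallCategory J] (φ : I ⥤ J)
    {S : ShortComplex (I ⥤ ProMod k)} {T : ShortComplex (J ⥤ ProMod k)}
    (τ₁ : S.X₁ ⟶ φ ⋙ T.X₁) (τ₂ : S.X₂ ⟶ φ ⋙ T.X₂) (τ₃ : S.X₃ ⟶ φ ⋙ T.X₃)
    (h₁ : S.f ≫ τ₂ = τ₁ ≫ Functor.whiskerLeft φ T.f)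
    (h₂ : S.g ≫ τ₃ = τ₂ ≫ Functor.whiskerLeft φ T.g) : barShort S ⟶ barShort T where
  τ₁ := (barDiagram k).map (Diagram.Hom.mk φ τ₁ : Diagram.mk I S.X₁ ⟶ Diagram.mk J T.X₁)
  τ₂ := (barDiagram k).map (Diagram.Hom.mk φ τ₂ : Diagram.mk I S.X₂ ⟶ Diagram.mk J T.X₂)
  τ₃ := (barDiagram k).map (Diagram.Hom.mk φ τ₃ : Diagram.mk I S.X₃ ⟶ Diagram.mk J T.X₃)
  comm₁₂ := ((barDiagram k).map_comp _ _).symm.trans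
    ((congrArg (barDiagram k).map (Diagram.incl_map_comp_mk S.f T.f τ₁ τ₂ h₁).symm).trans
      ((barDiagram k).map_comp _ _))
  comm₂₃ := ((barDiagram k).map_comp _ _).symm.trans
    ((congrArg (barDiagram k).map (Diagram.incl_map_comp_mk S.g T.g τ₂ τ₃ h₂).symm).trans
      ((barDiagram k).map_comp _ _))

end

namespace HomologicalComplex
variable {C : Type*} [Category* C] [Abelian C] (K : ChainComplex C ℕ)

theorem exact_d_pOpcycles (n : ℕ) :
    (ShortComplex.mk _ _ (K.d_pOpcycles (n + 1) n)).Exact :=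
  ShortComplex.exact_of_g_is_cokernel _ (K.opcyclesIsCokernel (n + 1) n (by simp))

theorem exact_homologyι (n : ℕ) :
    (ShortComplex.mk _ _ (K.homologyι_comp_fromOpcycles (n + 1) n)).Exact :=
  ShortComplex.exact_of_f_is_kernel _ (K.homologyIsKernel (n + 1) n (by simp))

/-- The short complex `Oₙ₊₁ ⟶ Kₙ ⟶ Oₙ`, where `Oₙ` are the opcycles. -/
noncomputable def opcyclesShort (n : ℕ) : ShortComplex C :=
  ShortComplex.mk (K.fromOpcycles (n + 1) n) (K.pOpcycles n) (by
    rw [← cancel_epi (K.pOpcycles (n + 1)), K.p_fromOpcycles_assoc, K.d_pOpcycles, comp_zero])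

/-- The kernel of the map from the opcycles to K_n is the homology in degree n + 1, which vanishes
by hypothesis. -/
theorem opcyclesShort_shortExact (n : ℕ) (h : K.ExactAt (n + 1)) :
    (K.opcyclesShort n).ShortExact where
  mono_f := by
    refine (ShortComplex.exact_iff_mono _ ?_).1 (K.exact_homologyι n)
    exact (h.isZero_homology).eq_of_src _ _
  epi_g := inferInstanceAs (Epi (K.pOpcycles n))
  exact := by
    have e := K.exact_d_pOpcycles n
    let ψ : ShortComplex.mk _ _ (K.d_pOpcycles (n + 1) n) ⟶ K.opcyclesShort n :=
      { τ₁ := K.pOpcycles (n + 1)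
        τ₂ := 𝟙 _
        τ₃ := 𝟙 _
        comm₁₂ := (K.p_fromOpcycles (n + 1) n).trans (Category.comp_id _).symm
        comm₂₃ := (Category.id_comp _).trans (Category.comp_id _).symm }
    have : Epi ψ.τ₁ := inferInstanceAs (Epi (K.pOpcycles (n + 1)))
    have : IsIso ψ.τ₂ := inferInstanceAs (IsIso (𝟙 _))
    have : Mono ψ.τ₃ := inferInstanceAs (Mono (𝟙 _))
    exact (ShortComplex.exact_iff_of_epi_of_isIso_of_mono ψ).1 e

end HomologicalComplex

namespace CategoryTheory.ShortComplex
variable {C : Type*} [Category* C] [Abelian C] {A A' B B' X X' : C} {f : A ⟶ B} {g : B ⟶ X}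
  {w : f ≫ g = 0}

theorem Exact.comp_iso (hw : (ShortComplex.mk f g w).Exact) (e : B ⟶ B') (e' : X ⟶ X')
    (he : IsIso e) (he' : IsIso e') (g' : B' ⟶ X') (h : g ≫ e' = e ≫ g') :
    ∃ w' : (f ≫ e) ≫ g' = 0, (ShortComplex.mk (f ≫ e) g' w').Exact := by
  have w' : (f ≫ e) ≫ g' = 0 := by
    rw [Category.assoc, ← h, ← Category.assoc, w, zero_comp]
  refine ⟨w', (ShortComplex.exact_iff_of_iso ?_).1 hw⟩
  exact ShortComplex.isoMk (Iso.refl _) (asIso e) (asIso e') (by simp) (by simp [h])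

theorem Exact.iso_comp (hw : (ShortComplex.mk f g w).Exact) (e : A' ⟶ A) (he : IsIso e) :
    ∃ w' : (e ≫ f) ≫ g = 0, (ShortComplex.mk (e ≫ f) g w').Exact := by
  have w' : (e ≫ f) ≫ g = 0 := by rw [Category.assoc, w, comp_zero]
  refine ⟨w', (ShortComplex.exact_iff_of_iso ?_).2 hw⟩
  exact ShortComplex.isoMk (asIso e) (Iso.refl _) (Iso.refl _) (by simp) (by simp)

end CategoryTheory.ShortComplex

section
open HomologicalComplex
variable {k : Type u} [CommRing k] {I J : Type u} [SmallCategory I] [SmallCategory J]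

/-- The complex `colim K`. -/
noncomputable abbrev colimCx (K : ChainComplex (I ⥤ ProMod k) ℕ) : ChainComplex (ProMod k) ℕ :=
  ((colim : (I ⥤ ProMod k) ⥤ ProMod k).mapHomologicalComplex _).obj K

theorem colim_d_pOpcycles (K : ChainComplex (I ⥤ ProMod k) ℕ) (n : ℕ) :
    (colimCx K).d (n + 1) n ≫ colim.map (K.pOpcycles n) = 0 := by
  refine (colim.map_comp _ _).symm.trans ((congrArg colim.map (K.d_pOpcycles (n + 1) n)).trans ?_)
  exact Functor.map_zero _ _ _

/-- The opcycles of `colim K` are the colimit of the opcycles of `K`. -/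
noncomputable def opcyclesColim (K : ChainComplex (I ⥤ ProMod k) ℕ) (n : ℕ) :
    (colimCx K).opcycles n ⟶ colim.obj (K.opcycles n) :=
  (colimCx K).descOpcycles (colim.map (K.pOpcycles n)) (n + 1) (by simp) (colim_d_pOpcycles K n)

theorem p_opcyclesColim (K : ChainComplex (I ⥤ ProMod k) ℕ) (n : ℕ) :
    (colimCx K).pOpcycles n ≫ opcyclesColim K n = colim.map (K.pOpcycles n) :=
  (colimCx K).p_descOpcycles _ _ _ _

/-- Opcycles are cokernels, and colim preserves cokernels as a left adjoint. -/
instance (K : ChainComplex (I ⥤ ProMod k) ℕ) (n : ℕ) : IsIso (opcyclesColim K n) := by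
  have : (colim : (I ⥤ ProMod k) ⥤ ProMod k).PreservesEpimorphisms :=
    Functor.preservesEpimorphisms_of_adjunction colimConstAdj
  let p : (colimCx K).X n ⟶ colim.obj (K.opcycles n) := colim.map (K.pOpcycles n)
  have : Epi p := colim.map_epi (K.pOpcycles n)
  have : Epi (ShortComplex.mk _ _ (K.d_pOpcycles (n + 1) n)).g :=
    inferInstanceAs (Epi (K.pOpcycles n))
  exact (colimCx K).isIso_descOpcycles p _ _
    ((K.exact_d_pOpcycles n).map_of_epi_of_preservesCokernel colim this inferInstance)

theorem opcyclesColim_fromOpcycles (K : ChainComplex (I ⥤ ProMod k) ℕ) (n : ℕ) :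
    opcyclesColim K (n + 1) ≫ colim.map (K.fromOpcycles (n + 1) n) =
      (colimCx K).fromOpcycles (n + 1) n := by
  refine (cancel_epi ((colimCx K).pOpcycles (n + 1))).1 ?_
  refine Eq.trans ?_ ((colimCx K).p_fromOpcycles (n + 1) n).symm
  refine (Category.assoc _ _ _).symm.trans ((eq_whisker (p_opcyclesColim K (n + 1)) _).trans ?_)
  exact (colim.map_comp _ _).symm.trans (congrArg colim.map (K.p_fromOpcycles (n + 1) n))

/-- The iterated connecting homomorphism `Hₘ(C(I, Oₙ)) ⟶ Oₙ₊ₘ(colim K)`. -/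
noncomputable def connect (K : ChainComplex (I ⥤ ProMod k) ℕ) (hK : ∀ n, K.ExactAt (n + 1)) :
    ∀ m n j : ℕ, n + m = j →
      (((barDiagram k).obj ((Diagram.incl I).obj (K.opcycles n))).homology m ⟶
        (colimCx K).opcycles j)
  | 0, n, _, rfl => barZero ((Diagram.incl I).obj (K.opcycles n)) ≫
    (inv (opcyclesColim K n) : colim.obj (K.opcycles n) ⟶ (colimCx K).opcycles n)
  -- The target degree `j` is a separate variable, so that n + (m + 1) and (n + 1) + m need no
  -- transport.
  | m + 1, n, j, h =>
    (barShort_shortExact (K.opcyclesShort_shortExact n (hK n))).δ (m + 1) m (by simp) ≫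
      connect K hK m (n + 1) j (by omega)

theorem isIso_connect_zero (K : ChainComplex (I ⥤ ProMod k) ℕ) (hK : ∀ n, K.ExactAt (n + 1))
    (n j : ℕ) (h : n + 0 = j) : IsIso (connect K hK 0 n j h) := by
  subst h
  have h₁ : IsIso (inv (opcyclesColim K n)) := inferInstance
  exact IsIso.comp_isIso' inferInstance h₁

theorem connect_zero_fromOpcycles (K : ChainComplex (I ⥤ ProMod k) ℕ)
    (hK : ∀ n, K.ExactAt (n + 1)) (n : ℕ) :
    homologyMap (barShort (K.opcyclesShort n)).f 0 ≫
      barZero ((Diagram.incl I).obj (K.X n)) =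
    connect K hK 0 (n + 1) (n + 1) rfl ≫ (colimCx K).fromOpcycles (n + 1) n := by
  refine (barZero_naturality ((Diagram.incl I).map (K.fromOpcycles (n + 1) n))).trans ?_
  refine Eq.trans ?_ (Category.assoc _ _ _).symm
  refine whisker_eq _ ?_
  refine Eq.trans ?_ (whisker_eq _ (opcyclesColim_fromOpcycles K n))
  refine Eq.trans ?_ (IsIso.inv_hom_id_assoc (opcyclesColim K (n + 1)) _).symm
  refine colimit.hom_ext fun i => (ι_colimDiagram_map _ i).trans ?_
  refine Eq.trans (eq_whisker (Category.comp_id _) _) ?_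
  exact (ι_colimMap (K.fromOpcycles (n + 1) n) i).symm

/-- Acyclicity of C(I, K_n) makes the connecting maps isomorphisms from degree two on, and the last
one, from degree one to degree zero, the kernel of H_0(C(I, O_{n+1})) → H_0(C(I, K_n)). After
identifying H_0 with the colimit, this is the kernel of the map from the opcycles of colim K to
colim K_j. -/
theorem connect_exact (K : ChainComplex (I ⥤ ProMod k) ℕ) (hK : ∀ n, K.ExactAt (n + 1))
    (hP : ∀ n, IsQuasiProjectiveFunctor (K.X n)) : ∀ (m n j : ℕ) (h : n + (m + 1) = j + 1),
    Mono (connect K hK (m + 1) n (j + 1) h) ∧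
      ∃ w : connect K hK (m + 1) n (j + 1) h ≫ (colimCx K).fromOpcycles (j + 1) j = 0,
        (ShortComplex.mk _ _ w).Exact
  | 0, n, j, h => by
    obtain rfl : n = j := by omega
    have hS := barShort_shortExact (K.opcyclesShort_shortExact n (hK n))
    have hz : IsZero ((barShort (K.opcyclesShort n)).X₂.homology 1) :=
      (barDiagram_exactAt ((Diagram.incl I).obj (K.X n)) (hP n) 0).isZero_homology
    have h₁ := hS.mono_δ 1 0 (by simp) hz
    have h₂ := isIso_connect_zero K hK (n + 1) (n + 1) rfl
    have h₃ : Mono (connect K hK 0 (n + 1) (n + 1) rfl) := inferInstance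
    have h₄ : IsIso (barZero ((Diagram.incl I).obj (K.X n))) := inferInstance
    refine ⟨mono_comp' h₁ h₃, ?_⟩
    exact (hS.homology_exact₁ 1 0 (by simp)).comp_iso
      (connect K hK 0 (n + 1) (n + 1) rfl) (barZero ((Diagram.incl I).obj (K.X n))) h₂ h₄ _
      (connect_zero_fromOpcycles K hK n)
  | m + 1, n, j, h => by
    obtain ⟨hm, w, hw⟩ := connect_exact K hK hP m (n + 1) j (by omega)
    have hS := barShort_shortExact (K.opcyclesShort_shortExact n (hK n))
    have hz : ∀ i, IsZero ((barShort (K.opcyclesShort n)).X₂.homology (i + 1)) := fun i =>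
      (barDiagram_exactAt ((Diagram.incl I).obj (K.X n)) (hP n) i).isZero_homology
    have h₁ := hS.isIso_δ (m + 2) (m + 1) (by simp) (hz _) (hz _)
    have h₂ : Mono (hS.δ (m + 2) (m + 1) (by simp)) := inferInstance
    exact ⟨mono_comp' h₂ hm, hw.iso_comp _ h₁⟩

/-- In positive degree both sides are kernels of the same map out of the opcycles; in degree zero
homology and opcycles agree. The recorded equation pins down the isomorphism, since `homologyι` is
mono. -/
theorem exists_connect_iso (K : ChainComplex (I ⥤ ProMod k) ℕ) (hK : ∀ n, K.ExactAt (n + 1))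
    (hP : ∀ n, IsQuasiProjectiveFunctor (K.X n)) (n : ℕ) :
    ∃ e : ((barDiagram k).obj ((Diagram.incl I).obj (K.opcycles 0))).homology n ≅
      (colimCx K).homology n,
        e.hom ≫ (colimCx K).homologyι n = connect K hK n 0 n (by simp) := by
  obtain - | n := n
  · have := isIso_connect_zero K hK 0 0 rfl
    have : IsIso ((colimCx K).homologyι 0) := (colimCx K).isIso_homologyι 0 0 (by simp) (by simp)
    exact ⟨asIso (connect K hK 0 0 0 rfl) ≪≫ (asIso ((colimCx K).homologyι 0)).symm, by simp⟩
  · obtain ⟨hm, w, hw⟩ := connect_exact K hK hP n 0 n (by simp)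
    have : Mono (ShortComplex.mk _ _ w).f := hm
    refine ⟨IsLimit.conePointUniqueUpToIso hw.fIsKernel
      ((colimCx K).homologyIsKernel (n + 1) n (by simp)), ?_⟩
    exact IsLimit.conePointUniqueUpToIso_hom_comp hw.fIsKernel
      ((colimCx K).homologyIsKernel (n + 1) n (by simp)) WalkingParallelPair.zero

end

section
open HomologicalComplex
variable {k : Type u} [CommRing k] {I J : Type u} [SmallCategory I] [SmallCategory J]
  {φ : I ⥤ J} {K : ChainComplex (I ⥤ ProMod k) ℕ} {L : ChainComplex (J ⥤ ProMod k) ℕ}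

/-- The map on opcycles induced by a chain map over a functor. -/
noncomputable def opcyclesOver
    (f : K ⟶ (((Functor.whiskeringLeft _ _ (ProMod k)).obj φ).mapHomologicalComplex _).obj L)
    (n : ℕ) : K.opcycles n ⟶ φ ⋙ L.opcycles n :=
  K.descOpcycles (f.f n ≫ Functor.whiskerLeft φ (L.pOpcycles n)) (n + 1) (by simp) (by
    have h₁ : Functor.whiskerLeft φ (L.d (n + 1) n) ≫ Functor.whiskerLeft φ (L.pOpcycles n) = 0 :=
      NatTrans.ext (funext fun i => congrArg (fun z => z.app (φ.obj i)) (L.d_pOpcycles (n + 1) n))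
    have h₂ : f.f (n + 1) ≫ Functor.whiskerLeft φ (L.d (n + 1) n) = K.d (n + 1) n ≫ f.f n :=
      f.comm (n + 1) n
    refine (Category.assoc _ _ _).symm.trans ((eq_whisker h₂.symm _).trans ?_)
    exact (Category.assoc _ _ _).trans ((whisker_eq _ h₁).trans comp_zero))

variable (f : K ⟶ (((Functor.whiskeringLeft _ _ (ProMod k)).obj φ).mapHomologicalComplex _).obj L)

theorem p_opcyclesOver (n : ℕ) : K.pOpcycles n ≫ opcyclesOver f n =
    f.f n ≫ Functor.whiskerLeft φ (L.pOpcycles n) :=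
  K.p_descOpcycles _ _ _ _

theorem opcyclesOver_fromOpcycles (n : ℕ) :
    K.fromOpcycles (n + 1) n ≫ (f.f n : K.X n ⟶ φ ⋙ L.X n) =
      opcyclesOver f (n + 1) ≫ Functor.whiskerLeft φ (L.fromOpcycles (n + 1) n) := by
  refine (cancel_epi (K.pOpcycles (n + 1))).1 ?_
  have h₁ : Functor.whiskerLeft φ (L.pOpcycles (n + 1)) ≫
      Functor.whiskerLeft φ (L.fromOpcycles (n + 1) n) = Functor.whiskerLeft φ (L.d (n + 1) n) :=
    NatTrans.ext (funext fun i => congrArg (fun z => z.app (φ.obj i)) (L.p_fromOpcycles (n + 1) n))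
  have h₂ : f.f (n + 1) ≫ Functor.whiskerLeft φ (L.d (n + 1) n) = K.d (n + 1) n ≫ f.f n :=
    f.comm (n + 1) n
  refine (Category.assoc _ _ _).symm.trans
    ((eq_whisker (K.p_fromOpcycles (n + 1) n) _).trans ?_)
  refine h₂.symm.trans ((whisker_eq _ h₁.symm).trans ?_)
  refine (Category.assoc _ _ _).symm.trans ((eq_whisker (p_opcyclesOver f (n + 1)).symm _).trans ?_)
  exact Category.assoc _ _ _

/-- The chain map of colimits induced by a chain map over a functor. -/
noncomputable def colimOver : colimCx K ⟶ colimCx L :=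
  (colim.mapHomologicalComplex _).map f ≫
    (NatTrans.mapHomologicalComplex (Diagram.preTrans φ) _).app L

theorem opcyclesColim_naturality (n : ℕ) :
    opcyclesMap (colimOver f) n ≫ opcyclesColim L n = opcyclesColim K n ≫
      (colimDiagram k).map (Diagram.Hom.mk φ (opcyclesOver f n) :
        Diagram.mk I (K.opcycles n) ⟶ Diagram.mk J (L.opcycles n)) := by
  refine (cancel_epi ((colimCx K).pOpcycles n)).1 ?_
  refine (Category.assoc _ _ _).symm.trans ((eq_whisker (p_opcyclesMap (colimOver f) n) _).trans ?_)
  refine (Category.assoc _ _ _).trans ((whisker_eq _ (p_opcyclesColim L n)).trans ?_)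
  refine Eq.trans ?_ (Category.assoc _ _ _)
  refine Eq.trans ?_ (eq_whisker (p_opcyclesColim K n).symm _)
  refine colimit.hom_ext fun i => ?_
  have h₁ : colimit.ι (K.X n) i ≫ (colimOver f).f n =
      (f.f n).app i ≫ colimit.ι (L.X n) (φ.obj i) := ι_colimDiagram_map
    (Diagram.Hom.mk φ (f.f n) : Diagram.mk I (K.X n) ⟶ Diagram.mk J (L.X n)) i
  have h₂ : colimit.ι (L.X n) (φ.obj i) ≫ colim.map (L.pOpcycles n) =
      (L.pOpcycles n).app (φ.obj i) ≫ colimit.ι (L.opcycles n) (φ.obj i) := ι_colimMap _ _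
  have h₃ : colimit.ι (K.X n) i ≫ colim.map (K.pOpcycles n) =
      (K.pOpcycles n).app i ≫ colimit.ι (K.opcycles n) i := ι_colimMap _ _
  have h₄ := ι_colimDiagram_map (Diagram.Hom.mk φ (opcyclesOver f n) :
        Diagram.mk I (K.opcycles n) ⟶ Diagram.mk J (L.opcycles n)) i
  have h₅ : (K.pOpcycles n).app i ≫ (opcyclesOver f n).app i =
      (f.f n).app i ≫ (L.pOpcycles n).app (φ.obj i) :=
    congrArg (fun z => z.app i) (p_opcyclesOver f n)
  refine (Category.assoc _ _ _).symm.trans ((eq_whisker h₁ _).trans ?_)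
  refine (Category.assoc _ _ _).trans ((whisker_eq _ h₂).trans ?_)
  refine (Category.assoc _ _ _).symm.trans ((eq_whisker h₅.symm _).trans ?_)
  refine Eq.symm ((Category.assoc _ _ _).symm.trans ((eq_whisker h₃ _).trans ?_))
  refine (Category.assoc _ _ _).trans ((whisker_eq _ h₄).trans ?_)
  exact (Category.assoc _ _ _).symm

/-- Connecting maps are natural in short exact sequences, and the identification of H_0 with the
colimit is natural. With opcycles as target, the induction never has to mention kernels. -/
theorem connect_naturality (hK : ∀ n, K.ExactAt (n + 1)) (hL : ∀ n, L.ExactAt (n + 1)) :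
    ∀ (m n j : ℕ) (h : n + m = j),
      homologyMap ((barDiagram k).map (Diagram.Hom.mk φ (opcyclesOver f n) :
        Diagram.mk I (K.opcycles n) ⟶ Diagram.mk J (L.opcycles n))) m ≫ connect L hL m n j h =
      connect K hK m n j h ≫ opcyclesMap (colimOver f) j
  | 0, n, _, rfl => by
    have h₁ := barZero_naturality (Diagram.Hom.mk φ (opcyclesOver f n) :
        Diagram.mk I (K.opcycles n) ⟶ Diagram.mk J (L.opcycles n))
    have h₂ := opcyclesColim_naturality f n
    refine (Category.assoc _ _ _).symm.trans ((eq_whisker h₁ _).trans ?_)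
    refine (Category.assoc _ _ _).trans (Eq.symm ((Category.assoc _ _ _).trans ?_))
    refine whisker_eq _ ?_
    refine (IsIso.inv_comp_eq (opcyclesColim K n)).2 ?_
    refine Eq.trans ?_ (Category.assoc _ _ _)
    exact (IsIso.eq_comp_inv (opcyclesColim L n)).2 h₂
  | m + 1, n, j, h => by
    have hS := barShort_shortExact (K.opcyclesShort_shortExact n (hK n))
    have hT := barShort_shortExact (L.opcyclesShort_shortExact n (hL n))
    have h₁ := HomologySequence.δ_naturality (barShortMap φ (S := K.opcyclesShort n)
      (T := L.opcyclesShort n) (opcyclesOver f (n + 1)) (f.f n) (opcyclesOver f n)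
      (opcyclesOver_fromOpcycles f n) (p_opcyclesOver f n)) hS hT (m + 1) m (by simp)
    have h₂ := connect_naturality hK hL m (n + 1) j (by omega)
    refine (Category.assoc _ _ _).symm.trans ((eq_whisker h₁.symm _).trans ?_)
    refine (Category.assoc _ _ _).trans ((whisker_eq _ h₂).trans ?_)
    exact (Category.assoc _ _ _).symm

end

/-! ### Bar homology is the higher colimit -/

namespace ResolutionBy
variable {C : Type*} [Category* C] [Abelian C] {Q : ObjectProperty C} {A : C}

/-- The isomorphism from the zeroth opcycles of a resolution. -/
noncomputable def aug (P : ResolutionBy Q A) : P.complex.opcycles 0 ⟶ A :=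
  P.complex.descOpcycles P.π 1 (by simp) P.w

theorem p_aug (P : ResolutionBy Q A) : P.complex.pOpcycles 0 ≫ P.aug = P.π :=
  P.complex.p_descOpcycles _ _ _ _

instance (P : ResolutionBy Q A) : IsIso P.aug := by
  have := P.epi
  exact P.complex.isIso_descOpcycles P.π (by simp) P.w P.exact_zero

end ResolutionBy

section
open HomologicalComplex
variable {k : Type u} [CommRing k]

theorem aug_naturality {D E : Diagram k} {u : D ⟶ E} {P : D.Resolution} {Q : E.Resolution}
    (l : Diagram.Lift u P Q) :
    (Diagram.Hom.mk u.base (opcyclesOver l.hom 0) :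
        Diagram.mk D.I (P.complex.opcycles 0) ⟶ Diagram.mk E.I (Q.complex.opcycles 0)) ≫
      (Diagram.incl E.I).map Q.aug = (Diagram.incl D.I).map P.aug ≫ u := by
  refine (Diagram.incl_map_comp_mk P.aug Q.aug (opcyclesOver l.hom 0) u.fiber ?_).symm
  refine (cancel_epi (P.complex.pOpcycles 0)).1 ?_
  refine (Category.assoc _ _ _).symm.trans ((eq_whisker P.p_aug _).trans ?_)
  refine l.w.symm.trans (Eq.symm ?_)
  refine (Category.assoc _ _ _).symm.trans ((eq_whisker (p_opcyclesOver l.hom 0) _).trans ?_)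
  refine (Category.assoc _ _ _).trans (whisker_eq _ ?_)
  exact NatTrans.ext (funext fun i => congrArg (fun z => z.app (u.base.obj i)) Q.p_aug)

/-- The homology of the bar construction is the higher colimit. -/
theorem isHigherColimit_bar (n : ℕ) :
    IsHigherColimit n (barDiagram k ⋙ homologyFunctor (ProMod k) _ n) := by
  choose e he using fun (D : Diagram k) (P : D.Resolution) =>
    exists_connect_iso P.complex P.exact_succ P.mem n
  let a : ∀ (D : Diagram k) (P : D.Resolution),
      (barDiagram k ⋙ homologyFunctor (ProMod k) _ n).obj
        ((Diagram.incl D.I).obj (P.complex.opcycles 0)) ≅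
      (barDiagram k ⋙ homologyFunctor (ProMod k) _ n).obj D := fun D P =>
    (Diagram.incl D.I ⋙ barDiagram k ⋙ homologyFunctor (ProMod k) _ n).mapIso (asIso P.aug)
  refine ⟨fun D P => (a D P).symm ≪≫ e D P, fun D E u P Q l => ?_⟩
  have h₁ : (a D P).hom ≫ (barDiagram k ⋙ homologyFunctor (ProMod k) _ n).map u =
      homologyMap ((barDiagram k).map (Diagram.Hom.mk u.base (opcyclesOver l.hom 0) :
        Diagram.mk D.I (P.complex.opcycles 0) ⟶ Diagram.mk E.I (Q.complex.opcycles 0))) n ≫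
        (a E Q).hom :=
    ((barDiagram k ⋙ homologyFunctor (ProMod k) _ n).map_comp _ _).symm.trans
      ((congrArg _ (aug_naturality l).symm).trans
        ((barDiagram k ⋙ homologyFunctor (ProMod k) _ n).map_comp _ _))
  have h₂ := connect_naturality l.hom P.exact_succ Q.exact_succ n 0 n (by simp)
  have h₃ : homologyMap ((barDiagram k).map (Diagram.Hom.mk u.base (opcyclesOver l.hom 0) :
        Diagram.mk D.I (P.complex.opcycles 0) ⟶ Diagram.mk E.I (Q.complex.opcycles 0))) n ≫
        (e E Q).hom = (e D P).hom ≫ homologyMap l.colimMap n := by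
    -- Inside the opcycles both identifications become the iterated connecting maps, whose
    -- naturality is `h₂`.
    refine (cancel_mono (homologyι _ n)).1 ?_
    refine (Category.assoc _ _ _).trans ((whisker_eq _ (he E Q)).trans (h₂.trans ?_))
    refine (eq_whisker (he D P).symm _).trans ((Category.assoc _ _ _).trans ?_)
    refine Eq.trans ?_ (Category.assoc _ _ _).symm
    exact whisker_eq _ (homologyι_naturality l.colimMap n).symm
  refine (cancel_epi (a D P).hom).1 ?_
  refine (Category.assoc _ _ _).symm.trans ((eq_whisker h₁ _).trans ?_)
  refine (Category.assoc _ _ _).trans ((whisker_eq _ ((a E Q).hom_inv_id_assoc _)).trans ?_)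
  refine h₃.trans ?_
  refine ((a D P).hom_inv_id_assoc _).symm.trans (whisker_eq _ ?_)
  exact (Category.assoc _ _ _).symm

theorem isHigherColimit_higherColim (n : ℕ) : IsHigherColimit n (higherColim k n) := by
  have h : ∃ L : Diagram k ⥤ ProMod k, IsHigherColimit n L := ⟨_, isHigherColimit_bar n⟩
  unfold higherColim
  rw [dif_pos h]
  exact h.choose_spec

/-- One resolution per diagram and one lift per morphism suffice: both functors then act as the same
map on homology. The syzygy resolutions provide them. -/
theorem IsHigherColimit.iso (hk : IsQuasiNoetherian k) {n : ℕ} {L L' : Diagram k ⥤ ProMod k}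
    (h : IsHigherColimit n L) (h' : IsHigherColimit n L') : Nonempty (L ≅ L') := by
  obtain ⟨e, he⟩ := h
  obtain ⟨e', he'⟩ := h'
  refine ⟨NatIso.ofComponents (fun D => e D (syzResolution hk D.functor) ≪≫
    (e' D (syzResolution hk D.functor)).symm) fun {D E} u => ?_⟩
  have h₁ := he D E u _ _ (syzLift hk u)
  have h₂ := he' D E u _ _ (syzLift hk u)
  simp only [Iso.trans_hom, Iso.symm_hom, ← Category.assoc, Iso.comp_inv_eq, h₁]
  simp [h₂]

theorem nonempty_bar_iso (hk : IsQuasiNoetherian k) (I : Type u) [SmallCategory I] (n : ℕ) :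
    Nonempty (Diagram.incl I ⋙ higherColim k n ≅
      barComplex k I ⋙ homologyFunctor (ProMod k) _ n) := by
  obtain ⟨e⟩ := (isHigherColimit_higherColim n).iso hk (isHigherColimit_bar n)
  exact ⟨Functor.isoWhiskerLeft (Diagram.incl I) e ≪≫ (Functor.associator _ _ _).symm ≪≫
    Functor.isoWhiskerRight (inclBarDiagramIso k I) _⟩

end

/-! ### Cosheaves on Alexandroff spaces and their stalks -/

section
variable {X Y : Type u} [Preorder X] [Preorder Y]

/-- The least open neighbourhood of a point of an Alexandroff space. -/
def downSet (x : X) : Opens (aSpace X) where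
  carrier := {y | WithLowerSet.ofLowerSet y ≤ x}
  is_open' := (IsLowerSet.isOpen_iff_isLowerSet (α := WithLowerSet X)).2
    fun _ _ h hy => le_trans (show WithLowerSet.ofLowerSet _ ≤ WithLowerSet.ofLowerSet _ from h) hy

theorem mem_downSet (x : X) : WithLowerSet.toLowerSet x ∈ downSet x :=
  le_refl x

theorem downSet_le {U : Opens (aSpace X)} {x : X} (hx : WithLowerSet.toLowerSet x ∈ U) :
    downSet x ≤ U := fun _ hy =>
  (IsLowerSet.isOpen_iff_isLowerSet (α := WithLowerSet X)).1 U.isOpen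
    (show _ ≤ WithLowerSet.toLowerSet x from hy) hx

/-- The functor sending a point to its least open neighbourhood. -/
def down (X : Type u) [Preorder X] : X ⥤ Opens (aSpace X) :=
  Monotone.functor (f := downSet) fun _ _ h => downSet_le h

instance : (down X).Full where
  map_surjective {x _} f := ⟨homOfLE (f.le (mem_downSet x)), Subsingleton.elim _ _⟩

instance : (down X).Faithful where

instance : (down X).IsCoverDense (Opens.grothendieckTopology (aSpace X)) where
  is_cover _ x hx := ⟨downSet (WithLowerSet.ofLowerSet x), homOfLE (downSet_le hx),
    Presieve.in_coverByImage (down X) (Y := WithLowerSet.ofLowerSet x) _, mem_downSet _⟩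

/-- A covering of the least neighbourhood of x has a member containing x, which is then the whole
neighbourhood; so the induced topology on X is trivial. -/
instance : (down X).IsDenseSubsite ⊥ (Opens.grothendieckTopology (aSpace X)) where
  functorPushforward_mem_iff {x S} := by
    rw [GrothendieckTopology.bot_covering]
    constructor
    · intro h
      obtain ⟨V, g, ⟨y, a, b, ha, -⟩, hV⟩ := h (WithLowerSet.toLowerSet x) (mem_downSet x)
      rw [← Sieve.id_mem_iff_eq_top]
      have e : (𝟙 x : x ⟶ x) = homOfLE (b.le hV) ≫ a := Subsingleton.elim _ _
      rw [e]
      exact S.downward_closed ha _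
    · rintro rfl
      exact fun y hy => ⟨downSet x, 𝟙 _, ⟨x, 𝟙 x, 𝟙 _, trivial, Subsingleton.elim _ _⟩, hy⟩

/-- The monotone map underlying a continuous map of Alexandroff spaces. -/
def ptMap (f : aSpace X ⟶ aSpace Y) : X ⥤ Y :=
  Monotone.functor (f := fun x => WithLowerSet.ofLowerSet (f (WithLowerSet.toLowerSet x)))
    fun x y h => (IsLowerSet.monotone_iff_continuous (α := WithLowerSet X)
      (β := WithLowerSet Y)).2 f.hom.continuous
        (show WithLowerSet.toLowerSet x ≤ WithLowerSet.toLowerSet y from h)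

variable {k : Type u} [CommRing k]

/-- The values of a cosheaf at the least open neighbourhoods. -/
noncomputable def stalk (X : Type u) [Preorder X] (k : Type u) [CommRing k] :
    Cosheaf (aSpace X) k ⥤ (X ⥤ ProMod k) :=
  ObjectProperty.ι _ ⋙ (Functor.whiskeringLeft _ _ _).obj (down X)

/-- The map of stalks given by a morphism of cosheaves over a continuous map. -/
noncomputable def stalkMap (f : aSpace X ⟶ aSpace Y) {A : Cosheaf (aSpace X) k}
    {B : Cosheaf (aSpace Y) k} (g : (Cosheaf.pushforward k f).obj A ⟶ B) :
    (stalk X k).obj A ⟶ ptMap f ⋙ (stalk Y k).obj B where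
  app x := A.obj.map (homOfLE (downSet_le (mem_downSet ((ptMap f).obj x))) :
    downSet x ⟶ (Opens.map f).obj (downSet ((ptMap f).obj x))) ≫
      g.hom.app (downSet ((ptMap f).obj x))
  naturality x y h := by
    have h₁ : A.obj.map ((Opens.map f).map ((down Y).map ((ptMap f).map h))) ≫
        g.hom.app (downSet ((ptMap f).obj y)) =
      g.hom.app (downSet ((ptMap f).obj x)) ≫ B.obj.map ((down Y).map ((ptMap f).map h)) :=
      g.hom.naturality ((down Y).map ((ptMap f).map h))
    refine Eq.symm ((Category.assoc _ _ _).trans ((whisker_eq _ h₁.symm).trans ?_))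
    refine (Category.assoc _ _ _).symm.trans (Eq.trans ?_ (Category.assoc _ _ _))
    refine eq_whisker ?_ _
    exact (A.obj.map_comp _ _).symm.trans (A.obj.map_comp ((down X).map h) (homOfLE _))

/-- The map from `F` to the stalks of `𝓕`. -/
noncomputable def toStalk (F : X ⥤ ProMod k) :
    F ⟶ (stalk X k).obj ((functorToCosheaf X k).obj F) where
  app x := inOn F (downSet x) x (mem_downSet x)
  naturality x y f :=
    (map_inOn F (downSet y) f ((down X).map f |>.le (mem_downSet x)) (mem_downSet y)).trans
      (map_inOn_colimPrecosheaf F ((down X).map f) x (mem_downSet x)).symm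

/-- The point x is terminal in its least neighbourhood, so the colimit there is F(x). -/
instance isIso_toStalk (F : X ⥤ ProMod k) : IsIso (toStalk F) := by
  have : ∀ x, IsIso ((toStalk F).app x) := fun x =>
    isIso_ι_of_isTerminal (IsTerminal.ofUniqueHom (Y := (⟨x, mem_downSet x⟩ : pts (downSet x)))
      (fun y => homOfLE y.2) fun _ _ => Subsingleton.elim _ _) (ptsIncl (downSet x) ⋙ F)
  exact NatIso.isIso_of_isIso_app _

theorem inOn_functorToCosheaf_map {F G : X ⥤ ProMod k} (α : F ⟶ G) (U : Opens (aSpace X)) (x : X)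
    (hx : WithLowerSet.toLowerSet x ∈ U) :
    inOn F U x hx ≫ ((functorToCosheaf X k).map α).hom.app U = α.app x ≫ inOn G U x hx :=
  inOn_descOn _ _ _ _ _ _

/-- Passing to the cosheaf and back to stalks does nothing. -/
noncomputable def functorToCosheafStalk (X : Type u) [Preorder X] (k : Type u) [CommRing k] :
    𝟭 _ ≅ functorToCosheaf X k ⋙ stalk X k :=
  NatIso.ofComponents (fun F => @asIso _ _ _ _ (toStalk F) (isIso_toStalk F)) fun {F G} α => by
    refine NatTrans.ext (funext fun x => ?_)
    exact (inOn_functorToCosheaf_map α (downSet x) x (mem_downSet x)).symm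

/-- The canonical map from the cosheaf of the stalks. -/
noncomputable def ofStalk (A : Cosheaf (aSpace X) k) :
    (functorToCosheaf X k).obj ((stalk X k).obj A) ⟶ A :=
  ObjectProperty.homMk
    { app := fun U => descOn ((stalk X k).obj A) U
        (fun x hx => A.obj.map (homOfLE (downSet_le hx) : downSet x ⟶ U))
        (fun x y h hx hy => (A.obj.map_comp _ _).symm)
      naturality := fun U V i => colimOn_hom_ext fun x hx => by
        have e := map_inOn_colimPrecosheaf ((stalk X k).obj A) i x hx
        refine (Category.assoc _ _ _).symm.trans ((eq_whisker e _).trans ?_)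
        refine (inOn_descOn _ _ _ _ _ _).trans ?_
        refine Eq.symm ((Category.assoc _ _ _).symm.trans
          ((eq_whisker (inOn_descOn _ _ _ _ _ _) _).trans ?_))
        exact (A.obj.map_comp _ _).symm }

theorem inOn_ofStalk (A : Cosheaf (aSpace X) k) (U : Opens (aSpace X)) (x : X)
    (hx : WithLowerSet.toLowerSet x ∈ U) :
    inOn ((stalk X k).obj A) U x hx ≫ (ofStalk A).hom.app U =
      A.obj.map (homOfLE (downSet_le hx) : downSet x ⟶ U) :=
  inOn_descOn _ _ _ _ _ _

/-- In the opposite category this is a morphism of sheaves; it is invertible on the least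
neighbourhoods, which are cover-dense, hence everywhere. -/
instance isIso_ofStalk (A : Cosheaf (aSpace X) k) : IsIso (ofStalk A) := by
  let J := Opens.grothendieckTopology (aSpace X)
  let S : Sheaf J (ProMod k)ᵒᵖ := ⟨A.obj.op, (isCosheaf_iff_isSheaf_op J A.obj).1 A.property⟩
  let B := (functorToCosheaf X k).obj ((stalk X k).obj A)
  let T : Sheaf J (ProMod k)ᵒᵖ := ⟨B.obj.op, (isCosheaf_iff_isSheaf_op J B.obj).1 B.property⟩
  let α : S ⟶ T := ⟨NatTrans.op (ofStalk A).hom⟩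
  have h₁ : ∀ x, IsIso ((ofStalk A).hom.app (downSet x)) := fun x => by
    have e := inOn_ofStalk A (downSet x) x (mem_downSet x)
    have e' : A.obj.map (homOfLE (downSet_le (mem_downSet x)) : downSet x ⟶ downSet x) = 𝟙 _ :=
      A.obj.map_id _
    have : IsIso (inOn ((stalk X k).obj A) (downSet x) x (mem_downSet x)) :=
      inferInstanceAs (IsIso ((toStalk ((stalk X k).obj A)).app x))
    have h : IsIso (inOn ((stalk X k).obj A) (downSet x) x (mem_downSet x) ≫
        (ofStalk A).hom.app (downSet x)) := by
      rw [e, e']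
      exact IsIso.id (A.obj.obj (downSet x))
    exact IsIso.of_isIso_comp_left (inOn ((stalk X k).obj A) (downSet x) x (mem_downSet x)) _
  have h₂ : IsIso (Functor.whiskerLeft (down X).op α.hom) := by
    have : ∀ x, IsIso ((Functor.whiskerLeft (down X).op α.hom).app x) := fun x => by
      have := h₁ x.unop
      exact inferInstanceAs (IsIso ((ofStalk A).hom.app (downSet x.unop)).op)
    exact NatIso.isIso_of_isIso_app _
  have h₃ : IsIso α := Functor.IsCoverDense.iso_of_restrict_iso (G := down X) α h₂
  have h₄ : IsIso ((sheafToPresheaf J (ProMod k)ᵒᵖ).map α) := inferInstance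
  have h₅ : ∀ U, IsIso ((ofStalk A).hom.app U) := fun U => by
    have h : IsIso (((sheafToPresheaf J (ProMod k)ᵒᵖ).map α).app (op U)) := inferInstance
    have h' : IsIso (((ofStalk A).hom.app U).op) := h
    exact (isIso_op_iff _).1 h'
  have h₆ : IsIso (ofStalk A).hom := NatIso.isIso_of_isIso_app _
  have h₇ : IsIso ((ObjectProperty.ι _).map (ofStalk A)) := h₆
  exact isIso_of_reflects_iso (ofStalk A) (ObjectProperty.ι _)

/-- A cosheaf is determined by its stalks. -/
noncomputable def stalkFunctorToCosheaf (X : Type u) [Preorder X] (k : Type u) [CommRing k] :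
    stalk X k ⋙ functorToCosheaf X k ≅ 𝟭 _ :=
  NatIso.ofComponents (fun A => @asIso _ _ _ _ (ofStalk A) (isIso_ofStalk A)) fun {A B} g => by
    refine ObjectProperty.hom_ext _ (NatTrans.ext (funext fun U => colimOn_hom_ext fun x hx => ?_))
    have h₁ := inOn_functorToCosheaf_map ((stalk X k).map g) U x hx
    refine (Category.assoc _ _ _).symm.trans ((eq_whisker h₁ _).trans ?_)
    refine (Category.assoc _ _ _).trans ((whisker_eq _ (inOn_ofStalk B U x hx)).trans ?_)
    refine Eq.symm ((Category.assoc _ _ _).symm.trans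
      ((eq_whisker (inOn_ofStalk A U x hx) _).trans ?_))
    exact g.hom.naturality _

/-- Functors and cosheaves are equivalent. -/
noncomputable def cosheafEquivalence (X : Type u) [Preorder X] (k : Type u) [CommRing k] :
    (X ⥤ ProMod k) ≌ Cosheaf (aSpace X) k :=
  CategoryTheory.Equivalence.mk (functorToCosheaf X k) (stalk X k) (functorToCosheafStalk X k)
    (stalkFunctorToCosheaf X k)

instance : (functorToCosheaf X k).IsEquivalence :=
  (cosheafEquivalence X k).isEquivalence_functor

instance : (stalk X k).IsEquivalence := (cosheafEquivalence X k).isEquivalence_inverse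

/-- By the dense subsite, sheaves of modules on the space are equivalent to presheaves on X, and
equivalences preserve and reflect injective objects. Pairing with T commutes with taking stalks. -/
theorem isQuasiProjective_iff_stalk (A : Cosheaf (aSpace X) k) :
    A.IsQuasiProjective ↔ IsQuasiProjectiveFunctor ((stalk X k).obj A) := by
  let e := ((down X).sheafPushforwardContinuous (ModuleCat.{u} k) ⊥
    (Opens.grothendieckTopology (aSpace X))).asEquivalence.trans (sheafBotEquivalence _)
  refine forall_congr' fun T => forall_congr' fun _ => ?_
  exact (e.map_injective_iff _).symm

end

/-! ### Transfer of resolutions; cosheaf homology through stalks -/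

namespace ResolutionBy
variable {C D : Type*} [Category* C] [Category* D] [Preadditive C] [Preadditive D]
  {Q : ObjectProperty C} {Q' : ObjectProperty D} {A : C}

/-- The image of a resolution under an additive equivalence. -/
noncomputable def map (P : ResolutionBy Q A) (F : C ⥤ D) [F.Additive] [F.IsEquivalence]
    (h : ∀ X, Q X → Q' (F.obj X)) : ResolutionBy Q' (F.obj A) where
  complex := (F.mapHomologicalComplex _).obj P.complex
  mem n := h _ (P.mem n)
  π := F.map P.π
  w := (F.map_comp _ _).symm.trans ((congrArg F.map P.w).trans (F.map_zero _ _))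
  epi :=
    have := P.epi
    have := Functor.preservesEpimorphisms_of_adjunction F.asEquivalence.toAdjunction
    F.map_epi P.π
  exact_zero := P.exact_zero.map F
  exact_succ n := (P.exact_succ n).map F

/-- A resolution of `A` is one of each object isomorphic to `A`. -/
noncomputable def ofIso (P : ResolutionBy Q A) {A' : C} (e : A ≅ A') : ResolutionBy Q A' where
  complex := P.complex
  mem := P.mem
  π := P.π ≫ e.hom
  w := by rw [← Category.assoc, P.w, zero_comp]
  epi := have := P.epi; inferInstance
  exact_zero :=
    (ShortComplex.exact_iff_of_iso (S₁ := ShortComplex.mk _ _ P.w)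
      (S₂ := ShortComplex.mk (P.complex.d 1 0) (P.π ≫ e.hom)
        (by rw [← Category.assoc, P.w, zero_comp]))
      (ShortComplex.isoMk (Iso.refl _) (Iso.refl _) e (by simp) (by simp))).1 P.exact_zero
  exact_succ := P.exact_succ

end ResolutionBy

section
variable {X Y : Type u} [Preorder X] [Preorder Y] {k : Type u} [CommRing k]

instance : (stalk X k).Additive where
instance : (functorToCosheaf X k).Additive :=
  have : (cosheafEquivalence X k).symm.functor.Additive :=
    inferInstanceAs (stalk X k).Additive
  (cosheafEquivalence X k).symm.inverse_additive

theorem IsQuasiProjectiveFunctor.of_iso {I : Type u} [SmallCategory I] {F G : I ⥤ ProMod k}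
    (hF : IsQuasiProjectiveFunctor F) (e : F ≅ G) : IsQuasiProjectiveFunctor G := fun T hT =>
  have := hF T hT
  Injective.of_iso (Functor.isoWhiskerRight (NatIso.op e).symm (ProMod.pairing T)) this

theorem isQuasiProjective_functorToCosheaf {F : X ⥤ ProMod k} (hF : IsQuasiProjectiveFunctor F) :
    Cosheaf.IsQuasiProjective ((functorToCosheaf X k).obj F) :=
  (isQuasiProjective_iff_stalk _).2 (hF.of_iso ((functorToCosheafStalk X k).app F))

theorem stalkMap_map_comp (f : aSpace X ⟶ aSpace Y) {A A' : Cosheaf (aSpace X) k}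
    {B : Cosheaf (aSpace Y) k} (a : A ⟶ A') (g : (Cosheaf.pushforward k f).obj A' ⟶ B) :
    stalkMap f ((Cosheaf.pushforward k f).map a ≫ g) = (stalk X k).map a ≫ stalkMap f g := by
  refine NatTrans.ext (funext fun x => ?_)
  refine (Category.assoc _ _ _).symm.trans (Eq.trans ?_ (Category.assoc _ _ _))
  exact eq_whisker (a.hom.naturality _) _

theorem stalkMap_comp_map (f : aSpace X ⟶ aSpace Y) {A : Cosheaf (aSpace X) k}
    {B B' : Cosheaf (aSpace Y) k} (g : (Cosheaf.pushforward k f).obj A ⟶ B) (b : B ⟶ B') :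
    stalkMap f (g ≫ b) = stalkMap f g ≫ Functor.whiskerLeft (ptMap f) ((stalk Y k).map b) :=
  NatTrans.ext (funext fun _ => (Category.assoc _ _ _).symm)

/-- Naturality of `g`, carried from the least neighbourhood of f(x) to any open set containing it.
Functoriality of stalks and the comparisons with Γ and with `ofStalk` rest on this square. -/
theorem stalkMap_app_map (f : aSpace X ⟶ aSpace Y) {A : Cosheaf (aSpace X) k}
    {B : Cosheaf (aSpace Y) k} (g : (Cosheaf.pushforward k f).obj A ⟶ B) (U : Opens (aSpace Y))
    (x : X) (hx : WithLowerSet.toLowerSet x ∈ (Opens.map f).obj U) :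
    (stalkMap f g).app x ≫
        B.obj.map (homOfLE (downSet_le hx) : downSet ((ptMap f).obj x) ⟶ U) =
      A.obj.map (homOfLE (downSet_le hx) : downSet x ⟶ (Opens.map f).obj U) ≫ g.hom.app U := by
  have h := g.hom.naturality (homOfLE (downSet_le hx) : downSet ((ptMap f).obj x) ⟶ U)
  refine (Category.assoc _ _ _).trans ((whisker_eq _ h.symm).trans ?_)
  refine (Category.assoc _ _ _).symm.trans (eq_whisker ?_ _)
  exact (A.obj.map_comp _ _).symm

/-- The functor sending a cosheaf on an Alexandroff space to the diagram of its stalks. -/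
noncomputable def stalkDiagram (k : Type u) [CommRing k] : ACosheaf k ⥤ Diagram k where
  obj A := ⟨A.X, (stalk A.X k).obj A.cosheaf⟩
  map u := ⟨ptMap u.base, stalkMap u.base u.fiber⟩
  map_id A := by
    refine congrArg (Diagram.Hom.mk (D := Diagram.mk A.X ((stalk A.X k).obj A.cosheaf))
      (E := Diagram.mk A.X ((stalk A.X k).obj A.cosheaf)) (𝟭 A.X))
      (NatTrans.ext (funext fun x => ?_))
    exact (Category.comp_id _).trans (A.cosheaf.obj.map_id (downSet x))
  map_comp {A B C} u v := by
    refine congrArg (Diagram.Hom.mk (D := Diagram.mk A.X ((stalk A.X k).obj A.cosheaf))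
      (E := Diagram.mk C.X ((stalk C.X k).obj C.cosheaf)) (ptMap u.base ⋙ ptMap v.base))
      (NatTrans.ext (funext fun x => ?_))
    let U := downSet ((ptMap v.base).obj ((ptMap u.base).obj x))
    have h := stalkMap_app_map u.base u.fiber ((Opens.map v.base).obj U) x (mem_downSet _)
    have e : (stalkMap u.base u.fiber ≫ Functor.whiskerLeft (ptMap u.base)
        (stalkMap v.base v.fiber) ≫ (Functor.associator _ _ _).inv).app x =
        (stalkMap u.base u.fiber).app x ≫
          (stalkMap v.base v.fiber).app ((ptMap u.base).obj x) :=
      whisker_eq ((stalkMap u.base u.fiber).app x) (Category.comp_id _)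
    refine Eq.trans ?_ e.symm
    refine Eq.trans ?_ (Category.assoc _ _ _)
    refine Eq.trans ?_ (eq_whisker h.symm _)
    exact (Category.assoc _ _ _).symm

/-- The map from the colimit of the stalks to the global cosections. -/
noncomputable def colimToΓ (X : Type u) [Preorder X] (k : Type u) [CommRing k] :
    stalk X k ⋙ colim ⟶ Cosheaf.Γ k (aSpace X) where
  app A := colimit.desc ((stalk X k).obj A)
    ⟨A.obj.obj ⊤,
      { app := fun x => A.obj.map (homOfLE le_top : downSet x ⟶ ⊤)
        naturality := fun x y f => (A.obj.map_comp _ _).symm.trans (Category.comp_id _).symm }⟩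
  naturality A B g := colimit.hom_ext fun x => by
    refine (Category.assoc _ _ _).symm.trans ((eq_whisker (ι_colimMap _ x) _).trans ?_)
    refine (Category.assoc _ _ _).trans ((whisker_eq _ (colimit.ι_desc _ _)).trans ?_)
    refine Eq.symm ((Category.assoc _ _ _).symm.trans ((eq_whisker (colimit.ι_desc _ _) _).trans ?_))
    exact g.hom.naturality _

theorem ι_colimToΓ (A : Cosheaf (aSpace X) k) (x : X) :
    colimit.ι ((stalk X k).obj A) x ≫ (colimToΓ X k).app A =
      A.obj.map (homOfLE le_top : downSet x ⟶ ⊤) :=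
  colimit.ι_desc _ _

instance : (ptsIncl (⊤ : Opens (aSpace X))).IsEquivalence where
  faithful := ⟨fun _ => Subsingleton.elim _ _⟩
  full := ⟨fun f => ⟨homOfLE f.le, Subsingleton.elim _ _⟩⟩
  essSurj := ⟨fun x => ⟨⟨x, trivial⟩, ⟨Iso.refl _⟩⟩⟩

/-- This is `ofStalk A` over the whole space, up to the equivalence between the points of ⊤ and X.
-/
instance isIso_colimToΓ (A : Cosheaf (aSpace X) k) : IsIso ((colimToΓ X k).app A) := by
  have h : colimit.pre ((stalk X k).obj A) (ptsIncl ⊤) ≫ (colimToΓ X k).app A =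
      (ofStalk A).hom.app ⊤ := colimOn_hom_ext fun x hx => by
    refine Eq.trans ?_ (inOn_ofStalk A ⊤ x hx).symm
    refine (Category.assoc _ _ _).symm.trans ((eq_whisker (colimit.ι_pre _ _ _) _).trans ?_)
    exact ι_colimToΓ A x
  have h₁ : IsIso ((ObjectProperty.ι _).map (ofStalk A)) := inferInstance
  have h₂ : IsIso (((ObjectProperty.ι _).map (ofStalk A)).app ⊤) := inferInstance
  have h₃ : IsIso (colimit.pre ((stalk X k).obj A) (ptsIncl ⊤) ≫ (colimToΓ X k).app A) := by
    rw [h]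
    exact h₂
  exact IsIso.of_isIso_comp_left (colimit.pre ((stalk X k).obj A) (ptsIncl ⊤)) _

instance : IsIso (colimToΓ X k) := NatIso.isIso_of_isIso_app _

/-- The resolution of the stalks given by a resolution of a cosheaf. -/
noncomputable abbrev ACosheaf.Resolution.stalk {A : ACosheaf k} (P : A.Resolution) :
    ((stalkDiagram k).obj A).Resolution :=
  P.map (_root_.stalk A.X k) fun B => (isQuasiProjective_iff_stalk B).1

/-- The colimit of the stalks of a resolution is the complex of global cosections. -/
noncomputable def ACosheaf.Resolution.colimIso {A : ACosheaf k} (P : A.Resolution) :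
    P.stalk.colimComplex ≅ P.ΓComplex :=
  (NatIso.mapHomologicalComplex (asIso (colimToΓ A.X k)) _).app P.complex

/-- The lift of stalks given by a lift of cosheaves. -/
noncomputable def ACosheaf.Lift.stalk {A B : ACosheaf k} {u : A ⟶ B} {P : A.Resolution}
    {Q : B.Resolution} (l : ACosheaf.Lift u P Q) :
    Diagram.Lift ((stalkDiagram k).map u) P.stalk Q.stalk where
  hom :=
    { f := fun n => stalkMap u.base (l.hom.f n)
      comm' := fun i j _ =>
        (stalkMap_comp_map u.base (l.hom.f i) (Q.complex.d i j)).symm.trans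
          ((congrArg (stalkMap u.base) (l.hom.comm i j)).trans
            (stalkMap_map_comp u.base (P.complex.d i j) (l.hom.f j))) }
  w := (stalkMap_comp_map u.base (l.hom.f 0) Q.π).symm.trans
    ((congrArg (stalkMap u.base) l.w).trans (stalkMap_map_comp u.base P.π u.fiber))

theorem ACosheaf.Lift.colimMap_stalk {A B : ACosheaf k} {u : A ⟶ B} {P : A.Resolution}
    {Q : B.Resolution} (l : ACosheaf.Lift u P Q) :
    l.stalk.colimMap ≫ Q.colimIso.hom = P.colimIso.hom ≫ l.ΓMap := by
  refine HomologicalComplex.hom_ext _ _ fun n => colimit.hom_ext fun x => ?_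
  have h₁ := ι_colimDiagram_map (Diagram.Hom.mk (ptMap u.base) (stalkMap u.base (l.hom.f n)) :
    Diagram.mk A.X ((_root_.stalk A.X k).obj (P.complex.X n)) ⟶
      Diagram.mk B.X ((_root_.stalk B.X k).obj (Q.complex.X n))) x
  have h₂ := ι_colimToΓ (Q.complex.X n) ((ptMap u.base).obj x)
  have h₃ := ι_colimToΓ (P.complex.X n) x
  refine (Category.assoc _ _ _).symm.trans ((eq_whisker h₁ _).trans ?_)
  refine (Category.assoc _ _ _).trans ((whisker_eq _ h₂).trans ?_)
  refine Eq.symm ((Category.assoc _ _ _).symm.trans ((eq_whisker h₃ _).trans ?_))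
  exact (stalkMap_app_map u.base (l.hom.f n) ⊤ x trivial).symm

/-- Resolutions and lifts of cosheaves become resolutions and lifts of stalks, with colim in place
of Γ, so the defining property of the higher colimit carries over. -/
theorem isCosheafHomology_stalkDiagram (n : ℕ) :
    IsCosheafHomology n (stalkDiagram k ⋙ higherColim k n) := by
  obtain ⟨e, he⟩ := isHigherColimit_higherColim (k := k) n
  refine ⟨fun A P => e _ P.stalk ≪≫
    (HomologicalComplex.homologyFunctor _ _ n).mapIso P.colimIso, fun A B u P Q l => ?_⟩
  have h₁ := he _ _ _ _ _ l.stalk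
  have h₂ : HomologicalComplex.homologyMap l.stalk.colimMap n ≫
      HomologicalComplex.homologyMap Q.colimIso.hom n =
      HomologicalComplex.homologyMap P.colimIso.hom n ≫
        HomologicalComplex.homologyMap l.ΓMap n := by
    rw [← HomologicalComplex.homologyMap_comp, ← HomologicalComplex.homologyMap_comp]
    exact congrArg (HomologicalComplex.homologyMap · n) l.colimMap_stalk
  refine (Category.assoc _ _ _).symm.trans ((eq_whisker h₁ _).trans ?_)
  refine (Category.assoc _ _ _).trans ((whisker_eq _ h₂).trans ?_)
  exact (Category.assoc _ _ _).symm

theorem isCosheafHomology_cosheafHomology (n : ℕ) :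
    IsCosheafHomology n (cosheafHomology k n) := by
  have h : ∃ H : ACosheaf k ⥤ ProMod k, IsCosheafHomology n H :=
    ⟨_, isCosheafHomology_stalkDiagram n⟩
  unfold cosheafHomology
  rw [dif_pos h]
  exact h.choose_spec

/-- The resolution of a cosheaf given by the one of its stalks. -/
noncomputable def syzCosheafResolution (hk : IsQuasiNoetherian k) (A : ACosheaf k) :
    A.Resolution :=
  ((syzResolution hk ((stalk A.X k).obj A.cosheaf)).map (functorToCosheaf A.X k)
    fun _ => isQuasiProjective_functorToCosheaf).ofIso (asIso (ofStalk A.cosheaf))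

/-- The morphism of cosheaves over a continuous map given by a map of functors. -/
noncomputable def cosheafMap (f : aSpace X ⟶ aSpace Y) {F : X ⥤ ProMod k} {G : Y ⥤ ProMod k}
    (α : F ⟶ ptMap f ⋙ G) :
    (Cosheaf.pushforward k f).obj ((functorToCosheaf X k).obj F) ⟶ (functorToCosheaf Y k).obj G :=
  pushforwardMap (ptMap f) α

theorem inOn_cosheafMap (f : aSpace X ⟶ aSpace Y) {F : X ⥤ ProMod k} {G : Y ⥤ ProMod k}
    (α : F ⟶ ptMap f ⋙ G) (U : Opens (aSpace Y)) (x : X)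
    (hx : WithLowerSet.toLowerSet x ∈ (Opens.map f).obj U) :
    inOn F ((Opens.map f).obj U) x hx ≫ (cosheafMap f α).hom.app U =
      α.app x ≫ inOn G U ((ptMap f).obj x) hx :=
  inOn_pushforwardMap (ptMap f) α U x hx

theorem cosheafMap_comp_map (f : aSpace X ⟶ aSpace Y) {F F' : X ⥤ ProMod k}
    {G G' : Y ⥤ ProMod k} (α : F ⟶ ptMap f ⋙ G) (α' : F' ⟶ ptMap f ⋙ G') (a : F ⟶ F')
    (b : G ⟶ G') (h : α ≫ Functor.whiskerLeft (ptMap f) b = a ≫ α') :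
    cosheafMap f α ≫ (functorToCosheaf Y k).map b =
      (Cosheaf.pushforward k f).map ((functorToCosheaf X k).map a) ≫ cosheafMap f α' := by
  refine ObjectProperty.hom_ext _ (NatTrans.ext (funext fun U => colimOn_hom_ext fun x hx => ?_))
  have h₁ := inOn_cosheafMap f α U x hx
  have h₂ := inOn_cosheafMap f α' U x hx
  have h₃ := inOn_functorToCosheaf_map b U ((ptMap f).obj x) hx
  have h₄ := inOn_functorToCosheaf_map a ((Opens.map f).obj U) x hx
  refine (Category.assoc _ _ _).symm.trans ((eq_whisker h₁ _).trans ?_)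
  refine (Category.assoc _ _ _).trans ((whisker_eq _ h₃).trans ?_)
  refine Eq.symm ((Category.assoc _ _ _).symm.trans ((eq_whisker h₄ _).trans ?_))
  refine (Category.assoc _ _ _).trans ((whisker_eq _ h₂).trans ?_)
  refine (Category.assoc _ _ _).symm.trans (Eq.trans ?_ (Category.assoc _ _ _))
  exact eq_whisker (congrArg (fun z => z.app x) h.symm) _

/-- Needed because the augmentation of `syzCosheafResolution` ends with `ofStalk`. -/
theorem cosheafMap_ofStalk (f : aSpace X ⟶ aSpace Y) {A : Cosheaf (aSpace X) k}
    {B : Cosheaf (aSpace Y) k} (g : (Cosheaf.pushforward k f).obj A ⟶ B) :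
    cosheafMap f (stalkMap f g) ≫ ofStalk B = (Cosheaf.pushforward k f).map (ofStalk A) ≫ g := by
  refine ObjectProperty.hom_ext _ (NatTrans.ext (funext fun U => colimOn_hom_ext fun x hx => ?_))
  have h₁ := inOn_cosheafMap f (stalkMap f g) U x hx
  have h₂ := inOn_ofStalk B U ((ptMap f).obj x) hx
  have h₃ := inOn_ofStalk A ((Opens.map f).obj U) x hx
  refine (Category.assoc _ _ _).symm.trans ((eq_whisker h₁ _).trans ?_)
  refine (Category.assoc _ _ _).trans ((whisker_eq _ h₂).trans ?_)
  refine (stalkMap_app_map f g U x hx).trans ?_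
  exact (eq_whisker h₃.symm _).trans (Category.assoc _ _ _)

/-- The lift of a morphism to the resolutions given by those of the stalks. -/
noncomputable def syzCosheafLift (hk : IsQuasiNoetherian k) {A B : ACosheaf k} (u : A ⟶ B) :
    ACosheaf.Lift u (syzCosheafResolution hk A) (syzCosheafResolution hk B) where
  hom :=
    { f := fun n => cosheafMap u.base ((syzLift hk ((stalkDiagram k).map u)).hom.f n)
      comm' := fun i j _ => cosheafMap_comp_map u.base _ _ _ _
        ((syzLift hk ((stalkDiagram k).map u)).hom.comm i j) }
  w := by
    have h₁ := cosheafMap_comp_map u.base _ _ _ _ (syzLift hk ((stalkDiagram k).map u)).w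
    have h₂ := cosheafMap_ofStalk u.base u.fiber
    refine (Category.assoc _ _ _).symm.trans ((eq_whisker h₁ _).trans ?_)
    refine (Category.assoc _ _ _).trans ((whisker_eq _ h₂).trans ?_)
    refine (Category.assoc _ _ _).symm.trans (eq_whisker ?_ _)
    exact ((Cosheaf.pushforward k u.base).map_comp _ _).symm

theorem IsCosheafHomology.iso (hk : IsQuasiNoetherian k) {n : ℕ} {H H' : ACosheaf k ⥤ ProMod k}
    (h : IsCosheafHomology n H) (h' : IsCosheafHomology n H') : Nonempty (H ≅ H') := by
  obtain ⟨e, he⟩ := h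
  obtain ⟨e', he'⟩ := h'
  refine ⟨NatIso.ofComponents (fun A => e A (syzCosheafResolution hk A) ≪≫
    (e' A (syzCosheafResolution hk A)).symm) fun {A B} u => ?_⟩
  have h₁ := he A B u _ _ (syzCosheafLift hk u)
  have h₂ := he' A B u _ _ (syzCosheafLift hk u)
  simp only [Iso.trans_hom, Iso.symm_hom, ← Category.assoc, Iso.comp_inv_eq, h₁]
  simp [h₂]

end

/-! ### Comparison of the two theories; invariance under equivalences -/

section
variable {k : Type u} [CommRing k]

/-- The stalks of `𝓕` form the diagram `F`, naturally in the preordered set. -/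
noncomputable def stalkDiagramIso (k : Type u) [CommRing k] :
    inducedFunctor PreDiagramData.toDiagram ≅ preDiagramToACosheaf k ⋙ stalkDiagram k :=
  NatIso.ofComponents
    (fun D => (Diagram.incl D.X).mapIso ((functorToCosheafStalk D.X k).app D.functor))
    fun {D E} u => by
      refine (Diagram.incl_map_comp_mk (φ := u.hom.base) (toStalk D.functor) (toStalk E.functor)
        u.hom.fiber (stalkMap (aMap u.hom.base) (pushforwardMap u.hom.base u.hom.fiber)) ?_).symm
      refine NatTrans.ext (funext fun x => ?_)
      have h := map_inOn_colimPrecosheaf D.functor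
        (homOfLE (downSet_le (mem_downSet (u.hom.base.obj x))) :
          downSet x ⟶ (Opens.map (aMap u.hom.base)).obj (downSet (u.hom.base.obj x)))
        x (mem_downSet x)
      refine (Category.assoc _ _ _).symm.trans ((eq_whisker h _).trans ?_)
      exact inOn_pushforwardMap u.hom.base u.hom.fiber (downSet (u.hom.base.obj x)) x _

theorem nonempty_cosheafHomology_iso (hk : IsQuasiNoetherian k) (n : ℕ) :
    Nonempty (cosheafHomology k n ≅ stalkDiagram k ⋙ higherColim k n) :=
  (isCosheafHomology_cosheafHomology n).iso hk (isCosheafHomology_stalkDiagram n)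

theorem nonempty_higherColim_iso (hk : IsQuasiNoetherian k) (n : ℕ) :
    Nonempty (inducedFunctor PreDiagramData.toDiagram ⋙ higherColim k n ≅
      preDiagramToACosheaf k ⋙ cosheafHomology k n) := by
  obtain ⟨e⟩ := nonempty_cosheafHomology_iso hk n
  exact ⟨Functor.isoWhiskerRight (stalkDiagramIso k) _ ≪≫ Functor.associator _ _ _ ≪≫
    Functor.isoWhiskerLeft _ e.symm⟩

theorem IsQuasiProjectiveFunctor.comp_equivalence {I J : Type u} [SmallCategory I]
    [SmallCategory J] (φ : I ⥤ J) [φ.IsEquivalence] {F : J ⥤ ProMod k}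
    (hF : IsQuasiProjectiveFunctor F) : IsQuasiProjectiveFunctor (φ ⋙ F) := fun T hT =>
  (((Functor.whiskeringLeft Iᵒᵖ Jᵒᵖ (ModuleCat.{u} k)).obj φ.op).asEquivalence.map_injective_iff
    (F.op ⋙ ProMod.pairing T)).2 (hF T hT)

/-- A resolution of the target, restricted along the equivalence, resolves the source, and colimits
do not change under restriction along an equivalence. -/
theorem isIso_higherColim_map (hk : IsQuasiNoetherian k) (n : ℕ) {D E : Diagram k} (u : D ⟶ E)
    [u.base.IsEquivalence] [IsIso u.fiber] : IsIso ((higherColim k n).map u) := by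
  obtain ⟨e, he⟩ := isHigherColimit_higherColim (k := k) n
  let Q : E.Resolution := syzResolution hk E.functor
  let P : D.Resolution :=
    (Q.map ((Functor.whiskeringLeft D.I E.I (ProMod k)).obj u.base)
      fun _ h => h.comp_equivalence u.base).ofIso (asIso u.fiber).symm
  -- The complex of `P` is by construction the restriction of that of `Q`, so the identity is a
  -- lift.
  let l : Diagram.Lift u P Q :=
    { hom := 𝟙 _
      w := (Category.id_comp _).trans
        ((Category.comp_id _).symm.trans ((whisker_eq _ (IsIso.inv_hom_id u.fiber).symm).trans
          (Category.assoc _ _ _).symm)) }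
  have h₁ : ∀ i, IsIso (l.colimMap.f i) := fun i => by
    have h₀ : IsIso (colimit.pre (show E.I ⥤ ProMod k from Q.complex.X i) u.base) := inferInstance
    have h : l.colimMap.f i = colimit.pre (Q.complex.X i) u.base :=
      (eq_whisker (colim.map_id (u.base ⋙ Q.complex.X i)) _).trans (Category.id_comp _)
    rw [h]
    exact h₀
  have h₂ : IsIso l.colimMap := HomologicalComplex.Hom.isIso_of_components _
  have h₃ : IsIso ((higherColim k n).map u ≫ (e E Q).hom) := by
    rw [he D E u P Q l]
    infer_instance
  exact IsIso.of_isIso_comp_right _ (e E Q).hom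

end

/-! ### The quotient partially ordered set -/

section
variable {X : Type u} [Preorder X] {k : Type u} [CommRing k]

instance : (hatν X).IsEquivalence where
  faithful := ⟨fun _ => Subsingleton.elim _ _⟩
  full := ⟨fun f => ⟨homOfLE (toAntisymmetrization_le_toAntisymmetrization_iff.1 f.le),
    Subsingleton.elim _ _⟩⟩
  essSurj := ⟨fun x => Quotient.inductionOn x fun x => ⟨x, ⟨Iso.refl _⟩⟩⟩

theorem map_hatν_downSet (x : X) :
    (Opens.map (hatνTop X)).obj (downSet ((hatν X).obj x)) = downSet x :=
  Opens.ext (Set.ext fun _ => toAntisymmetrization_le_toAntisymmetrization_iff)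

/-- The least neighbourhood of the class of x has the least neighbourhood of x as preimage, so each
component is the image under A of an isomorphism of open sets. -/
instance isIso_stalkMap_hatν (A : Cosheaf (aSpace X) k) :
    IsIso (stalkMap (hatνTop X) (𝟙 ((Cosheaf.pushforward k (hatνTop X)).obj A))) := by
  have : ∀ x, IsIso ((stalkMap (hatνTop X)
      (𝟙 ((Cosheaf.pushforward k (hatνTop X)).obj A))).app x) := fun x => by
    have h₁ : IsIso (homOfLE (downSet_le (mem_downSet ((hatν X).obj x))) :
        downSet x ⟶ (Opens.map (hatνTop X)).obj (downSet ((hatν X).obj x))) :=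
      ⟨eqToHom (map_hatν_downSet x), Subsingleton.elim _ _, Subsingleton.elim _ _⟩
    have h₂ : IsIso (A.obj.map (homOfLE (downSet_le (mem_downSet ((hatν X).obj x))) :
        downSet x ⟶ (Opens.map (hatνTop X)).obj (downSet ((hatν X).obj x)))) := inferInstance
    exact IsIso.comp_isIso' h₂ (IsIso.id _)
  exact NatIso.isIso_of_isIso_app _

/-- Passing to the quotient partially ordered set does not change the stalks. -/
noncomputable def stalkHatIso (X : Type u) [Preorder X] (k : Type u) [CommRing k] :
    stalk X k ≅ Cosheaf.pushforward k (hatνTop X) ⋙ stalk (Hat X) k ⋙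
      (Functor.whiskeringLeft X (Hat X) (ProMod k)).obj (hatν X) :=
  NatIso.ofComponents
    (fun A => @asIso _ _ _ _
      (stalkMap (hatνTop X) (𝟙 ((Cosheaf.pushforward k (hatνTop X)).obj A)))
      (isIso_stalkMap_hatν A)) fun {A B} g => by
    refine (stalkMap_map_comp (hatνTop X) g (𝟙 _)).symm.trans ?_
    refine Eq.trans ?_ (stalkMap_comp_map (hatνTop X) (𝟙 _)
      ((Cosheaf.pushforward k (hatνTop X)).map g))
    exact congrArg (stalkMap (hatνTop X)) ((Category.comp_id _).trans (Category.id_comp _).symm)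

/-- Cancellation of equivalences: both stalk functors and restriction along `hatν X` are
equivalences, and `stalkHatIso` relates them to the pushforward. -/
instance : (Cosheaf.pushforward k (hatνTop X)).IsEquivalence := by
  have h : (Cosheaf.pushforward k (hatνTop X) ⋙ stalk (Hat X) k ⋙
      (Functor.whiskeringLeft X (Hat X) (ProMod k)).obj (hatν X)).IsEquivalence :=
    Functor.isEquivalence_of_iso (stalkHatIso X k)
  exact Functor.isEquivalence_of_comp_right _ (stalk (Hat X) k ⋙
      (Functor.whiskeringLeft X (Hat X) (ProMod k)).obj (hatν X))

/-- On stalks the projection lies over the equivalence `hatν` with invertible fibre, so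
`isIso_higherColim_map` applies. -/
theorem isIso_cosheafHomology_toHat (hk : IsQuasiNoetherian k) (n : ℕ) :
    IsIso (Functor.whiskerRight (toHat k) (cosheafHomology k n)) := by
  obtain ⟨e⟩ := nonempty_cosheafHomology_iso hk n
  have : ∀ A, IsIso ((Functor.whiskerRight (toHat k) (cosheafHomology k n)).app A) := fun A => by
    have h₁ : ((stalkDiagram k).map ((toHat k).app A)).base.IsEquivalence :=
      inferInstanceAs (hatν A.X).IsEquivalence
    have h₂ : IsIso ((stalkDiagram k).map ((toHat k).app A)).fiber :=
      isIso_stalkMap_hatν A.cosheaf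
    have h₃ := isIso_higherColim_map hk n ((stalkDiagram k).map ((toHat k).app A))
    exact (NatIso.isIso_map_iff e ((toHat k).app A)).2 h₃
  exact NatIso.isIso_of_isIso_app _

end

theorem mainTheorem6 (k : Type u) [CommRing k] (hk : IsQuasiNoetherian k) :
    -- every diagram and every cosheaf has a quasi-projective resolution; the left satellites of
    -- `colim` and of `Γ` exist and are unique
    ((∀ D : Diagram k, Nonempty D.Resolution) ∧
      (∀ A : ACosheaf k, Nonempty A.Resolution) ∧
      ∀ n : ℕ, IsHigherColimit n (higherColim k n) ∧ IsCosheafHomology n (cosheafHomology k n) ∧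
        (∀ L : Diagram k ⥤ ProMod k, IsHigherColimit n L → Nonempty (L ≅ higherColim k n)) ∧
        (∀ H : ACosheaf k ⥤ ProMod k, IsCosheafHomology n H →
          Nonempty (H ≅ cosheafHomology k n))) ∧
    -- functors and cosheaves
    (∀ (X : Type u) [Preorder X], (functorToCosheaf X k).IsEquivalence) ∧
    -- `colim_n F ≅ H_n(X, 𝓕)`, naturally in `X` and `F`
    (∀ n : ℕ, Nonempty (inducedFunctor PreDiagramData.toDiagram ⋙ higherColim k n ≅
      preDiagramToACosheaf k ⋙ cosheafHomology k n)) ∧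
    -- the bar construction
    (∀ (I : Type u) [SmallCategory I] (n : ℕ),
      Nonempty (Diagram.incl I ⋙ higherColim k n ≅
        barComplex k I ⋙ HomologicalComplex.homologyFunctor (ProMod k) _ n)) ∧
    -- passage to the quotient partially ordered set
    (∀ (X : Type u) [Preorder X], (Cosheaf.pushforward k (hatνTop X)).IsEquivalence) ∧
    (∀ n : ℕ, IsIso (Functor.whiskerRight (toHat k) (cosheafHomology k n))) ∧
    (∀ (X : Type u) [Preorder X] (F : Hat X ⥤ ProMod k) (n : ℕ),
      IsIso ((higherColim k n).map
        (Diagram.Hom.mk (hatν X) (𝟙 _) :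
          (⟨X, hatν X ⋙ F⟩ : Diagram k) ⟶ ⟨Hat X, F⟩))) := by
  refine ⟨⟨fun D => ⟨syzResolution hk D.functor⟩, fun A => ⟨syzCosheafResolution hk A⟩,
    fun n => ⟨isHigherColimit_higherColim n, isCosheafHomology_cosheafHomology n,
      fun L hL => hL.iso hk (isHigherColimit_higherColim n),
      fun H hH => hH.iso hk (isCosheafHomology_cosheafHomology n)⟩⟩,
    fun X _ => inferInstance, nonempty_higherColim_iso hk, fun I _ n => nonempty_bar_iso hk I n,
    fun X _ => inferInstance, isIso_cosheafHomology_toHat hk, fun X _ F n => ?_⟩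
  let u : (⟨X, hatν X ⋙ F⟩ : Diagram k) ⟶ ⟨Hat X, F⟩ := Diagram.Hom.mk (hatν X) (𝟙 _)
  have : u.base.IsEquivalence := inferInstanceAs (hatν X).IsEquivalence
  have : IsIso u.fiber := IsIso.id (hatν X ⋙ F)
  exact isIso_higherColim_map hk n u
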